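/- Let $n\ge 1$ be an integer, $h=1/n$, $x_j=j/n$ $(0\le j\le n)$, $K_j=(x_{j-1},x_j)$, $k\ge 1$ with $kh\le 1$, let $\gamma$ be a real number with $0<|\gamma|\le \frac16$, and let $f\in L^2(0,1)$ be complex-valued. Write $(v,w)=\int_0^1 v\bar w\,dx$ and $\|w\|=\sqrt{(w,w)}$. Let $u\in H^2(0,1)$ be the solution of $$u''+k^2u=-f \ \text{ in } (0,1),\qquad u(0)=0,\qquad u'(1)-\mathrm{i}ku(1)=0 .$$ With $[w]_j=w(x_j-)-w(x_j+)$ put $$a_h(v,w)=(v',w')-k^2(v,w)-\mathrm{i}kv(1)\bar w(1)+\sum_{j=1}^{n-1}\gamma h[v']_j[\bar w']_j+\gamma h\,(v'(1)-\mathrm{i}kv(1))(\bar w'(1)-\mathrm{i}k\bar w(1)),$$ where $v',w'$ denote piecewise derivatives and $v'(1),w'(1)$ are one-sided. Let $V_h$ be the space of continuous $v_h:[0,1]\to\mathbb C$ with $v_h(0)=0$ that are affine on each $K_j$, and let the CIP-FEM solution $u_h\in V_h$ be defined by $a_h(u_h,v_h)=(f,v_h)$ for all $v_h\in V_h$. Put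 $$\|v\|_{1,h}=\Big(\|v'\|^2+\sum_{j=1}^{n-1}|\gamma|h\,|[v']_j|^2\Big)^{1/2}.$$ With $t=kh$, let $k_h^-=\frac1h\arccos\!\Big(\frac{4\gamma+1+\frac{t^2}{6}-\sqrt{(1+\frac{t^2}{6})^2+4\gamma t^2}}{4\gamma}\Big)$ be the discrete wave number and $\gamma_o=\dfrac{6\cos t-6+t^2\cos t+2t^2}{12(1-\cos t)^2}$. Then $u_h$ exists and is unique, and there is a constant $C>0$, independent of $k,n,\gamma,f$, such that $$\|u-u_h\|_{1,h}\le C\,(kh+|k_h^--k|)\,\|f\|,\qquad (kh+|k_h^--k|)\,\|f\|\le C\,(kh+k^3h^2)\,\|f\| .$$ If, furthermore, $\gamma=-\frac1{12}$, then $\|u-u_h\|_{1,h}\le C\,(kh+k^5h^4)\,\|f\|$ with $C$ independent of $k,n,f$. For every $C_0>0$ there is a constant $C>0$, depending only on $C_0$, such that $|\gamma-\gamma_o|\le \dfrac{C_0}{k^2h}$ implies $$\|u-u_h\|_{1,h}\le C\,kh\,\|f\| .$$ -/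

import Mathlib

open MeasureTheory Set
open scoped ContDiff ComplexConjugate

namespace CIPFEM

noncomputable section

/-- Square integrability over the interval `(0, 1)`. -/
def MemL2 (v : ℝ → ℂ) : Prop :=
  MemLp v 2 (volume.restrict (Ioo (0 : ℝ) 1))

/-- The `L²(0,1)` norm (meaningful for `v` with `MemL2 v`). -/
def l2norm (v : ℝ → ℂ) : ℝ :=
  Real.sqrt (∫ x in Ioo (0 : ℝ) 1, ‖v x‖ ^ 2)

/-- The `L²(0,1)` inner product `(v, w) = ∫ v w̄`. -/
def l2inner (v w : ℝ → ℂ) : ℂ :=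
  ∫ x in Ioo (0 : ℝ) 1, v x * conj (w x)

/-- `w` is the weak derivative of `v` on `(0, 1)`: integration by parts against all smooth
test functions with compact support in `(0, 1)`. -/
def HasWeakDeriv (v w : ℝ → ℂ) : Prop :=
  ∀ φ : ℝ → ℝ, ContDiff ℝ ∞ φ → HasCompactSupport φ → tsupport φ ⊆ Ioo (0 : ℝ) 1 →
    ∫ x in Ioo (0 : ℝ) 1, ((deriv φ x : ℝ) : ℂ) * v x
      = -∫ x in Ioo (0 : ℝ) 1, ((φ x : ℝ) : ℂ) * w x

/-- `u ∈ H²(0,1)` solves `u'' + k² u = -f` in `(0,1)`, `u(0) = 0`, `u'(1) - i k u(1) = 0`.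
Here `u` and its weak derivative `du` are represented by their continuous representatives
on `[0, 1]`, which give the boundary values their meaning. -/
def IsHelmholtzSolution (k : ℝ) (f u : ℝ → ℂ) : Prop :=
  ∃ du d2u : ℝ → ℂ,
    ContinuousOn u (Icc 0 1) ∧ ContinuousOn du (Icc 0 1) ∧
    MemL2 u ∧ MemL2 du ∧ MemL2 d2u ∧
    HasWeakDeriv u du ∧ HasWeakDeriv du d2u ∧
    (∀ᵐ x ∂(volume.restrict (Ioo (0 : ℝ) 1)), d2u x + (k : ℂ) ^ 2 * u x = -f x) ∧
    u 0 = 0 ∧ du 1 - Complex.I * k * u 1 = 0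

/-- The step size `h = 1/n`. -/
def step (n : ℕ) : ℝ := 1 / (n : ℝ)

/-- The mesh node `x_j = j/n`. -/
def node (n j : ℕ) : ℝ := (j : ℝ) / (n : ℝ)

/-- The jump `[v']_j = v'(x_j -) - v'(x_j +)` of the derivative at the node `x_j`. -/
def derivJump (n : ℕ) (v : ℝ → ℂ) (j : ℕ) : ℂ :=
  Function.leftLim (deriv v) (node n j) - Function.rightLim (deriv v) (node n j)

/-- The boundary value `v'(1)`, taken from inside the interval. -/
def derivAtOne (v : ℝ → ℂ) : ℂ := Function.leftLim (deriv v) 1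

/-- The penalty form `J(u, v)`. -/
def penalty (k γ : ℝ) (n : ℕ) (u v : ℝ → ℂ) : ℂ :=
  (∑ j ∈ Finset.Ico 1 n, (γ : ℂ) * (step n : ℂ) * derivJump n u j * conj (derivJump n v j))
    + (γ : ℂ) * (step n : ℂ) * (derivAtOne u - Complex.I * k * u 1)
        * (conj (derivAtOne v) - Complex.I * k * conj (v 1))

/-- The sesquilinear form `a_h(u, v) = (u', v') - k² (u, v) - i k u(1) v̄(1) + J(u, v)`. -/
def cipForm (k γ : ℝ) (n : ℕ) (u v : ℝ → ℂ) : ℂ :=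
  l2inner (deriv u) (deriv v) - (k : ℂ) ^ 2 * l2inner u v
    - Complex.I * k * u 1 * conj (v 1) + penalty k γ n u v

/-- The finite element space `V_h`: continuous functions on `[0, 1]`, vanishing at `0`, that are
affine on each open element `(x_j, x_{j+1})`. Only the values on `[0, 1]` matter. -/
def MemFESpace (n : ℕ) (v : ℝ → ℂ) : Prop :=
  ContinuousOn v (Icc 0 1) ∧ v 0 = 0 ∧
    ∀ j < n, ∃ a b : ℂ, ∀ x ∈ Ioo (node n j) (node n (j + 1)), v x = a + b * x

/-- `uh ∈ V_h` is a CIP finite element solution: `a_h(uh, vh) = (f, vh)` for all `vh ∈ V_h`. -/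
def IsCIPSolution (k γ : ℝ) (n : ℕ) (f uh : ℝ → ℂ) : Prop :=
  MemFESpace n uh ∧ ∀ vh : ℝ → ℂ, MemFESpace n vh → cipForm k γ n uh vh = l2inner f vh

/-- The discrete `H¹` seminorm `‖v‖_{1,h}`. -/
def seminorm1h (γ : ℝ) (n : ℕ) (v : ℝ → ℂ) : ℝ :=
  Real.sqrt (l2norm (deriv v) ^ 2
    + ∑ j ∈ Finset.Ico 1 n, |γ| * step n * ‖derivJump n v j‖ ^ 2)

/-- The root `cos t_h⁻` of the discrete dispersion relation, as a function of `γ` and `t = k h`. -/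
def cosMinus (γ t : ℝ) : ℝ :=
  (4 * γ + 1 + t ^ 2 / 6 - Real.sqrt ((1 + t ^ 2 / 6) ^ 2 + 4 * γ * t ^ 2)) / (4 * γ)

/-- The discrete wave number `k_h⁻ = t_h⁻ / h`. -/
def discreteWavenumber (k γ : ℝ) (n : ℕ) : ℝ :=
  Real.arccos (cosMinus γ (k * step n)) / step n

/-- The optimal penalty parameter `γ_o` as a function of `t = k h`. -/
def gammaOpt (t : ℝ) : ℝ :=
  (6 * Real.cos t - 6 + t ^ 2 * Real.cos t + 2 * t ^ 2) / (12 * (1 - Real.cos t) ^ 2)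

/-- Standing conditions on the parameters: at least one element, `k ≥ 1`, `k h ≤ 1`,
`0 < |γ| ≤ 1/6`. -/
def Admissible (k γ : ℝ) (n : ℕ) : Prop :=
  1 ≤ n ∧ 1 ≤ k ∧ k * step n ≤ 1 ∧ 0 < |γ| ∧ |γ| ≤ 1 / 6

end

end CIPFEM

/-! Let `L` be the second difference `(LU)_j = 2U_j - U_{j-1} - U_{j+1}`. Tested with hat functions
and multiplied by `h`, the method becomes, for the nodal values `U` and the scaled jumps `D = LU`,
the fourth-order difference equation `γ L²U + (1 + t²/6) LU - t² U = F` with `t = kh`. Its symbol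
has the small root `σ = 2 - 2 cos t_h⁻`, and with `β = 1 + t²/6 + γσ`, `βσ = t²`, the operator
factors as `(L - σ)(γL + β)`.

The two factors are inverted separately. The high part `D - σU` satisfies `(γL + β)w = F`, which is
diagonally dominant for `|γ| ≤ 1/6`, so it is controlled by the load in `ℓ¹` and `ℓ²`
(`norm_high_le`, `high_sq_sum_le`). The low part `Z = βU + γD` satisfies `2 cos θ Z_j - Z_{j-1} -
Z_{j+1} = F` with `θ = t_h⁻`, a discrete Helmholtz equation bounded by splitting it into one-way
recursions (`recursion_bounds`). At `x = 1` the outgoing condition for `Z` holds up to a defect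
small enough to be absorbed (`low_last`, `stability_last`). The resulting stability gives
uniqueness, hence existence.

For the error, let `ũ` be the continuous solution with wave number `k_h⁻` instead of `k`. At the
nodes `ũ` satisfies exactly the recursion of `Z`, with sine weights in place of hat functions in the
load, and the exact outgoing condition; so `Z - ũ` is small (`norm_low_sub_wave_le`), and so is `U -
ũ` in the energy sense (`sum_sq_error_le`). The rest is `u' - ũ'`, bounded by `|k - k_h⁻|` through
explicit formulas (`norm_waveDeriv_sub_le`), and the interpolation error of `ũ`, of order `kh`.

The special choices of `γ` affect only `k_h⁻ - k`, which is controlled by the residual of the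
discrete dispersion relation at the exact phase `t` (`abs_phase_sub_le`). This residual is `O(t⁴)`
in general, `O(t⁶)` for `γ = -1/12`, and proportional to `γ - γ_o`. -/

namespace CIPFEM

open Filter Topology

/-- The propagating root `σ = 2 - 2 cos t_h⁻` of the discrete dispersion relation. -/
noncomputable def symbolRoot (γ t : ℝ) : ℝ := 2 - 2 * cosMinus γ t

/-- The phase advance `t_h⁻ = k_h⁻ h` per element. -/
noncomputable def phase (γ t : ℝ) : ℝ := Real.arccos (cosMinus γ t)

/-! ### The discrete dispersion relation. -/

section Parameters

variable {γ t : ℝ}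

/-- With `r` the square root in `cosMinus`, `β` is the mean of `1 + t²/6` and `r`. The bound `|γ| ≤
1/6` enters through `r² ≥ (1 + t²/6)² - 2t²/3 = (1 - t²/6)²`, which gives `β ≥ 1`. -/
theorem symbolRoot_spec (hγ : 0 < |γ|) (hγ6 : |γ| ≤ 1 / 6) (ht0 : 0 < t) (ht1 : t ≤ 1) :
    (1 + t ^ 2 / 6 + γ * symbolRoot γ t) * symbolRoot γ t = t ^ 2 ∧
      1 ≤ 1 + t ^ 2 / 6 + γ * symbolRoot γ t ∧
      1 + t ^ 2 / 6 + γ * symbolRoot γ t ≤ 1 + t ^ 2 / 3 := by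
  have hγ0 : γ ≠ 0 := abs_pos.1 hγ
  obtain ⟨hl, hu⟩ := abs_le.1 hγ6
  have ht2 : t ^ 2 ≤ 1 := by nlinarith
  have ht2' : 0 < t ^ 2 := by positivity
  set r := Real.sqrt ((1 + t ^ 2 / 6) ^ 2 + 4 * γ * t ^ 2) with hr
  have hr2 : r ^ 2 = (1 + t ^ 2 / 6) ^ 2 + 4 * γ * t ^ 2 :=
    Real.sq_sqrt (by nlinarith)
  have hr0 : 0 ≤ r := Real.sqrt_nonneg _
  have hσ : 2 * γ * symbolRoot γ t = r - (1 + t ^ 2 / 6) := by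
    unfold symbolRoot cosMinus
    rw [← hr]; field_simp; ring
  have h1 : 1 - t ^ 2 / 6 ≤ r := by
    refine abs_le_of_sq_le_sq' ?_ hr0 |>.2
    rw [hr2]; nlinarith
  have h2 : r ≤ 1 + t ^ 2 / 2 := by
    refine abs_le_of_sq_le_sq' ?_ (by positivity) |>.2
    rw [hr2]; nlinarith
  refine ⟨?_, by linarith, by linarith⟩
  have : γ * ((1 + t ^ 2 / 6 + γ * symbolRoot γ t) * symbolRoot γ t) = γ * t ^ 2 := by
    have h4 : γ * symbolRoot γ t = (r - (1 + t ^ 2 / 6)) / 2 := by linarith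
    calc γ * ((1 + t ^ 2 / 6 + γ * symbolRoot γ t) * symbolRoot γ t)
        = (1 + t ^ 2 / 6 + γ * symbolRoot γ t) * (γ * symbolRoot γ t) := by ring
      _ = γ * t ^ 2 := by rw [h4]; nlinarith
  exact mul_left_cancel₀ hγ0 this

/-- `σ = t²/β` with `1 ≤ β ≤ 4/3`. -/
theorem symbolRoot_bounds (hγ : 0 < |γ|) (hγ6 : |γ| ≤ 1 / 6) (ht0 : 0 < t) (ht1 : t ≤ 1) :
    3 / 4 * t ^ 2 ≤ symbolRoot γ t ∧ symbolRoot γ t ≤ t ^ 2 := by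
  obtain ⟨h1, h2, h3⟩ := symbolRoot_spec hγ hγ6 ht0 ht1
  have ht2 : t ^ 2 ≤ 1 := by nlinarith
  have ht2' : 0 < t ^ 2 := by positivity
  have hpos : 0 < symbolRoot γ t := by
    by_contra h
    nlinarith
  constructor
  · nlinarith
  · nlinarith

theorem cos_phase (hγ : 0 < |γ|) (hγ6 : |γ| ≤ 1 / 6) (ht0 : 0 < t) (ht1 : t ≤ 1) :
    Real.cos (phase γ t) = 1 - symbolRoot γ t / 2 := by
  obtain ⟨h1, h2⟩ := symbolRoot_bounds hγ hγ6 ht0 ht1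
  have h : cosMinus γ t = 1 - symbolRoot γ t / 2 := by unfold symbolRoot; ring
  unfold phase
  rw [h, Real.cos_arccos (by nlinarith) (by nlinarith)]

theorem sin_phase_bounds (hγ : 0 < |γ|) (hγ6 : |γ| ≤ 1 / 6) (ht0 : 0 < t) (ht1 : t ≤ 1) :
    3 / 4 * t ≤ Real.sin (phase γ t) ∧ Real.sin (phase γ t) ≤ t ∧
      Real.sin (phase γ t) ^ 2 = symbolRoot γ t - symbolRoot γ t ^ 2 / 4 := by
  obtain ⟨h1, h2⟩ := symbolRoot_bounds hγ hγ6 ht0 ht1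
  have hs : 0 ≤ Real.sin (phase γ t) :=
    Real.sin_nonneg_of_nonneg_of_le_pi (Real.arccos_nonneg _) (Real.arccos_le_pi _)
  have hs2 : Real.sin (phase γ t) ^ 2 = symbolRoot γ t - symbolRoot γ t ^ 2 / 4 := by
    have := Real.sin_sq_add_cos_sq (phase γ t)
    rw [cos_phase hγ hγ6 ht0 ht1] at this
    linarith
  have ht2 : t ^ 2 ≤ 1 := by nlinarith
  refine ⟨?_, ?_, hs2⟩
  · refine abs_le_of_sq_le_sq' ?_ hs |>.2
    rw [hs2]
    nlinarith [mul_nonneg (sub_nonneg.2 h1) (by nlinarith : 0 ≤ 1 - symbolRoot γ t / 4)]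
  · refine abs_le_of_sq_le_sq' ?_ ht0.le |>.2
    rw [hs2]; nlinarith [sq_nonneg (symbolRoot γ t)]

theorem phase_bounds (hγ : 0 < |γ|) (hγ6 : |γ| ≤ 1 / 6) (ht0 : 0 < t) (ht1 : t ≤ 1) :
    3 / 4 * t ≤ phase γ t ∧ phase γ t ≤ 2 * t ∧ phase γ t ≤ Real.pi / 2 := by
  obtain ⟨h1, h2, -⟩ := sin_phase_bounds hγ hγ6 ht0 ht1
  have h0 : 0 ≤ phase γ t := Real.arccos_nonneg _
  have hpi : phase γ t ≤ Real.pi / 2 := by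
    refine Real.arccos_le_pi_div_two.2 ?_
    have h : cosMinus γ t = 1 - symbolRoot γ t / 2 := by unfold symbolRoot; ring
    rw [h]
    nlinarith [(symbolRoot_bounds hγ hγ6 ht0 ht1).2]
  refine ⟨h1.trans (Real.sin_le h0), ?_, hpi⟩
  have h3 := Real.mul_le_sin h0 hpi
  have hp : 1 / 2 ≤ 2 / Real.pi := by
    rw [div_le_div_iff₀ two_pos Real.pi_pos]; linarith [Real.pi_le_four]
  nlinarith

/-- These coefficients measure how far the numerical condition at `x = 1` is from the outgoing
condition of the discrete wave. They are of third order because `βσ = t²` turns `β(t² - sin²θ)` into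
`t²(β - 1 + σ/4)`, which is then divided by `t + sin θ ≥ 7t/4`. -/
theorem boundary_coefficient_bounds (hγ : 0 < |γ|) (hγ6 : |γ| ≤ 1 / 6) (ht0 : 0 < t)
    (ht1 : t ≤ 1) :
    |(1 + t ^ 2 / 6 + γ * symbolRoot γ t) * (t - Real.sin (phase γ t)) - t ^ 3 / 6| ≤ t ^ 3 / 6 ∧
      |t - Real.sin (phase γ t)| ≤ t ^ 3 / 3 := by
  obtain ⟨h1, h2, h3⟩ := symbolRoot_spec hγ hγ6 ht0 ht1
  obtain ⟨h4, h5⟩ := symbolRoot_bounds hγ hγ6 ht0 ht1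
  obtain ⟨s1, s2, s3⟩ := sin_phase_bounds hγ hγ6 ht0 ht1
  obtain ⟨hl, hu⟩ := abs_le.1 hγ6
  set σ := symbolRoot γ t
  set s := Real.sin (phase γ t)
  set β := 1 + t ^ 2 / 6 + γ * σ with hβ
  have hσ0 : 0 ≤ σ := le_trans (by positivity) h4
  have e1 : β * (t - s) * (t + s) = t ^ 2 * (t ^ 2 / 6 + γ * σ + σ / 4) := by
    have : β * (t - s) * (t + s) = β * t ^ 2 - β * s ^ 2 := by ring
    rw [this, s3]
    have : β * (σ - σ ^ 2 / 4) = (β * σ) - (β * σ) * σ / 4 := by ring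
    rw [this, h1, hβ]; ring
  have e2 : β * (t - s) * (t + s) ≤ 7 / 12 * t ^ 4 := by
    rw [e1]
    have : t ^ 2 / 6 + γ * σ + σ / 4 ≤ 7 / 12 * t ^ 2 := by nlinarith
    nlinarith [sq_nonneg t]
  have e3 : β * (t - s) ≤ t ^ 3 / 3 := by
    have h7 : 0 ≤ β * (t - s) := mul_nonneg (by linarith) (by linarith)
    have h8 : β * (t - s) * (7 / 4 * t) ≤ 7 / 12 * t ^ 4 :=
      (mul_le_mul_of_nonneg_left (by linarith) h7).trans e2
    have : (β * (t - s)) * (7 / 4 * t) ≤ t ^ 3 / 3 * (7 / 4 * t) := by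
      refine h8.trans (le_of_eq ?_); ring
    exact le_of_mul_le_mul_right this (by positivity)
  have h7 : 0 ≤ t - s := by linarith
  have h8 : t - s ≤ β * (t - s) := by nlinarith
  constructor
  · rw [abs_le]; constructor <;> linarith [mul_nonneg (by linarith : (0 : ℝ) ≤ β) h7]
  · rw [abs_le]; constructor <;> [nlinarith [pow_pos ht0 3]; linarith]

/-- The residual of the discrete dispersion relation at the exact phase. -/
noncomputable def dispersionResidual (γ t : ℝ) : ℝ :=
  γ * (2 - 2 * Real.cos t) ^ 2 + (1 + t ^ 2 / 6) * (2 - 2 * Real.cos t) - t ^ 2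

theorem two_sub_two_cos_bounds (t : ℝ) :
    0 ≤ 2 - 2 * Real.cos t ∧ 2 - 2 * Real.cos t ≤ t ^ 2 :=
  ⟨by linarith [Real.cos_le_one t], by linarith [Real.one_sub_sq_div_two_le_cos (x := t)]⟩

/-- The residual vanishes at `σ`, so at `c = 2 - 2 cos t` it equals `c - σ` times a factor that is
at least `2/3`. The product formula for `cos θ - cos t` and Jordan's inequality then convert `c - σ`
into `t (θ - t)`. -/
theorem abs_phase_sub_le (hγ : 0 < |γ|) (hγ6 : |γ| ≤ 1 / 6) (ht0 : 0 < t) (ht1 : t ≤ 1) :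
    t * |phase γ t - t| ≤ 6 * |dispersionResidual γ t| := by
  obtain ⟨p1, p2, p3⟩ := phase_bounds hγ hγ6 ht0 ht1
  obtain ⟨c1, c2⟩ := two_sub_two_cos_bounds t
  obtain ⟨h1, -, -⟩ := symbolRoot_spec hγ hγ6 ht0 ht1
  obtain ⟨h4, h5⟩ := symbolRoot_bounds hγ hγ6 ht0 ht1
  obtain ⟨hl, hu⟩ := abs_le.1 hγ6
  have hc := cos_phase hγ hγ6 ht0 ht1
  have ht2 : t ^ 2 ≤ 1 := by nlinarith
  set c := 2 - 2 * Real.cos t with hcdef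
  set σ := symbolRoot γ t
  have a1 : |c - σ| * (2 / 3) ≤ |dispersionResidual γ t| := by
    have : dispersionResidual γ t = (c - σ) * (γ * (c + σ) + 1 + t ^ 2 / 6) := by
      unfold dispersionResidual; rw [← hcdef]; linear_combination h1
    rw [this, abs_mul]
    refine mul_le_mul_of_nonneg_left ?_ (abs_nonneg _)
    refine le_trans ?_ (le_abs_self _)
    have h0 : 0 ≤ σ := le_trans (by positivity) h4
    nlinarith
  have a2 : |Real.cos (phase γ t) - Real.cos t| = |c - σ| / 2 := by
    rw [hc, ← abs_two (α := ℝ), ← abs_div, abs_two]; congr 1; rw [hcdef]; ring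
  have a3 : t * |phase γ t - t| / 8 ≤ |Real.cos (phase γ t) - Real.cos t| := by
    rw [Real.cos_sub_cos, abs_mul, abs_mul, abs_neg, abs_two]
    have pi4 := Real.pi_le_four
    have pi3 := Real.pi_gt_three
    have s1 := Real.mul_abs_le_abs_sin (x := (phase γ t + t) / 2)
      (by rw [abs_of_pos (by linarith)]; linarith)
    have s2 := Real.mul_abs_le_abs_sin (x := (phase γ t - t) / 2)
      (by rw [abs_le]; constructor <;> linarith)
    have hp : 1 / 2 ≤ 2 / Real.pi := by
      rw [div_le_div_iff₀ two_pos Real.pi_pos]; linarith [Real.pi_le_four]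
    have b1 : t / 4 ≤ |Real.sin ((phase γ t + t) / 2)| := by
      refine le_trans ?_ s1
      rw [abs_of_pos (by linarith)]
      nlinarith
    have b2 : |phase γ t - t| / 4 ≤ |Real.sin ((phase γ t - t) / 2)| := by
      refine le_trans ?_ s2
      rw [abs_div, abs_two]
      nlinarith [abs_nonneg (phase γ t - t)]
    have := mul_le_mul b1 b2 (by positivity) (abs_nonneg _)
    linarith
  rw [a2] at a3
  linarith

theorem abs_dispersionResidual_le (hγ6 : |γ| ≤ 1 / 6) (ht0 : 0 < t) (ht1 : t ≤ 1) :
    |dispersionResidual γ t| ≤ t ^ 4 := by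
  obtain ⟨c1, c2⟩ := two_sub_two_cos_bounds t
  have hb := Real.cos_bound (x := t) (by rwa [abs_of_pos ht0])
  rw [abs_of_pos ht0] at hb
  obtain ⟨b1, b2⟩ := abs_le.1 hb
  obtain ⟨hl, hu⟩ := abs_le.1 hγ6
  unfold dispersionResidual
  set c := 2 - 2 * Real.cos t with hc
  have hcos : Real.cos t = 1 - c / 2 := by rw [hc]; ring
  rw [hcos] at b1 b2
  have h1 : c ^ 2 ≤ t ^ 4 := by nlinarith
  have h2 : t ^ 2 * c ≤ t ^ 4 := by nlinarith [sq_nonneg t]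
  have h3 : 0 ≤ t ^ 2 * c := by positivity
  have h4 : |γ * c ^ 2| ≤ t ^ 4 / 6 := by
    rw [abs_mul, abs_of_nonneg (sq_nonneg c)]
    nlinarith [sq_nonneg c]
  obtain ⟨d1, d2⟩ := abs_le.1 h4
  rw [abs_le]; constructor <;> nlinarith

theorem abs_cos_sub_taylor_le (ht0 : 0 < t) (ht1 : t ≤ 1) :
    |Real.cos t - (1 - t ^ 2 / 2 + t ^ 4 / 24)| ≤ t ^ 6 := by
  -- Six terms of the series of `exp(it)`; the real part keeps the even ones, so the remainder has
  -- order six.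
  have h := Complex.exp_bound (x := t * Complex.I) (by simp [abs_of_pos ht0, ht1])
    (n := 6) (by norm_num)
  have hre := (Complex.abs_re_le_norm _).trans h
  simp only [Finset.sum_range_succ, Finset.sum_range_zero, mul_pow, Complex.norm_mul,
    Complex.norm_real, Complex.norm_I, Real.norm_eq_abs, abs_of_pos ht0] at hre
  have e : (Complex.exp (t * Complex.I)).re = Real.cos t := by
    rw [Complex.exp_ofReal_mul_I_re]
  have i2 : Complex.I ^ 2 = -1 := Complex.I_sq
  have i3 : Complex.I ^ 3 = -Complex.I := Complex.I_pow_three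
  have i4 : Complex.I ^ 4 = 1 := Complex.I_pow_four
  have i5 : Complex.I ^ 5 = Complex.I := by rw [pow_succ, i4, one_mul]
  rw [i2, i3, i4, i5, Complex.sub_re, e] at hre
  have e2 : (((0 : ℂ) + (t : ℂ) ^ 0 * Complex.I ^ 0 / (Nat.factorial 0 : ℂ)
      + (t : ℂ) ^ 1 * Complex.I ^ 1 / (Nat.factorial 1 : ℂ)
      + (t : ℂ) ^ 2 * (-1) / (Nat.factorial 2 : ℂ)
      + (t : ℂ) ^ 3 * (-Complex.I) / (Nat.factorial 3 : ℂ)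
      + (t : ℂ) ^ 4 * 1 / (Nat.factorial 4 : ℂ)
      + (t : ℂ) ^ 5 * Complex.I / (Nat.factorial 5 : ℂ)) : ℂ)
      = ((1 - t ^ 2 / 2 + t ^ 4 / 24 : ℝ) : ℂ) + ((t - t ^ 3 / 6 + t ^ 5 / 120 : ℝ) : ℂ)
        * Complex.I := by
    simp [Nat.factorial]; ring
  rw [e2] at hre
  simp only [Complex.add_re, Complex.re_ofReal_mul, Complex.ofReal_re, Complex.I_re, mul_zero,
    add_zero] at hre
  refine hre.trans ?_
  have : (0 : ℝ) ≤ t ^ 6 := by positivity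
  norm_num [Nat.factorial]
  linarith

/-- With `cos t = 1 - t²/2 + e` the residual is `-2(e - t⁴/24) - e²/3`: for this `γ` the terms in
`t²e` cancel and the remaining `t⁴` is the next Taylor term of the cosine. -/
theorem abs_dispersionResidual_neg_one_twelfth_le (ht0 : 0 < t) (ht1 : t ≤ 1) :
    |dispersionResidual (-1 / 12) t| ≤ 3 * t ^ 6 := by
  obtain ⟨c1, c2⟩ := two_sub_two_cos_bounds t
  have hb := Real.cos_bound (x := t) (by rwa [abs_of_pos ht0])
  rw [abs_of_pos ht0] at hb
  obtain ⟨b1, b2⟩ := abs_le.1 hb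
  obtain ⟨d1, d2⟩ := abs_le.1 (abs_cos_sub_taylor_le ht0 ht1)
  unfold dispersionResidual
  have e : -1 / 12 * (2 - 2 * Real.cos t) ^ 2 + (1 + t ^ 2 / 6) * (2 - 2 * Real.cos t) - t ^ 2
      = -2 * (Real.cos t - (1 - t ^ 2 / 2 + t ^ 4 / 24))
        - (Real.cos t - (1 - t ^ 2 / 2)) ^ 2 / 3 := by ring
  have h2 : (Real.cos t - (1 - t ^ 2 / 2)) ^ 2 ≤ t ^ 6 := by
    have : (Real.cos t - (1 - t ^ 2 / 2)) ^ 2 ≤ (t ^ 4 * (5 / 96)) ^ 2 := sq_le_sq' (by linarith) b2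
    refine this.trans ?_
    have h6 : (0 : ℝ) ≤ t ^ 6 := by positivity
    have : t ^ 2 ≤ 1 := by nlinarith
    nlinarith
  rw [e, abs_le]
  constructor <;> nlinarith [sq_nonneg (Real.cos t - (1 - t ^ 2 / 2))]

/-- The residual is affine in `γ`, and `γ_o` is its zero: the parameter for which the exact phase
`t` solves the discrete dispersion relation. -/
theorem dispersionResidual_eq_gammaOpt (ht0 : 0 < t) (ht1 : t ≤ 1) :
    dispersionResidual γ t = (γ - gammaOpt t) * (2 - 2 * Real.cos t) ^ 2 := by
  have : Real.cos t < 1 := by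
    have := Real.cos_lt_cos_of_nonneg_of_le_pi_div_two le_rfl
      (by linarith [Real.pi_gt_three]) ht0
    rwa [Real.cos_zero] at this
  have h : 1 - Real.cos t ≠ 0 := by linarith
  unfold dispersionResidual gammaOpt
  field_simp
  ring

end Parameters

/-! ### Estimates of the phase error `k_h⁻ - k`. -/

section Wavenumber

variable {k γ : ℝ} {n : ℕ}

theorem Admissible.step_pos (h : Admissible k γ n) : 0 < step n := by
  have : 0 < (n : ℝ) := by exact_mod_cast h.1
  unfold step; positivity

theorem Admissible.pos (h : Admissible k γ n) : 0 < k * step n :=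
  mul_pos (lt_of_lt_of_le one_pos h.2.1) h.step_pos

theorem Admissible.abs_wavenumber_sub (h : Admissible k γ n) :
    |discreteWavenumber k γ n - k| ≤
      6 * |dispersionResidual γ (k * step n)| / (k * step n ^ 2) := by
  have hh := h.step_pos
  have hk : 0 < k := lt_of_lt_of_le one_pos h.2.1
  have := abs_phase_sub_le h.2.2.2.1 h.2.2.2.2 h.pos h.2.2.1
  have e : discreteWavenumber k γ n - k = (phase γ (k * step n) - k * step n) / step n := by
    unfold discreteWavenumber phase; field_simp
  rw [e, abs_div, abs_of_pos hh, div_le_div_iff₀ hh (by positivity)]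
  nlinarith

theorem Admissible.wavenumber_le (h : Admissible k γ n) :
    |discreteWavenumber k γ n - k| ≤ 6 * (k ^ 3 * step n ^ 2) := by
  have hh := h.step_pos
  have hk : 0 < k := lt_of_lt_of_le one_pos h.2.1
  refine h.abs_wavenumber_sub.trans ?_
  rw [div_le_iff₀ (by positivity)]
  have := abs_dispersionResidual_le h.2.2.2.2 h.pos h.2.2.1
  calc _ ≤ 6 * (k * step n) ^ 4 := by linarith
    _ = _ := by ring

theorem Admissible.wavenumber_le_of_neg_one_twelfth (h : Admissible k (-1 / 12) n) :
    |discreteWavenumber k (-1 / 12) n - k| ≤ 18 * (k ^ 5 * step n ^ 4) := by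
  have hh := h.step_pos
  have hk : 0 < k := lt_of_lt_of_le one_pos h.2.1
  refine h.abs_wavenumber_sub.trans ?_
  rw [div_le_iff₀ (by positivity)]
  have := abs_dispersionResidual_neg_one_twelfth_le h.pos h.2.2.1
  calc _ ≤ 6 * (3 * (k * step n) ^ 6) := by linarith
    _ = _ := by ring

theorem Admissible.wavenumber_le_of_gammaOpt (h : Admissible k γ n) {C : ℝ} (hC : 0 < C)
    (hγ : |γ - gammaOpt (k * step n)| ≤ C * (1 / (k ^ 2 * step n))) :
    |discreteWavenumber k γ n - k| ≤ 6 * C * (k * step n) := by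
  have hh := h.step_pos
  have hk : 0 < k := lt_of_lt_of_le one_pos h.2.1
  refine h.abs_wavenumber_sub.trans ?_
  rw [div_le_iff₀ (by positivity), dispersionResidual_eq_gammaOpt h.pos h.2.2.1, abs_mul,
    abs_of_nonneg (sq_nonneg (2 - 2 * Real.cos (k * step n)))]
  obtain ⟨c1, c2⟩ := two_sub_two_cos_bounds (k * step n)
  have h1 : (2 - 2 * Real.cos (k * step n)) ^ 2 ≤ (k * step n) ^ 4 := by nlinarith
  have := mul_le_mul hγ h1 (sq_nonneg _) (by positivity)
  calc _ ≤ 6 * (C * (1 / (k ^ 2 * step n)) * (k * step n) ^ 4) := by linarith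
    _ = _ := by field_simp

end Wavenumber

/-! ### Weak derivatives and integration by parts for primitives. -/

/-- Increments of the primitive of `r` are dominated by those of the primitive of `‖r‖`, a real
function. -/
theorem absolutelyContinuous_primitive {r : ℝ → ℂ} {a b : ℝ}
    (h : IntervalIntegrable r volume a b) :
    AbsolutelyContinuousOnInterval (fun x ↦ ∫ y in a..x, r y) a b := by
  have h1 := (h.norm).absolutelyContinuousOnInterval_intervalIntegral (c := a) left_mem_uIcc
  unfold AbsolutelyContinuousOnInterval at h1 ⊢
  refine squeeze_zero' ?_ ?_ h1
  · filter_upwards with E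
    exact Finset.sum_nonneg fun _ _ ↦ dist_nonneg
  have h2 : ∀ᶠ E : ℕ × (ℕ → ℝ × ℝ) in AbsolutelyContinuousOnInterval.totalLengthFilter ⊓
      𝓟 (AbsolutelyContinuousOnInterval.disjWithin a b),
      E ∈ AbsolutelyContinuousOnInterval.disjWithin a b :=
    eventually_inf_principal.mpr (by simp)
  filter_upwards [h2] with E hE
  refine Finset.sum_le_sum fun i hi ↦ ?_
  have hmem := hE.1 i (Finset.mem_range.2 (by simpa using hi))
  have i1 : IntervalIntegrable r volume a (E.2 i).1 :=
    h.mono_set (uIcc_subset_uIcc left_mem_uIcc hmem.1)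
  have i2 : IntervalIntegrable r volume a (E.2 i).2 :=
    h.mono_set (uIcc_subset_uIcc left_mem_uIcc hmem.2)
  rw [dist_eq_norm, dist_eq_norm, intervalIntegral.integral_interval_sub_left i1 i2,
    intervalIntegral.integral_interval_sub_left i1.norm i2.norm, Real.norm_eq_abs]
  exact intervalIntegral.norm_integral_le_abs_integral_norm

/-- Integration by parts with one factor merely absolutely continuous: the difference of the two
sides, as a function of the upper limit, is absolutely continuous with zero derivative almost
everywhere, and vanishes at `a`. -/
theorem mul_primitive_eq {g g' r : ℝ → ℂ} {a b : ℝ} (hg : ∀ x, HasDerivAt g (g' x) x)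
    (hg' : Continuous g') (h : IntervalIntegrable r volume a b) :
    g b * ∫ y in a..b, r y = ∫ y in a..b, (g' y * (∫ z in a..y, r z) + g y * r y) := by
  have hgc : Continuous g := continuous_iff_continuousAt.2 fun x ↦ (hg x).continuousAt
  have hac := absolutelyContinuous_primitive h
  have hgac : AbsolutelyContinuousOnInterval g a b := by
    have hd : deriv g = g' := funext fun x ↦ (hg x).deriv
    have : ContDiff ℝ 1 g := contDiff_one_iff_deriv.2
      ⟨fun x ↦ (hg x).differentiableAt, hd ▸ hg'⟩
    exact this.contDiffOn.absolutelyContinuousOnInterval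
  have hint : IntervalIntegrable (fun y ↦ g' y * (∫ z in a..y, r z) + g y * r y) volume a b := by
    refine IntervalIntegrable.add ?_ (h.continuousOn_mul hgc.continuousOn)
    exact ContinuousOn.intervalIntegrable (hg'.continuousOn.mul hac.continuousOn)
  have hH := (hgac.smul hac).sub (absolutelyContinuous_primitive hint)
  obtain ⟨C, hC⟩ := hH.const_of_ae_hasDerivAt_zero (by
    filter_upwards [h.ae_hasDerivAt_integral, hint.ae_hasDerivAt_integral] with x h1 h2 hx
    have := ((hg x).smul (h1 hx a left_mem_uIcc)).sub (h2 hx a left_mem_uIcc)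
    refine this.congr_deriv ?_
    simp only [smul_eq_mul]; ring)
  have e1 := hC a left_mem_uIcc
  have e2 := hC b right_mem_uIcc
  simp at e1 e2
  rw [← e1] at e2
  exact sub_eq_zero.1 e2

theorem isCompact_subset_Icc {K : Set ℝ} (hK : IsCompact K) (h : K ⊆ Ioo 0 1) :
    ∃ a b : ℝ, 0 < a ∧ b < 1 ∧ K ⊆ Icc a b := by
  rcases K.eq_empty_or_nonempty with rfl | hne
  · exact ⟨1 / 2, 1 / 2, by norm_num, by norm_num, by simp⟩
  · exact ⟨sInf K, sSup K, (h (hK.sInf_mem hne)).1, (h (hK.sSup_mem hne)).2, fun x hx ↦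
      ⟨csInf_le hK.bddBelow hx, le_csSup hK.bddAbove hx⟩⟩

/-- The mean-zero condition is what makes the primitive vanish to the right of the support as well.
-/
theorem exists_primitive_testFunction {χ : ℝ → ℝ} (hχ : ContDiff ℝ ∞ χ) (hc : HasCompactSupport χ)
    (hs : tsupport χ ⊆ Ioo 0 1) (h0 : ∫ x in (0 : ℝ)..1, χ x = 0) :
    ∃ φ : ℝ → ℝ, ContDiff ℝ ∞ φ ∧ HasCompactSupport φ ∧ tsupport φ ⊆ Ioo (0 : ℝ) 1 ∧
      deriv φ = χ := by
  obtain ⟨a, b, ha, hb, hK⟩ := isCompact_subset_Icc hc hs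
  have hz : ∀ x, x ∉ Icc a b → χ x = 0 := fun x hx ↦
    image_eq_zero_of_notMem_tsupport fun h ↦ hx (hK h)
  have hd : ∀ x, HasDerivAt (fun x ↦ ∫ y in (0 : ℝ)..x, χ y) (χ x) x := fun x ↦
    intervalIntegral.integral_hasDerivAt_right (hχ.continuous.intervalIntegrable _ _)
      (hχ.continuous.stronglyMeasurableAtFilter _ _) hχ.continuous.continuousAt
  have hde : deriv (fun x ↦ ∫ y in (0 : ℝ)..x, χ y) = χ := funext fun x ↦ (hd x).deriv
  have hsup : Function.support (fun x ↦ ∫ y in (0 : ℝ)..x, χ y) ⊆ Icc a b := by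
    intro x hx
    by_contra hn
    apply hx
    rcases not_and_or.1 hn with h | h
    · refine (intervalIntegral.integral_congr (g := fun _ ↦ (0 : ℝ)) fun y hy ↦ hz y ?_).trans
        (by simp)
      intro hy'
      have := hy.2
      rcases le_max_iff.1 this with h3 | h3 <;> linarith [hy'.1]
    · have h1 : ∫ y in x..(1 : ℝ), χ y = 0 := by
        refine (intervalIntegral.integral_congr (g := fun _ ↦ (0 : ℝ)) fun y hy ↦ hz y ?_).trans
          (by simp)
        intro hy'
        rcases min_le_iff.1 hy.1 with h3 | h3 <;> linarith [hy'.2]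
      have h2 := intervalIntegral.integral_add_adjacent_intervals
        (hχ.continuous.intervalIntegrable (μ := volume) 0 x)
        (hχ.continuous.intervalIntegrable (μ := volume) x 1)
      simp only
      linarith
  have hts : tsupport (fun x ↦ ∫ y in (0 : ℝ)..x, χ y) ⊆ Icc a b :=
    closure_minimal hsup isClosed_Icc
  refine ⟨_, ?_, ?_, hts.trans fun x hx ↦ ⟨ha.trans_le hx.1, hx.2.trans_lt hb⟩, hde⟩
  · rw [contDiff_infty_iff_deriv]
    exact ⟨fun x ↦ (hd x).differentiableAt, by rw [hde]; exact hχ⟩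
  · exact isCompact_Icc.of_isClosed_subset (isClosed_tsupport _) hts

theorem setIntegral_eq_intervalIntegral (g : ℝ → ℂ) :
    ∫ x in Ioo (0 : ℝ) 1, g x = ∫ x in (0 : ℝ)..1, g x := by
  rw [intervalIntegral.integral_of_le zero_le_one, integral_Ioc_eq_integral_Ioo]

/-- The du Bois-Reymond argument: a test function minus its mean times a fixed normalised bump `η`
is a derivative of a test function, so `g - c`, with `c = ∫ ηg`, annihilates all test functions.
Continuity upgrades the almost-everywhere identity. -/
theorem const_of_weakDeriv_zero {g : ℝ → ℂ} (hg : ContinuousOn g (Icc 0 1))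
    (h : ∀ φ : ℝ → ℝ, ContDiff ℝ ∞ φ → HasCompactSupport φ → tsupport φ ⊆ Ioo (0 : ℝ) 1 →
      ∫ x in (0 : ℝ)..1, ((deriv φ x : ℝ) : ℂ) * g x = 0) :
    ∀ x ∈ Icc (0 : ℝ) 1, g x = g 0 := by
  let η₀ : ContDiffBump (1 / 2 : ℝ) := ⟨1 / 8, 1 / 4, by norm_num, by norm_num⟩
  let η : ℝ → ℝ := η₀.normed volume
  have hη : ContDiff ℝ ∞ η := η₀.contDiff_normed
  have hηc : HasCompactSupport η := η₀.hasCompactSupport_normed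
  have hηs : tsupport η ⊆ Ioo 0 1 := by
    rw [η₀.tsupport_normed_eq]
    intro x hx
    rw [Metric.mem_closedBall, Real.dist_eq, abs_le] at hx
    change -(1 / 4) ≤ x - 1 / 2 ∧ x - 1 / 2 ≤ 1 / 4 at hx
    constructor <;> linarith [hx.1, hx.2]
  have hη1 : ∫ x in (0 : ℝ)..1, η x = 1 := by
    rw [intervalIntegral.integral_of_le zero_le_one, integral_Ioc_eq_integral_Ioo,
      setIntegral_eq_integral_of_forall_compl_eq_zero, η₀.integral_normed]
    intro x hx
    exact image_eq_zero_of_notMem_tsupport fun h' ↦ hx (hηs h')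
  have hgi : IntervalIntegrable g volume 0 1 :=
    ContinuousOn.intervalIntegrable (by rwa [uIcc_of_le zero_le_one])
  have hmul : ∀ ψ : ℝ → ℝ, Continuous ψ →
      IntervalIntegrable (fun x ↦ (ψ x : ℂ) * g x) volume 0 1 := fun ψ hψ ↦
    hgi.continuousOn_mul (by fun_prop)
  set c : ℂ := ∫ x in (0 : ℝ)..1, (η x : ℂ) * g x with hc
  have key : ∀ ψ : ℝ → ℝ, ContDiff ℝ ∞ ψ → HasCompactSupport ψ → tsupport ψ ⊆ Ioo (0 : ℝ) 1 →
      ∫ x, ψ x • (g x - c) = 0 := by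
    intro ψ hψ hψc hψs
    set m := ∫ x in (0 : ℝ)..1, ψ x with hm
    obtain ⟨φ, h1, h2, h3, h4⟩ := exists_primitive_testFunction
      (χ := fun x ↦ ψ x - m * η x) (hψ.sub (contDiff_const.mul hη))
      (hψc.sub (hηc.mul_left))
      (by
        refine (tsupport_sub _ _).trans (union_subset hψs ?_)
        exact (tsupport_mul_subset_right).trans hηs)
      (by
        rw [intervalIntegral.integral_sub (hψ.continuous.intervalIntegrable _ _)
          ((hη.continuous.intervalIntegrable _ _).const_mul m),
          intervalIntegral.integral_const_mul, hη1, mul_one, sub_self])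
    have h5 := h φ h1 h2 h3
    rw [h4] at h5
    have h6 : ∫ x in (0 : ℝ)..1, (ψ x : ℂ) * g x = m * c := by
      rw [← sub_eq_zero, ← h5, hc, ← intervalIntegral.integral_const_mul,
        ← intervalIntegral.integral_sub (hmul ψ hψ.continuous)
          ((hmul η hη.continuous).const_mul _)]
      congr 1; ext x; push_cast; ring
    have h7 : ∫ x, ψ x • (g x - c) = ∫ x in Ioo (0 : ℝ) 1, ψ x • (g x - c) := by
      rw [setIntegral_eq_integral_of_forall_compl_eq_zero]
      intro x hx
      rw [image_eq_zero_of_notMem_tsupport fun h' ↦ hx (hψs h'), zero_smul]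
    rw [h7, setIntegral_eq_intervalIntegral]
    have h8 : ∀ x, ψ x • (g x - c) = (ψ x : ℂ) * g x - (ψ x : ℂ) * c := fun x ↦ by
      rw [Complex.real_smul]; ring
    simp_rw [h8]
    rw [intervalIntegral.integral_sub (hmul ψ hψ.continuous)
      ((by fun_prop : Continuous fun x ↦ (ψ x : ℂ) * c).intervalIntegrable _ _), h6,
      intervalIntegral.integral_mul_const, intervalIntegral.integral_ofReal, sub_self]
  have hae := isOpen_Ioo.ae_eq_zero_of_integral_contDiff_smul_eq_zero (μ := volume)
    (((hg.sub continuousOn_const).mono Ioo_subset_Icc_self).locallyIntegrableOn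
      measurableSet_Ioo) key
  have hae' : g =ᵐ[volume.restrict (Ioo 0 1)] fun _ ↦ c := by
    rw [Filter.EventuallyEq, ae_restrict_iff' measurableSet_Ioo]
    filter_upwards [hae] with x hx hx'
    exact sub_eq_zero.1 (hx hx')
  have hIoo : EqOn g (fun _ ↦ c) (Ioo 0 1) :=
    Measure.eqOn_open_of_ae_eq hae' isOpen_Ioo (hg.mono Ioo_subset_Icc_self) continuousOn_const
  have hIcc : EqOn g (fun _ ↦ c) (Icc 0 1) :=
    hIoo.of_subset_closure hg continuousOn_const Ioo_subset_Icc_self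
      (by rw [closure_Ioo zero_ne_one])
  intro x hx
  rw [hIcc hx, hIcc (left_mem_Icc.2 zero_le_one)]

theorem HasWeakDeriv.eq_add_integral {v w : ℝ → ℂ} (h : HasWeakDeriv v w)
    (hv : ContinuousOn v (Icc 0 1)) (hw : IntervalIntegrable w volume 0 1) :
    ∀ x ∈ Icc (0 : ℝ) 1, v x = v 0 + ∫ y in (0 : ℝ)..x, w y := by
  have hP : ContinuousOn (fun x ↦ ∫ y in (0 : ℝ)..x, w y) (Icc 0 1) := by
    have := (absolutelyContinuous_primitive hw).continuousOn
    rwa [uIcc_of_le zero_le_one] at this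
  have := const_of_weakDeriv_zero (g := fun x ↦ v x - ∫ y in (0 : ℝ)..x, w y) (hv.sub hP) (by
    intro φ h1 h2 h3
    have e1 := h φ h1 h2 h3
    rw [setIntegral_eq_intervalIntegral, setIntegral_eq_intervalIntegral] at e1
    have hd : Continuous (deriv φ) := (contDiff_infty_iff_deriv.1 h1).2.continuous
    have e2 := mul_primitive_eq (g := fun x ↦ (φ x : ℂ)) (g' := fun x ↦ ((deriv φ x : ℝ) : ℂ))
      (fun x ↦ ((contDiff_infty_iff_deriv.1 h1).1 x).hasDerivAt.ofReal_comp) (by fun_prop) hw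
    have hφ1 : φ 1 = 0 := image_eq_zero_of_notMem_tsupport fun h' ↦ lt_irrefl _ (h3 h').2
    have i1 : IntervalIntegrable (fun y ↦ ((deriv φ y : ℝ) : ℂ) * ∫ z in (0 : ℝ)..y, w z) volume 0 1 :=
      ContinuousOn.intervalIntegrable (by
        rw [uIcc_of_le zero_le_one]
        exact ContinuousOn.mul (by fun_prop) hP)
    have i2 : IntervalIntegrable (fun y ↦ (φ y : ℂ) * w y) volume 0 1 :=
      hw.continuousOn_mul (Complex.continuous_ofReal.comp h1.continuous).continuousOn
    have i3 : IntervalIntegrable (fun y ↦ ((deriv φ y : ℝ) : ℂ) * v y) volume 0 1 :=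
      ContinuousOn.intervalIntegrable (by
        rw [uIcc_of_le zero_le_one]
        exact ContinuousOn.mul (by fun_prop) hv)
    rw [intervalIntegral.integral_add i1 i2, hφ1, Complex.ofReal_zero, zero_mul] at e2
    simp only [mul_sub]
    rw [intervalIntegral.integral_sub i3 i1, e1]
    linear_combination e2)
  intro x hx
  have := this x hx
  simp at this
  linear_combination this

/-- The integral form of `p' = κp - f`, solved with the integrating factor `exp(-κx)`; `f` is only
integrable, so `mul_primitive_eq` replaces the classical product rule. -/
theorem firstOrder_solution {p f : ℝ → ℂ} {κ : ℂ} (hp : ContinuousOn p (Icc 0 1))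
    (hf : IntervalIntegrable f volume 0 1)
    (h : ∀ x ∈ Icc (0 : ℝ) 1, p x = p 0 + ∫ y in (0 : ℝ)..x, (κ * p y - f y)) :
    ∀ x ∈ Icc (0 : ℝ) 1, p x = Complex.exp (κ * x) *
      (p 0 - ∫ y in (0 : ℝ)..x, Complex.exp (-(κ * y)) * f y) := by
  intro x hx
  have hsub : uIcc 0 x ⊆ uIcc (0 : ℝ) 1 := by
    rw [uIcc_of_le hx.1, uIcc_of_le zero_le_one]; exact Icc_subset_Icc_right hx.2
  have hp' : IntervalIntegrable p volume 0 x :=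
    ContinuousOn.intervalIntegrable (hp.mono (by rwa [uIcc_of_le zero_le_one] at hsub))
  have hf' := hf.mono_set hsub
  have hE : ∀ y : ℝ, HasDerivAt (fun y : ℝ ↦ Complex.exp (-(κ * y)))
      (-κ * Complex.exp (-(κ * y))) y := by
    intro y
    have h1 : HasDerivAt (fun y : ℝ ↦ -(κ * (y : ℂ))) (-(κ * 1)) y :=
      ((Complex.ofRealCLM.hasDerivAt (x := y)).const_mul κ).neg
    convert h1.cexp using 1; ring
  have e := mul_primitive_eq hE (by fun_prop) ((hp'.const_mul κ).sub hf')
  have e2 : ∫ y in (0 : ℝ)..x, (-κ * Complex.exp (-(κ * y)) *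
        (∫ z in (0 : ℝ)..y, (κ * p z - f z)) + Complex.exp (-(κ * y)) * (κ * p y - f y))
      = ∫ y in (0 : ℝ)..x, ((-κ * Complex.exp (-(κ * y))) * (-p 0)
        - Complex.exp (-(κ * y)) * f y) := by
    refine intervalIntegral.integral_congr fun y hy ↦ ?_
    rw [uIcc_of_le hx.1] at hy
    have := h y ⟨hy.1, hy.2.trans hx.2⟩
    linear_combination (-κ * Complex.exp (-(κ * y))) * -this
  have e3 : ∫ y in (0 : ℝ)..x, (-κ * Complex.exp (-(κ * y))) = Complex.exp (-(κ * x)) - 1 := by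
    rw [intervalIntegral.integral_eq_sub_of_hasDerivAt (fun y _ ↦ hE y)
      ((by fun_prop : Continuous fun y : ℝ ↦ -κ * Complex.exp (-(κ * y))).intervalIntegrable _ _)]
    simp
  rw [e2, intervalIntegral.integral_sub
    ((by fun_prop : Continuous fun y : ℝ ↦
      -κ * Complex.exp (-(κ * y)) * (-p 0)).intervalIntegrable _ _)
    (hf'.continuousOn_mul (by fun_prop)), intervalIntegral.integral_mul_const, e3] at e
  have hx1 := h x hx
  have hee : Complex.exp (κ * x) * Complex.exp (-(κ * x)) = 1 := by
    rw [← Complex.exp_add]; simp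
  linear_combination (Complex.exp (κ * x)) * e + hx1 -
    (p 0 + ∫ y in (0 : ℝ)..x, (κ * p y - f y)) * hee

/-! ### The explicit Helmholtz solution and its dependence on the wave number. -/

/-- `u' + iκu` for the Helmholtz solution with wave number `κ`. -/
noncomputable def waveRight (κ : ℝ) (f : ℝ → ℂ) (x : ℝ) : ℂ :=
  Complex.exp (Complex.I * κ * x) * ((∫ y in (0 : ℝ)..1, Complex.exp (Complex.I * κ * y) * f y)
    - ∫ y in (0 : ℝ)..x, Complex.exp (-(Complex.I * κ * y)) * f y)

/-- `u' - iκu` for the Helmholtz solution with wave number `κ`. -/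
noncomputable def waveLeft (κ : ℝ) (f : ℝ → ℂ) (x : ℝ) : ℂ :=
  Complex.exp (-(Complex.I * κ * x)) * ((∫ y in (0 : ℝ)..1, Complex.exp (Complex.I * κ * y) * f y)
    - ∫ y in (0 : ℝ)..x, Complex.exp (Complex.I * κ * y) * f y)

/-- The Helmholtz solution with wave number `κ`. -/
noncomputable def waveSol (κ : ℝ) (f : ℝ → ℂ) (x : ℝ) : ℂ :=
  (waveRight κ f x - waveLeft κ f x) / (2 * Complex.I * κ)

/-- The derivative of the Helmholtz solution with wave number `κ`. -/
noncomputable def waveDeriv (κ : ℝ) (f : ℝ → ℂ) (x : ℝ) : ℂ :=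
  (waveRight κ f x + waveLeft κ f x) / 2

theorem MemL2.integrableOn {f : ℝ → ℂ} (hf : MemL2 f) : IntegrableOn f (Ioo 0 1) :=
  MemLp.integrable (q := 2) (by norm_num) hf

theorem intervalIntegrable_of_integrableOn {E : Type*} [NormedAddCommGroup E] {f : ℝ → E}
    (hf : IntegrableOn f (Ioo 0 1)) : IntervalIntegrable f volume 0 1 := by
  rwa [intervalIntegrable_iff_integrableOn_Ioc_of_le zero_le_one, integrableOn_Ioc_iff_integrableOn_Ioo]

theorem intervalIntegrable_mono_unit {E : Type*} [NormedAddCommGroup E] {f : ℝ → E}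
    (hf : IntervalIntegrable f volume 0 1) {a b : ℝ} (ha : a ∈ Icc (0 : ℝ) 1)
    (hb : b ∈ Icc (0 : ℝ) 1) : IntervalIntegrable f volume a b :=
  hf.mono_set (uIcc_subset_uIcc (by rwa [uIcc_of_le zero_le_one])
    (by rwa [uIcc_of_le zero_le_one]))

theorem continuousOn_primitive {r : ℝ → ℂ} (hr : IntervalIntegrable r volume 0 1) :
    ContinuousOn (fun x ↦ ∫ y in (0 : ℝ)..x, r y) (Icc 0 1) := by
  have := (absolutelyContinuous_primitive hr).continuousOn
  rwa [uIcc_of_le zero_le_one] at this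

theorem continuousOn_waveDeriv {κ : ℝ} {f : ℝ → ℂ} (hf : IntervalIntegrable f volume 0 1) :
    ContinuousOn (waveDeriv κ f) (Icc 0 1) := by
  have h1 := continuousOn_primitive (hf.continuousOn_mul
    (g := fun y : ℝ ↦ Complex.exp (-(Complex.I * κ * y))) (by fun_prop))
  have h2 := continuousOn_primitive (hf.continuousOn_mul
    (g := fun y : ℝ ↦ Complex.exp (Complex.I * κ * y)) (by fun_prop))
  unfold waveDeriv waveRight waveLeft
  refine ContinuousOn.div_const (ContinuousOn.add ?_ ?_) _
  · exact ContinuousOn.mul (by fun_prop) (continuousOn_const.sub h1)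
  · exact ContinuousOn.mul (by fun_prop) (continuousOn_const.sub h2)

/-- The operator `d² + k²` factors, so `p = u' ± iku` satisfies `p' = ±ikp - f`. Since `u(0) = 0`
both have initial value `u'(0)`, and the condition `u'(1) = iku(1)` determines that value from the
equation for `u' - iku`. -/
theorem IsHelmholtzSolution.hasDerivAt {k : ℝ} {f u : ℝ → ℂ} (hf : MemL2 f)
    (hu : IsHelmholtzSolution k f u) :
    ∀ x ∈ Ioo (0 : ℝ) 1, HasDerivAt u (waveDeriv k f x) x := by
  obtain ⟨du, d2u, cu, cdu, -, -, m2, w1, w2, hode, hu0, hu1⟩ := hu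
  have idu : IntervalIntegrable du volume 0 1 :=
    ContinuousOn.intervalIntegrable (by rwa [uIcc_of_le zero_le_one])
  have iu : IntervalIntegrable u volume 0 1 :=
    ContinuousOn.intervalIntegrable (by rwa [uIcc_of_le zero_le_one])
  have id2 := intervalIntegrable_of_integrableOn m2.integrableOn
  have hfi := intervalIntegrable_of_integrableOn hf.integrableOn
  have e1 := w1.eq_add_integral cu idu
  have e2 := w2.eq_add_integral cdu id2
  have hode' : ∀ᵐ y ∂volume, y ∈ Ioo (0 : ℝ) 1 → d2u y + (k : ℂ) ^ 2 * u y = -f y :=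
    (ae_restrict_iff' measurableSet_Ioo).1 hode
  -- The equation holds on the open interval, whereas interval integrals up to `1` include the
  -- endpoint.
  have hne : ∀ᵐ y : ℝ ∂volume, y ≠ 1 := by simp [ae_iff, measure_singleton]
  have first : ∀ κ : ℂ, κ ^ 2 = -(k : ℂ) ^ 2 → ∀ x ∈ Icc (0 : ℝ) 1,
      du x + κ * u x = Complex.exp (κ * x) *
        (du 0 - ∫ y in (0 : ℝ)..x, Complex.exp (-(κ * y)) * f y) := by
    intro κ hκ x hx
    have := firstOrder_solution (p := fun x ↦ du x + κ * u x) (f := f) (κ := κ)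
      (cdu.add (continuousOn_const.mul cu)) hfi (by
        intro x hx
        have h0 : (0 : ℝ) ∈ Icc (0 : ℝ) 1 := left_mem_Icc.2 zero_le_one
        have e3 : ∫ y in (0 : ℝ)..x, (κ * (du y + κ * u y) - f y)
            = ∫ y in (0 : ℝ)..x, (d2u y + κ * du y) := by
          refine intervalIntegral.integral_congr_ae ?_
          filter_upwards [hode', hne] with y hy hy1 hyx
          rw [uIoc_of_le hx.1] at hyx
          have := hy ⟨hyx.1, lt_of_le_of_ne (hyx.2.trans hx.2) hy1⟩
          linear_combination u y * hκ - this
        rw [e3, intervalIntegral.integral_add (intervalIntegrable_mono_unit id2 h0 hx)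
          ((intervalIntegrable_mono_unit idu h0 hx).const_mul κ),
          intervalIntegral.integral_const_mul]
        linear_combination e2 x hx + κ * e1 x hx) x hx
    simpa [hu0] using this
  have fP := first (Complex.I * k) (by rw [mul_pow, Complex.I_sq]; ring)
  have fM := first (-(Complex.I * k)) (by rw [neg_sq, mul_pow, Complex.I_sq]; ring)
  simp only [neg_mul, neg_neg] at fM
  have h11 : (1 : ℝ) ∈ Icc (0 : ℝ) 1 := right_mem_Icc.2 zero_le_one
  have hdu0 : du 0 = ∫ y in (0 : ℝ)..1, Complex.exp (Complex.I * k * y) * f y := by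
    have := fM 1 h11
    rw [← sub_eq_add_neg, hu1] at this
    rcases mul_eq_zero.1 this.symm with h | h
    · exact absurd h (Complex.exp_ne_zero _)
    · exact sub_eq_zero.1 h
  have hdu : ∀ x ∈ Icc (0 : ℝ) 1, du x = waveDeriv k f x := by
    intro x hx
    have a1 := fP x hx
    have a2 := fM x hx
    rw [hdu0] at a1 a2
    unfold waveDeriv waveRight waveLeft
    rw [← a1, ← a2]; ring
  intro x hx
  rw [← hdu x (Ioo_subset_Icc_self hx)]
  have hcont : ContinuousAt du x := cdu.continuousAt (Icc_mem_nhds hx.1 hx.2)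
  have hD : HasDerivAt (fun x ↦ ∫ y in (0 : ℝ)..x, du y) (du x) x := by
    refine intervalIntegral.integral_hasDerivAt_right
      (intervalIntegrable_mono_unit idu (left_mem_Icc.2 zero_le_one) (Ioo_subset_Icc_self hx))
      ?_ hcont
    exact (cdu.mono Ioo_subset_Icc_self).stronglyMeasurableAtFilter isOpen_Ioo x hx
  refine hD.congr_of_eventuallyEq ?_
  filter_upwards [Ioo_mem_nhds hx.1 hx.2] with y hy
  rw [e1 y (Ioo_subset_Icc_self hy), hu0, zero_add]

theorem waveRight_transfer {κ : ℝ} {f : ℝ → ℂ} (hf : IntervalIntegrable f volume 0 1) {a x : ℝ}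
    (ha : a ∈ Icc (0 : ℝ) 1) (hx : x ∈ Icc (0 : ℝ) 1) :
    waveRight κ f x = Complex.exp (Complex.I * (κ * (x - a) : ℝ)) * waveRight κ f a
      - ∫ y in a..x, Complex.exp (Complex.I * (κ * (x - y) : ℝ)) * f y := by
  have h0 : (0 : ℝ) ∈ Icc (0 : ℝ) 1 := left_mem_Icc.2 zero_le_one
  have hi := hf.continuousOn_mul (g := fun y : ℝ ↦ Complex.exp (-(Complex.I * κ * y)))
    (by fun_prop)
  have e1 := intervalIntegral.integral_add_adjacent_intervals
    (intervalIntegrable_mono_unit hi h0 ha) (intervalIntegrable_mono_unit hi ha hx)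
  have e2 : ∫ y in a..x, Complex.exp (Complex.I * (κ * (x - y) : ℝ)) * f y
      = Complex.exp (Complex.I * κ * x) *
        ∫ y in a..x, Complex.exp (-(Complex.I * κ * y)) * f y := by
    rw [← intervalIntegral.integral_const_mul]
    congr 1; ext y
    rw [← mul_assoc, ← Complex.exp_add]
    congr 2; push_cast; ring
  rw [e2]
  unfold waveRight
  rw [← e1, ← mul_assoc, ← Complex.exp_add]
  have : Complex.I * (κ * (x - a) : ℝ) + Complex.I * κ * a = Complex.I * κ * x := by
    push_cast; ring
  rw [this]; ring

theorem waveLeft_transfer {κ : ℝ} {f : ℝ → ℂ} (hf : IntervalIntegrable f volume 0 1) {a x : ℝ}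
    (ha : a ∈ Icc (0 : ℝ) 1) (hx : x ∈ Icc (0 : ℝ) 1) :
    waveLeft κ f x = Complex.exp (-(Complex.I * (κ * (x - a) : ℝ))) * waveLeft κ f a
      - ∫ y in a..x, Complex.exp (-(Complex.I * (κ * (x - y) : ℝ))) * f y := by
  have h0 : (0 : ℝ) ∈ Icc (0 : ℝ) 1 := left_mem_Icc.2 zero_le_one
  have hi := hf.continuousOn_mul (g := fun y : ℝ ↦ Complex.exp (Complex.I * κ * y))
    (by fun_prop)
  have e1 := intervalIntegral.integral_add_adjacent_intervals
    (intervalIntegrable_mono_unit hi h0 ha) (intervalIntegrable_mono_unit hi ha hx)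
  have e2 : ∫ y in a..x, Complex.exp (-(Complex.I * (κ * (x - y) : ℝ))) * f y
      = Complex.exp (-(Complex.I * κ * x)) *
        ∫ y in a..x, Complex.exp (Complex.I * κ * y) * f y := by
    rw [← intervalIntegral.integral_const_mul]
    congr 1; ext y
    rw [← mul_assoc, ← Complex.exp_add]
    congr 2; push_cast; ring
  rw [e2]
  unfold waveLeft
  rw [← e1, ← mul_assoc (Complex.exp (-(Complex.I * (κ * (x - a) : ℝ)))), ← Complex.exp_add]
  have : -(Complex.I * (κ * (x - a) : ℝ)) + -(Complex.I * κ * a) = -(Complex.I * κ * x) := by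
    push_cast; ring
  rw [this]; ring

theorem exp_I_mul_real (θ : ℝ) :
    Complex.exp (Complex.I * θ) = (Real.cos θ : ℂ) + (Real.sin θ : ℂ) * Complex.I := by
  rw [mul_comm, Complex.exp_mul_I, Complex.ofReal_cos, Complex.ofReal_sin]

theorem exp_neg_I_mul_real (θ : ℝ) :
    Complex.exp (-(Complex.I * θ)) = (Real.cos θ : ℂ) - (Real.sin θ : ℂ) * Complex.I := by
  rw [← mul_neg, ← Complex.ofReal_neg, exp_I_mul_real, Real.cos_neg, Real.sin_neg]
  push_cast; ring

/-- Variation of constants from an arbitrary base point, obtained by subtracting the two one-way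
formulas. The point `x` may lie to the left of `a`, which the backward step at a node needs. -/
theorem waveSol_transfer {κ : ℝ} (hκ : κ ≠ 0) {f : ℝ → ℂ} (hf : IntervalIntegrable f volume 0 1)
    {a x : ℝ} (ha : a ∈ Icc (0 : ℝ) 1) (hx : x ∈ Icc (0 : ℝ) 1) :
    waveSol κ f x = Real.cos (κ * (x - a)) * waveSol κ f a
      + (Real.sin (κ * (x - a)) / κ : ℝ) * waveDeriv κ f a
      - ∫ y in a..x, ((Real.sin (κ * (x - y)) / κ : ℝ) : ℂ) * f y := by
  have hfx := intervalIntegrable_mono_unit hf ha hx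
  have hκ' : (κ : ℂ) ≠ 0 := by exact_mod_cast hκ
  have e : ∫ y in a..x, ((Real.sin (κ * (x - y)) / κ : ℝ) : ℂ) * f y
      = ((∫ y in a..x, Complex.exp (Complex.I * (κ * (x - y) : ℝ)) * f y)
        - ∫ y in a..x, Complex.exp (-(Complex.I * (κ * (x - y) : ℝ))) * f y)
          / (2 * Complex.I * κ) := by
    rw [← intervalIntegral.integral_sub (hfx.continuousOn_mul (by fun_prop))
      (hfx.continuousOn_mul (by fun_prop)), ← intervalIntegral.integral_div]
    congr 1; ext y
    rw [exp_I_mul_real, exp_neg_I_mul_real]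
    push_cast
    field_simp
    ring
  rw [e]
  unfold waveSol waveDeriv
  rw [waveRight_transfer hf ha hx, waveLeft_transfer hf ha hx, exp_I_mul_real,
    exp_neg_I_mul_real]
  push_cast
  field_simp
  ring

theorem waveDeriv_transfer {κ : ℝ} (hκ : κ ≠ 0) {f : ℝ → ℂ} (hf : IntervalIntegrable f volume 0 1)
    {a x : ℝ} (ha : a ∈ Icc (0 : ℝ) 1) (hx : x ∈ Icc (0 : ℝ) 1) :
    waveDeriv κ f x = Real.cos (κ * (x - a)) * waveDeriv κ f a
      - (κ * Real.sin (κ * (x - a)) : ℝ) * waveSol κ f a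
      - ∫ y in a..x, ((Real.cos (κ * (x - y)) : ℝ) : ℂ) * f y := by
  have hfx := intervalIntegrable_mono_unit hf ha hx
  have hκ' : (κ : ℂ) ≠ 0 := by exact_mod_cast hκ
  have e : ∫ y in a..x, ((Real.cos (κ * (x - y)) : ℝ) : ℂ) * f y
      = ((∫ y in a..x, Complex.exp (Complex.I * (κ * (x - y) : ℝ)) * f y)
        + ∫ y in a..x, Complex.exp (-(Complex.I * (κ * (x - y) : ℝ))) * f y)
          / 2 := by
    rw [← intervalIntegral.integral_add (hfx.continuousOn_mul (by fun_prop))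
      (hfx.continuousOn_mul (by fun_prop)), ← intervalIntegral.integral_div]
    congr 1; ext y
    rw [exp_I_mul_real, exp_neg_I_mul_real]
    ring
  rw [e]
  unfold waveSol waveDeriv
  rw [waveRight_transfer hf ha hx, waveLeft_transfer hf ha hx, exp_I_mul_real,
    exp_neg_I_mul_real]
  push_cast
  field_simp
  ring_nf
  try rw [Complex.I_sq]
  try ring

theorem waveSol_zero (κ : ℝ) (f : ℝ → ℂ) : waveSol κ f 0 = 0 := by
  simp [waveSol, waveRight, waveLeft]

theorem waveDeriv_one {κ : ℝ} (hκ : κ ≠ 0) (f : ℝ → ℂ) :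
    waveDeriv κ f 1 = Complex.I * κ * waveSol κ f 1 := by
  have hκ' : (κ : ℂ) ≠ 0 := by exact_mod_cast hκ
  have : waveLeft κ f 1 = 0 := by simp [waveLeft]
  unfold waveDeriv waveSol
  rw [this]; field_simp; ring

theorem norm_exp_I_mul (a b : ℝ) : ‖Complex.exp (Complex.I * a * b)‖ = 1 := by
  rw [Complex.norm_exp]; simp

theorem norm_exp_neg_I_mul (a b : ℝ) : ‖Complex.exp (-(Complex.I * a * b))‖ = 1 := by
  rw [Complex.norm_exp]; simp

theorem norm_integral_mul_le {g f : ℝ → ℂ} {a b c : ℝ} (hab : a ≤ b)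
    (hf : IntervalIntegrable f volume a b) (hg : ∀ y ∈ Icc a b, ‖g y‖ ≤ c) :
    ‖∫ y in a..b, g y * f y‖ ≤ c * ∫ y in a..b, ‖f y‖ := by
  rw [← intervalIntegral.integral_const_mul]
  refine intervalIntegral.norm_integral_le_of_norm_le hab ?_ (hf.norm.const_mul c)
  filter_upwards with y hy
  rw [norm_mul]
  exact mul_le_mul_of_nonneg_right (hg y (Ioc_subset_Icc_self hy)) (norm_nonneg _)

theorem integral_norm_le_unit {f : ℝ → ℂ} (hf : IntervalIntegrable f volume 0 1) {x : ℝ}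
    (hx : x ∈ Icc (0 : ℝ) 1) : ∫ y in (0 : ℝ)..x, ‖f y‖ ≤ ∫ y in (0 : ℝ)..1, ‖f y‖ :=
  intervalIntegral.integral_mono_interval le_rfl hx.1 hx.2
    (Filter.Eventually.of_forall fun _ ↦ norm_nonneg _) hf.norm

theorem norm_wave_le {κ : ℝ} {f : ℝ → ℂ} (hf : IntervalIntegrable f volume 0 1) {x : ℝ}
    (hx : x ∈ Icc (0 : ℝ) 1) : ‖waveRight κ f x‖ ≤ 2 * ∫ y in (0 : ℝ)..1, ‖f y‖ ∧
      ‖waveLeft κ f x‖ ≤ 2 * ∫ y in (0 : ℝ)..1, ‖f y‖ := by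
  have h0 : (0 : ℝ) ∈ Icc (0 : ℝ) 1 := left_mem_Icc.2 zero_le_one
  have hfx := intervalIntegrable_mono_unit hf h0 hx
  have h1 := norm_integral_mul_le zero_le_one hf
    (fun y _ ↦ (norm_exp_I_mul κ y).le)
  have h2 := norm_integral_mul_le hx.1 hfx (fun y _ ↦ (norm_exp_neg_I_mul κ y).le)
  have h3 := norm_integral_mul_le hx.1 hfx (fun y _ ↦ (norm_exp_I_mul κ y).le)
  have h4 := integral_norm_le_unit hf hx
  unfold waveRight waveLeft
  rw [norm_mul, norm_mul, norm_exp_I_mul, norm_exp_neg_I_mul, one_mul, one_mul]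
  constructor
  · refine (norm_sub_le _ _).trans ?_
    linarith
  · refine (norm_sub_le _ _).trans ?_
    linarith

theorem norm_waveDeriv_le {κ : ℝ} {f : ℝ → ℂ} (hf : IntervalIntegrable f volume 0 1) {x : ℝ}
    (hx : x ∈ Icc (0 : ℝ) 1) : ‖waveDeriv κ f x‖ ≤ 2 * ∫ y in (0 : ℝ)..1, ‖f y‖ := by
  obtain ⟨h1, h2⟩ := norm_wave_le (κ := κ) hf hx
  unfold waveDeriv
  rw [norm_div, Complex.norm_ofNat, div_le_iff₀ two_pos]
  refine (norm_add_le _ _).trans ?_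
  linarith

theorem norm_waveSol_le {κ : ℝ} (hκ : 0 < κ) {f : ℝ → ℂ} (hf : IntervalIntegrable f volume 0 1)
    {x : ℝ} (hx : x ∈ Icc (0 : ℝ) 1) : ‖waveSol κ f x‖ ≤ 2 * (∫ y in (0 : ℝ)..1, ‖f y‖) / κ := by
  obtain ⟨h1, h2⟩ := norm_wave_le (κ := κ) hf hx
  unfold waveSol
  have : ‖(2 * Complex.I * κ : ℂ)‖ = 2 * κ := by simp [abs_of_pos hκ]
  rw [norm_div, this, div_le_div_iff₀ (by positivity) hκ]
  have := norm_sub_le (waveRight κ f x) (waveLeft κ f x)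
  nlinarith

theorem norm_exp_sub_exp_le (k κ : ℝ) {x : ℝ} (hx : x ∈ Icc (0 : ℝ) 1) :
    ‖Complex.exp (Complex.I * k * x) - Complex.exp (Complex.I * κ * x)‖ ≤ |k - κ| := by
  have e : Complex.exp (Complex.I * k * x) - Complex.exp (Complex.I * κ * x)
      = Complex.exp (Complex.I * κ * x) * (Complex.exp (Complex.I * ((k - κ) * x : ℝ)) - 1) := by
    rw [mul_sub, ← Complex.exp_add]; push_cast; ring_nf
  rw [e, norm_mul, norm_exp_I_mul, one_mul]
  refine (Real.norm_exp_I_mul_ofReal_sub_one_le (x := (k - κ) * x)).trans ?_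
  rw [Real.norm_eq_abs, abs_mul, abs_of_nonneg hx.1]
  exact mul_le_of_le_one_right (abs_nonneg _) hx.2

theorem norm_exp_neg_sub_exp_neg_le (k κ : ℝ) {x : ℝ} (hx : x ∈ Icc (0 : ℝ) 1) :
    ‖Complex.exp (-(Complex.I * k * x)) - Complex.exp (-(Complex.I * κ * x))‖ ≤ |k - κ| := by
  have := norm_exp_sub_exp_le (-k) (-κ) hx
  push_cast at this
  simp only [mul_neg, neg_mul] at this
  refine this.trans (le_of_eq ?_)
  rw [← abs_neg]; congr 1; ring

theorem norm_integral_exp_sub_le {f : ℝ → ℂ} (hf : IntervalIntegrable f volume 0 1) {x c : ℝ}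
    (hx : x ∈ Icc (0 : ℝ) 1) {g₁ g₂ : ℝ → ℂ} (h₁ : Continuous g₁) (h₂ : Continuous g₂)
    (h : ∀ y ∈ Icc (0 : ℝ) 1, ‖g₁ y - g₂ y‖ ≤ c) :
    ‖(∫ y in (0 : ℝ)..x, g₁ y * f y) - ∫ y in (0 : ℝ)..x, g₂ y * f y‖
      ≤ c * ∫ y in (0 : ℝ)..1, ‖f y‖ := by
  have h0 : (0 : ℝ) ∈ Icc (0 : ℝ) 1 := left_mem_Icc.2 zero_le_one
  have hfx := intervalIntegrable_mono_unit hf h0 hx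
  have hc : 0 ≤ c := (norm_nonneg _).trans (h 0 h0)
  rw [← intervalIntegral.integral_sub (hfx.continuousOn_mul h₁.continuousOn)
    (hfx.continuousOn_mul h₂.continuousOn)]
  simp only [← sub_mul]
  exact (norm_integral_mul_le hx.1 hfx fun y hy ↦ h y ⟨hy.1, hy.2.trans hx.2⟩).trans
    (mul_le_mul_of_nonneg_left (integral_norm_le_unit hf hx) hc)

/-- Each one-way component is a unimodular exponential times integrals of exponentials against `f`,
and all these exponentials are Lipschitz in the wave number with constant one on `[0, 1]`. This is
how `|k - k_h⁻|` enters the error. -/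
theorem norm_waveDeriv_sub_le {k κ : ℝ} {f : ℝ → ℂ} (hf : IntervalIntegrable f volume 0 1) {x : ℝ}
    (hx : x ∈ Icc (0 : ℝ) 1) :
    ‖waveDeriv k f x - waveDeriv κ f x‖ ≤ 4 * |k - κ| * ∫ y in (0 : ℝ)..1, ‖f y‖ := by
  have h0 : (0 : ℝ) ∈ Icc (0 : ℝ) 1 := left_mem_Icc.2 zero_le_one
  have h1' : (1 : ℝ) ∈ Icc (0 : ℝ) 1 := right_mem_Icc.2 zero_le_one
  obtain ⟨b1, b2⟩ := norm_wave_le (κ := k) hf hx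
  have prod : ∀ e₁ e₂ A₁ A₂ B₁ B₂ : ℂ, ∀ N c : ℝ, ‖e₁‖ = 1 → ‖e₂‖ = 1 → ‖e₁ - e₂‖ ≤ c →
      ‖A₁ - A₂‖ ≤ c * N → ‖B₁ - B₂‖ ≤ c * N → ‖e₁ * (A₁ - B₁)‖ ≤ 2 * N →
      ‖e₁ * (A₁ - B₁) - e₂ * (A₂ - B₂)‖ ≤ 4 * c * N := by
    intro e₁ e₂ A₁ A₂ B₁ B₂ N c n1 n2 h1 h2 h3 h4
    rw [norm_mul, n1, one_mul] at h4
    have : e₁ * (A₁ - B₁) - e₂ * (A₂ - B₂)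
        = (e₁ - e₂) * (A₁ - B₁) + e₂ * ((A₁ - A₂) - (B₁ - B₂)) := by ring
    rw [this]
    refine (norm_add_le _ _).trans ?_
    rw [norm_mul, norm_mul, n2, one_mul]
    have := norm_sub_le (A₁ - A₂) (B₁ - B₂)
    have := mul_le_mul h1 h4 (norm_nonneg _) ((norm_nonneg _).trans h1)
    linarith
  have iA := norm_integral_exp_sub_le hf h1' (by fun_prop) (by fun_prop)
    (fun y hy ↦ norm_exp_sub_exp_le k κ hy)
  have iB := norm_integral_exp_sub_le hf hx (by fun_prop) (by fun_prop)
    (fun y hy ↦ norm_exp_sub_exp_le k κ hy)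
  have iC := norm_integral_exp_sub_le hf hx (by fun_prop) (by fun_prop)
    (fun y hy ↦ norm_exp_neg_sub_exp_neg_le k κ hy)
  have p1 := prod _ _ _ _ _ _ _ _ (norm_exp_I_mul k x) (norm_exp_I_mul κ x)
    (norm_exp_sub_exp_le k κ hx) iA iC b1
  have p2 := prod _ _ _ _ _ _ _ _ (norm_exp_neg_I_mul k x) (norm_exp_neg_I_mul κ x)
    (norm_exp_neg_sub_exp_neg_le k κ hx) iA iB b2
  have : waveDeriv k f x - waveDeriv κ f x = ((waveRight k f x - waveRight κ f x)
      + (waveLeft k f x - waveLeft κ f x)) / 2 := by unfold waveDeriv; ring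
  rw [this, norm_div, Complex.norm_ofNat, div_le_iff₀ two_pos]
  refine (norm_add_le _ _).trans ?_
  unfold waveRight waveLeft
  linarith

theorem norm_exp_neg_I_mul_real (θ : ℝ) : ‖Complex.exp (-(Complex.I * θ))‖ = 1 := by
  rw [Complex.norm_exp]; simp

theorem norm_exp_I_mul_real (θ : ℝ) : ‖Complex.exp (Complex.I * θ)‖ = 1 := by
  rw [Complex.norm_exp]; simp

/-! ### The three-term recursion with an outgoing end condition. -/

section Recursion

variable {m : ℕ} {θ : ℝ} {Y g : ℕ → ℂ} {b : ℂ}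

/-- The discrete analogue of `u' ± iκu`: set `P_j = e^{-iθ}Y_{j+1} - Y_j` and `Q_j = e^{iθ}Y_{j+1} -
Y_j`. Both obey first-order recursions with unimodular factors; `P` is run backwards from the end
condition and `Q` forwards from `Y 0 = 0`, where `|Q_0| = |P_0|`. The solution is recovered from
`Q_j - P_j = 2i sin θ Y_{j+1}`, and the partial sums in the two bounds cancel. -/
theorem recursion_bounds (h0 : Y 0 = 0)
    (hrec : ∀ j < m, 2 * (Real.cos θ : ℂ) * Y (j + 1) - Y j - Y (j + 2) = g j)
    (hb : Complex.exp (-(Complex.I * θ)) * Y (m + 1) - Y m = b) (hs : 0 ≤ Real.sin θ) :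
    ∀ j ≤ m, ‖Complex.exp (-(Complex.I * θ)) * Y (j + 1) - Y j‖
        ≤ ‖b‖ + ∑ i ∈ Finset.range m, ‖g i‖ ∧
      Real.sin θ * ‖Y (j + 1)‖ ≤ ‖b‖ + ∑ i ∈ Finset.range m, ‖g i‖ := by
  set e : ℂ := Complex.exp (-(Complex.I * θ)) with he
  set e' : ℂ := Complex.exp (Complex.I * θ) with he'
  have hee : e * e' = 1 := by rw [he, he', ← Complex.exp_add]; simp
  have hcos : 2 * (Real.cos θ : ℂ) = e + e' := by
    rw [he, he', exp_I_mul_real, exp_neg_I_mul_real]; ring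
  have hsin : 2 * (Real.sin θ : ℂ) * Complex.I = e' - e := by
    rw [he, he', exp_I_mul_real, exp_neg_I_mul_real]; ring
  have ne : ‖e‖ = 1 := norm_exp_neg_I_mul_real θ
  have ne' : ‖e'‖ = 1 := norm_exp_I_mul_real θ
  set G := ∑ i ∈ Finset.range m, ‖g i‖ with hG
  have hP : ∀ i j, j + i = m → ‖e * Y (j + 1) - Y j‖
      ≤ ‖b‖ + (G - ∑ i ∈ Finset.range j, ‖g i‖) := by
    intro i
    induction i with
    | zero => intro j hj; subst hj; simp only [Nat.add_zero] at *; rw [hb, hG]; simp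
    | succ i ih =>
      intro j hj
      have h1 := ih (j + 1) (by omega)
      rw [Finset.sum_range_succ] at h1
      have h2 : e * Y (j + 1) - Y j = e' * (e * Y (j + 1 + 1) - Y (j + 1)) + g j := by
        rw [← hrec j (by omega), hcos]
        linear_combination (-Y (j + 2)) * hee
      have h3 : ‖e * Y (j + 1) - Y j‖ ≤ ‖e * Y (j + 1 + 1) - Y (j + 1)‖ + ‖g j‖ := by
        rw [h2]; refine (norm_add_le _ _).trans ?_; rw [norm_mul, ne', one_mul]
      linarith
  have hQ : ∀ j ≤ m, ‖e' * Y (j + 1) - Y j‖ ≤ ‖b‖ + G + ∑ i ∈ Finset.range j, ‖g i‖ := by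
    intro j
    induction j with
    | zero =>
      intro _
      have := hP m 0 (by omega)
      rw [h0, sub_zero, norm_mul, ne] at this
      rw [h0, sub_zero, norm_mul, ne']
      simp at this ⊢; linarith
    | succ j ih =>
      intro hj
      have h1 := ih (by omega)
      have h2 : e' * Y (j + 1 + 1) - Y (j + 1) = e' * ((e' * Y (j + 1) - Y j) - g j) := by
        rw [← hrec j (by omega), hcos]
        linear_combination (Y (j + 1)) * hee
      rw [h2, norm_mul, ne', one_mul, Finset.sum_range_succ]
      refine (norm_sub_le _ _).trans ?_
      linarith
  intro j hj
  have h1 := hP (m - j) j (by omega)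
  have h2 := hQ j hj
  have h3 : (0 : ℝ) ≤ ∑ i ∈ Finset.range j, ‖g i‖ := Finset.sum_nonneg fun _ _ ↦ norm_nonneg _
  refine ⟨by linarith, ?_⟩
  have h4 : 2 * (Real.sin θ : ℂ) * Complex.I * Y (j + 1)
      = (e' * Y (j + 1) - Y j) - (e * Y (j + 1) - Y j) := by rw [hsin]; ring
  have h5 := congrArg norm h4
  have h6 : ‖2 * (Real.sin θ : ℂ) * Complex.I * Y (j + 1)‖ = 2 * (Real.sin θ * ‖Y (j + 1)‖) := by
    simp only [norm_mul, Complex.norm_ofNat, Complex.norm_real, Complex.norm_I,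
      Real.norm_of_nonneg hs]
    ring
  rw [h6] at h5
  have h7 := norm_sub_le (e' * Y (j + 1) - Y j) (e * Y (j + 1) - Y j)
  linarith

/-- A difference equals `P_j + (1 - e^{-iθ})Y_{j+1}`; the factor `θ` of the second term compensates
the `1 / sin θ` in the bound on `Y`. -/
theorem recursion_difference_bound (h0 : Y 0 = 0)
    (hrec : ∀ j < m, 2 * (Real.cos θ : ℂ) * Y (j + 1) - Y j - Y (j + 2) = g j)
    (hb : Complex.exp (-(Complex.I * θ)) * Y (m + 1) - Y m = b) (hs : 0 ≤ Real.sin θ)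
    (hθ0 : 0 ≤ θ) (hθ : θ ≤ 3 * Real.sin θ) :
    ∀ j ≤ m, ‖Y (j + 1) - Y j‖ ≤ 4 * (‖b‖ + ∑ i ∈ Finset.range m, ‖g i‖) := by
  intro j hj
  obtain ⟨h1, h2⟩ := recursion_bounds h0 hrec hb hs j hj
  have h3 : ‖(1 : ℂ) - Complex.exp (-(Complex.I * θ))‖ ≤ θ := by
    have := Real.norm_exp_I_mul_ofReal_sub_one_le (x := -θ)
    rw [norm_sub_rev]
    rw [Real.norm_eq_abs, abs_neg, abs_of_nonneg hθ0] at this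
    rwa [Complex.ofReal_neg, mul_neg] at this
  have h4 : Y (j + 1) - Y j = (Complex.exp (-(Complex.I * θ)) * Y (j + 1) - Y j)
      + (1 - Complex.exp (-(Complex.I * θ))) * Y (j + 1) := by ring
  rw [h4]
  refine (norm_add_le _ _).trans ?_
  rw [norm_mul]
  have := mul_le_mul_of_nonneg_right (h3.trans hθ) (norm_nonneg (Y (j + 1)))
  linarith

end Recursion

/-! ### Diagonally dominant systems in `ℓ¹` and `ℓ²`. -/

section DiagonalDominance

variable {m : ℕ} {a c : ℕ → ℝ}

/-- Summing the interior inequalities, the neighbours contribute at most half of the sum plus `a (m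
+ 1) / 4`, so the sum is bounded by `a (m + 1) / 2` and the data. The last inequality closes the
loop because `a m` is at most that sum. -/
theorem dominance_sum_bound (ha : ∀ j, 0 ≤ a j) (h0 : a 0 = 0)
    (hint : ∀ j < m, a (j + 1) ≤ (a j + a (j + 2)) / 4 + 3 / 2 * c j)
    (hlast : a (m + 1) ≤ a m / 5 + 6 / 5 * c m) :
    a (m + 1) ≤ 2 / 3 * ∑ j ∈ Finset.range m, c j + 4 / 3 * c m ∧
      ∀ j < m, a (j + 1) ≤ a (m + 1) / 2 + 3 * ∑ j ∈ Finset.range m, c j := by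
  set S := ∑ j ∈ Finset.range m, a (j + 1) with hS
  have e1 : ∑ j ∈ Finset.range m, a j + a m = S + a 0 := by
    rw [hS, ← Finset.sum_range_succ, ← Finset.sum_range_succ']
  have e2 : ∑ j ∈ Finset.range m, a (j + 2) + a 1 = S + a (m + 1) := by
    rw [hS, ← Finset.sum_range_succ (fun j ↦ a (j + 1)),
      ← Finset.sum_range_succ' (fun j ↦ a (j + 1))]
  have h1 := Finset.sum_le_sum fun j hj ↦ hint j (Finset.mem_range.1 hj)
  rw [Finset.sum_add_distrib, ← Finset.sum_div, Finset.sum_add_distrib, ← Finset.mul_sum] at h1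
  have hS' : S ≤ a (m + 1) / 2 + 3 * ∑ j ∈ Finset.range m, c j := by
    linarith [ha m, ha 1]
  have hj : ∀ j < m, a (j + 1) ≤ S := fun j hj ↦
    Finset.single_le_sum (f := fun j ↦ a (j + 1)) (fun i _ ↦ ha _) (Finset.mem_range.2 hj)
  have hm : a m ≤ S := by
    rcases Nat.eq_zero_or_pos m with h | h
    · rw [h, h0]; exact Finset.sum_nonneg fun i _ ↦ ha _
    · have := hj (m - 1) (by omega)
      rwa [Nat.sub_add_cancel h] at this
  exact ⟨by linarith, fun j hjm ↦ (hj j hjm).trans hS'⟩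

/-- The same summation after squaring with `(x + y)² ≤ 2x² + 2y²`, which leaves neighbour weights
`1/4 + 1/4`, still less than one. -/
theorem dominance_sq_sum_bound (ha : ∀ j, 0 ≤ a j) (h0 : a 0 = 0)
    (hint : ∀ j < m, a (j + 1) ≤ (a j + a (j + 2)) / 4 + 3 / 2 * c j)
    (hlast : a (m + 1) ≤ a m / 5 + 6 / 5 * c m) :
    ∑ j ∈ Finset.range (m + 1), a (j + 1) ^ 2 ≤ 9 * ∑ j ∈ Finset.range (m + 1), c j ^ 2 := by
  set S := ∑ j ∈ Finset.range m, a (j + 1) ^ 2 with hS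
  have e1 : ∑ j ∈ Finset.range m, a j ^ 2 + a m ^ 2 = S + a 0 ^ 2 := by
    rw [hS, ← Finset.sum_range_succ (fun j ↦ a j ^ 2),
      ← Finset.sum_range_succ' (fun j ↦ a j ^ 2)]
  have e2 : ∑ j ∈ Finset.range m, a (j + 2) ^ 2 + a 1 ^ 2 = S + a (m + 1) ^ 2 := by
    rw [hS, ← Finset.sum_range_succ (fun j ↦ a (j + 1) ^ 2),
      ← Finset.sum_range_succ' (fun j ↦ a (j + 1) ^ 2)]
  have h1 : ∑ j ∈ Finset.range m, a (j + 1) ^ 2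
      ≤ ∑ j ∈ Finset.range m, ((a j ^ 2 + a (j + 2) ^ 2) / 4 + 9 / 2 * c j ^ 2) := by
    refine Finset.sum_le_sum fun j hj ↦ ?_
    have := pow_le_pow_left₀ (ha _) (hint j (Finset.mem_range.1 hj)) 2
    nlinarith [sq_nonneg ((a j + a (j + 2)) / 4 - 3 / 2 * c j), sq_nonneg (a j - a (j + 2))]
  rw [Finset.sum_add_distrib, ← Finset.sum_div, Finset.sum_add_distrib, ← Finset.mul_sum] at h1
  have h2 : a (m + 1) ^ 2 ≤ a m ^ 2 / 4 + 9 / 2 * c m ^ 2 := by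
    have := pow_le_pow_left₀ (ha _) hlast 2
    nlinarith [sq_nonneg (a m / 5 - 6 / 5 * c m), sq_nonneg (a m), sq_nonneg (c m)]
  rw [Finset.sum_range_succ, Finset.sum_range_succ, ← hS]
  rw [h0] at e1
  nlinarith [sq_nonneg (a 1)]

end DiagonalDominance

/-! ### The nodal system: factorisation and stability. -/

/-- The linear system satisfied by the nodal values `U` of a CIP finite element function with
load vector `F`, together with the scaled derivative jumps `D`; the mesh has `m + 1` elements. -/
structure IsDiscreteSolution (m : ℕ) (t γ : ℝ) (U D F : ℕ → ℂ) : Prop where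
  zero : U 0 = 0
  jump_zero : D 0 = 0
  jump : ∀ j < m, D (j + 1) = 2 * U (j + 1) - U j - U (j + 2)
  jump_last : D (m + 1) = U (m + 1) - U m - Complex.I * t * U (m + 1)
  eq_interior : ∀ j < m, D (j + 1) - (t : ℂ) ^ 2 / 6 * (U j + 4 * U (j + 1) + U (j + 2))
    + γ * (2 * D (j + 1) - D j - D (j + 2)) = F j
  eq_last : D (m + 1) - (t : ℂ) ^ 2 / 6 * (2 * U (m + 1) + U m)
    + γ * ((1 - Complex.I * t) * D (m + 1) - D m) = F m

namespace IsDiscreteSolution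

variable {m : ℕ} {t γ σ β : ℝ} {U D F : ℕ → ℂ}

/-- The factorisation read as `(γL + β)` applied to `(L - σ)U`. -/
theorem high_interior (h : IsDiscreteSolution m t γ U D F) (hβ : β = 1 + t ^ 2 / 6 + γ * σ)
    (hσ : β * σ = t ^ 2) {j : ℕ} (hj : j < m) :
    ((β : ℂ) + 2 * γ) * (D (j + 1) - σ * U (j + 1))
      = γ * ((D j - σ * U j) + (D (j + 2) - σ * U (j + 2))) + F j := by
  have hσ' : (β : ℂ) * σ = (t : ℂ) ^ 2 := by exact_mod_cast hσ
  have hβ' : (β : ℂ) = 1 + (t : ℂ) ^ 2 / 6 + γ * σ := by rw [hβ]; push_cast; ring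
  linear_combination h.eq_interior j hj - U (j + 1) * hσ' + D (j + 1) * hβ'
    + (γ * σ + (t : ℂ) ^ 2 / 6) * h.jump j hj

theorem high_last (h : IsDiscreteSolution m t γ U D F) (hβ : β = 1 + t ^ 2 / 6 + γ * σ)
    (hσ : β * σ = t ^ 2) :
    ((β : ℂ) + γ * (1 - Complex.I * t)) * (D (m + 1) - σ * U (m + 1))
      = γ * (D m - σ * U m)
        + (F m - (t : ℂ) ^ 2 / 2 * (1 + Complex.I * t / 3) * U (m + 1)) := by
  have hσ' : (β : ℂ) * σ = (t : ℂ) ^ 2 := by exact_mod_cast hσ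
  have hβ' : (β : ℂ) = 1 + (t : ℂ) ^ 2 / 6 + γ * σ := by rw [hβ]; push_cast; ring
  linear_combination h.eq_last - U (m + 1) * hσ' + D (m + 1) * hβ'
    + (γ * σ + (t : ℂ) ^ 2 / 6) * h.jump_last

/-- The factorisation read as `(L - σ)` applied to `(γL + β)U`, with `2 - σ = 2c`. -/
theorem low_interior (h : IsDiscreteSolution m t γ U D F) (hβ : β = 1 + t ^ 2 / 6 + γ * σ)
    (hσ : β * σ = t ^ 2) {c : ℝ} (hc : c = 1 - σ / 2) {j : ℕ} (hj : j < m) :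
    2 * (c : ℂ) * (β * U (j + 1) + γ * D (j + 1)) - (β * U j + γ * D j)
      - (β * U (j + 2) + γ * D (j + 2)) = F j := by
  have hσ' : (β : ℂ) * σ = (t : ℂ) ^ 2 := by exact_mod_cast hσ
  have hβ' : (β : ℂ) = 1 + (t : ℂ) ^ 2 / 6 + γ * σ := by rw [hβ]; push_cast; ring
  have hc' : (c : ℂ) = 1 - σ / 2 := by rw [hc]; push_cast; ring
  rw [hc']
  linear_combination h.eq_interior j hj - U (j + 1) * hσ' + D (j + 1) * hβ'
    - (β - (t : ℂ) ^ 2 / 6) * h.jump j hj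

/-- For `c = cos θ`, `s = sin θ` the left side is the defect of the outgoing condition
`e^{-iθ}Z_{m+1} - Z_m = F_m`. On the right only endpoint values remain, with coefficients `O(t²)`
for `D` and `O(t³)` for `U`. -/
theorem low_last (h : IsDiscreteSolution m t γ U D F) (hβ : β = 1 + t ^ 2 / 6 + γ * σ)
    (hσ : β * σ = t ^ 2) {c s : ℝ} (hc : c = 1 - σ / 2) :
    ((c : ℂ) - s * Complex.I) * (β * U (m + 1) + γ * D (m + 1)) - (β * U m + γ * D m) - F m
      = γ * ((σ : ℂ) / 2 + Complex.I * (t - s : ℝ)) * D (m + 1)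
        + Complex.I * (β * (t - s) - t ^ 3 / 6 : ℝ) * U (m + 1) := by
  have hσ' : (β : ℂ) * σ = (t : ℂ) ^ 2 := by exact_mod_cast hσ
  have hβ' : (β : ℂ) = 1 + (t : ℂ) ^ 2 / 6 + γ * σ := by rw [hβ]; push_cast; ring
  have hc' : (c : ℂ) = 1 - σ / 2 := by rw [hc]; push_cast; ring
  rw [hc']
  push_cast
  linear_combination h.eq_last - U (m + 1) / 2 * hσ' + D (m + 1) * hβ'
    - (β - (t : ℂ) ^ 2 / 6) * h.jump_last

/-- The total load `∑ ‖F j‖`. -/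
noncomputable def load (m : ℕ) (F : ℕ → ℂ) : ℝ := ∑ j ∈ Finset.range (m + 1), ‖F j‖

theorem load_eq (m : ℕ) (F : ℕ → ℂ) : load m F = (∑ j ∈ Finset.range m, ‖F j‖) + ‖F m‖ :=
  Finset.sum_range_succ _ _

theorem high_zero (h : IsDiscreteSolution m t γ U D F) : ‖D 0 - symbolRoot γ t * U 0‖ = 0 := by
  rw [h.zero, h.jump_zero]; simp

variable (h : IsDiscreteSolution m t γ U D F) (hγ : 0 < |γ|) (hγ6 : |γ| ≤ 1 / 6) (ht0 : 0 < t)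
  (ht1 : t ≤ 1)

include h hγ hγ6 ht0 ht1

/-- The interior diagonal `β + 2γ` is at least `2/3` and the last one has real part `β + γ ≥ 5/6`,
against off-diagonal entries of size at most `1/6`. The trace `U (m + 1)` in the last equation is
counted as data. -/
theorem high_dominance : ∃ c : ℕ → ℝ, (∀ j, 0 ≤ c j) ∧ (∀ j < m, c j = ‖F j‖) ∧
    c m ≤ ‖F m‖ + 2 / 3 * t ^ 2 * ‖U (m + 1)‖ ∧
    (∀ j < m, ‖D (j + 1) - symbolRoot γ t * U (j + 1)‖
      ≤ (‖D j - symbolRoot γ t * U j‖ + ‖D (j + 2) - symbolRoot γ t * U (j + 2)‖) / 4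
        + 3 / 2 * c j) ∧
    ‖D (m + 1) - symbolRoot γ t * U (m + 1)‖
      ≤ ‖D m - symbolRoot γ t * U m‖ / 5 + 6 / 5 * c m := by
  obtain ⟨hσ, hβ1, -⟩ := symbolRoot_spec hγ hγ6 ht0 ht1
  obtain ⟨hl, hu⟩ := abs_le.1 hγ6
  set σ := symbolRoot γ t
  set β := 1 + t ^ 2 / 6 + γ * σ with hβ
  set w : ℕ → ℂ := fun j ↦ D j - σ * U j with hw
  set Fn : ℂ := F m - (t : ℂ) ^ 2 / 2 * (1 + Complex.I * t / 3) * U (m + 1) with hFn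
  have nγ : ‖(γ : ℂ)‖ = |γ| := by simp
  refine ⟨fun j ↦ if j = m then ‖Fn‖ else ‖F j‖, fun j ↦ by dsimp only; split_ifs <;> positivity,
    fun j hj ↦ by simp [hj.ne], ?_, fun j hj ↦ ?_, ?_⟩
  · simp only [if_true]
    refine (norm_sub_le _ _).trans ?_
    have h1 : ‖(1 : ℂ) + Complex.I * t / 3‖ ≤ 4 / 3 := by
      refine (norm_add_le _ _).trans ?_
      simp [abs_of_pos ht0]; linarith
    have h2 : ‖(t : ℂ) ^ 2 / 2‖ = t ^ 2 / 2 := by simp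
    rw [norm_mul, norm_mul, h2]
    have := mul_le_mul_of_nonneg_left h1 (by positivity : 0 ≤ t ^ 2 / 2)
    have := mul_le_mul_of_nonneg_right this (norm_nonneg (U (m + 1)))
    linarith
  · simp only [if_neg hj.ne]
    have e := congrArg norm (h.high_interior hβ hσ hj)
    have e1 : ‖(β : ℂ) + 2 * γ‖ = β + 2 * γ := by
      rw [← Complex.ofReal_ofNat, ← Complex.ofReal_mul, ← Complex.ofReal_add, Complex.norm_real,
        Real.norm_of_nonneg (by linarith)]
    rw [norm_mul, e1] at e
    have h1 := norm_add_le ((γ : ℂ) * ((D j - σ * U j) + (D (j + 2) - σ * U (j + 2)))) (F j)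
    rw [← e, norm_mul, nγ] at h1
    have h2 := norm_add_le (D j - σ * U j) (D (j + 2) - σ * U (j + 2))
    have h3 := mul_le_mul hγ6 h2 (norm_nonneg _) (by norm_num)
    have h4 : 2 / 3 * ‖D (j + 1) - σ * U (j + 1)‖ ≤ (β + 2 * γ) * ‖D (j + 1) - σ * U (j + 1)‖ :=
      mul_le_mul_of_nonneg_right (by linarith) (norm_nonneg _)
    linarith
  · simp only [if_true]
    have e := congrArg norm (h.high_last hβ hσ)
    have e1 : 5 / 6 ≤ ‖(β : ℂ) + γ * (1 - Complex.I * t)‖ := by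
      refine le_trans ?_ (Complex.re_le_norm _)
      simp; linarith
    rw [norm_mul] at e
    have h1 := norm_add_le ((γ : ℂ) * (D m - σ * U m)) Fn
    rw [← e, norm_mul, nγ] at h1
    have h3 := mul_le_mul_of_nonneg_right hγ6 (norm_nonneg (D m - σ * U m))
    have h4 := mul_le_mul_of_nonneg_right e1 (norm_nonneg (D (m + 1) - σ * U (m + 1)))
    linarith

theorem norm_high_le : ‖D (m + 1) - symbolRoot γ t * U (m + 1)‖
      ≤ 4 / 3 * load m F + 8 / 9 * t ^ 2 * ‖U (m + 1)‖ ∧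
    ∀ j < m, ‖D (j + 1) - symbolRoot γ t * U (j + 1)‖
      ≤ ‖D (m + 1) - symbolRoot γ t * U (m + 1)‖ / 2 + 3 * load m F := by
  obtain ⟨c, c0, c1, c2, c3, c4⟩ := h.high_dominance hγ hγ6 ht0 ht1
  obtain ⟨h1, h2⟩ := dominance_sum_bound (a := fun j ↦ ‖D j - symbolRoot γ t * U j‖)
    (fun _ ↦ norm_nonneg _) h.high_zero c3 c4
  have hs : ∑ j ∈ Finset.range m, c j = ∑ j ∈ Finset.range m, ‖F j‖ :=
    Finset.sum_congr rfl fun j hj ↦ c1 j (Finset.mem_range.1 hj)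
  have hs0 : 0 ≤ ∑ j ∈ Finset.range m, ‖F j‖ := Finset.sum_nonneg fun _ _ ↦ norm_nonneg _
  rw [hs] at h1 h2
  rw [load_eq]
  refine ⟨by linarith, fun j hj ↦ (h2 j hj).trans ?_⟩
  linarith [norm_nonneg (F m)]

theorem norm_boundary_le :
    ‖Complex.exp (-(Complex.I * phase γ t)) *
        ((1 + t ^ 2 / 6 + γ * symbolRoot γ t : ℝ) * U (m + 1) + γ * D (m + 1))
      - ((1 + t ^ 2 / 6 + γ * symbolRoot γ t : ℝ) * U m + γ * D m) - F m‖
      ≤ 5 / 36 * t ^ 2 * ‖D (m + 1)‖ + t ^ 3 / 6 * ‖U (m + 1)‖ := by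
  obtain ⟨hσ, hβ1, -⟩ := symbolRoot_spec hγ hγ6 ht0 ht1
  obtain ⟨-, hσ1⟩ := symbolRoot_bounds hγ hγ6 ht0 ht1
  obtain ⟨hσ0, -⟩ := symbolRoot_bounds hγ hγ6 ht0 ht1
  obtain ⟨b1, b2⟩ := boundary_coefficient_bounds hγ hγ6 ht0 ht1
  have hc := cos_phase hγ hγ6 ht0 ht1
  rw [exp_neg_I_mul_real, h.low_last rfl hσ hc]
  refine (norm_add_le _ _).trans ?_
  rw [norm_mul, norm_mul, norm_mul, norm_mul, Complex.norm_real, Complex.norm_real,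
    Complex.norm_I, one_mul, Real.norm_eq_abs, Real.norm_eq_abs]
  have h1 : ‖(symbolRoot γ t : ℂ) / 2 + Complex.I * (t - Real.sin (phase γ t) : ℝ)‖
      ≤ 5 / 6 * t ^ 2 := by
    refine (norm_add_le _ _).trans ?_
    rw [norm_div, norm_mul, Complex.norm_real, Complex.norm_real, Complex.norm_I, one_mul,
      Complex.norm_ofNat, Real.norm_eq_abs, Real.norm_eq_abs,
      abs_of_nonneg (le_trans (by positivity) hσ0)]
    nlinarith [sq_nonneg t]
  have h2 := mul_le_mul hγ6 h1 (norm_nonneg _) (by norm_num)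
  have h3 := mul_le_mul_of_nonneg_right h2 (norm_nonneg (D (m + 1)))
  have h4 := mul_le_mul_of_nonneg_right b1 (norm_nonneg (U (m + 1)))
  linarith

/-- The endpoint values bound themselves: the recursion estimate controls `Z (m + 1)` by the load
and the boundary defect, which again contains `U (m + 1)` and `D (m + 1)`. Their coefficients are
small enough for `t ≤ 1` and `|γ| ≤ 1/6` to be absorbed on the left. -/
theorem stability_last : t * ‖U (m + 1)‖ ≤ 16 * load m F ∧
    ‖D (m + 1)‖ ≤ 32 * load m F := by
  obtain ⟨hσ, hβ1, -⟩ := symbolRoot_spec hγ hγ6 ht0 ht1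
  obtain ⟨hσ0, hσ1⟩ := symbolRoot_bounds hγ hγ6 ht0 ht1
  obtain ⟨s1, -, -⟩ := sin_phase_bounds hγ hγ6 ht0 ht1
  have hc := cos_phase hγ hγ6 ht0 ht1
  have hb := h.norm_boundary_le hγ hγ6 ht0 ht1
  obtain ⟨w1, -⟩ := h.norm_high_le hγ hγ6 ht0 ht1
  set σ := symbolRoot γ t
  set β := 1 + t ^ 2 / 6 + γ * σ with hβ
  set Z : ℕ → ℂ := fun j ↦ β * U j + γ * D j with hZ
  have hZ0 : Z 0 = 0 := by simp [hZ, h.zero, h.jump_zero]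
  obtain ⟨-, r2⟩ := recursion_bounds hZ0 (fun j hj ↦ h.low_interior hβ hσ hc hj) rfl
    (le_trans (by positivity) s1) m le_rfl
  have hD : ‖D (m + 1)‖ ≤ 4 / 3 * load m F + 17 / 9 * t ^ 2 * ‖U (m + 1)‖ := by
    have e : D (m + 1) = (D (m + 1) - σ * U (m + 1)) + σ * U (m + 1) := by ring
    have h1 := norm_add_le (D (m + 1) - σ * U (m + 1)) (σ * U (m + 1))
    rw [← e, norm_mul, Complex.norm_real, Real.norm_of_nonneg (le_trans (by positivity) hσ0)] at h1
    have := mul_le_mul_of_nonneg_right hσ1 (norm_nonneg (U (m + 1)))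
    linarith
  have hU : ‖U (m + 1)‖ ≤ ‖Z (m + 1)‖ + ‖D (m + 1)‖ / 6 := by
    have e : (β : ℂ) * U (m + 1) = Z (m + 1) - γ * D (m + 1) := by simp [hZ]
    have h1 := norm_sub_le (Z (m + 1)) (γ * D (m + 1))
    rw [← e, norm_mul, norm_mul, Complex.norm_real, Complex.norm_real, Real.norm_eq_abs,
      Real.norm_eq_abs, abs_of_nonneg (by linarith : 0 ≤ β)] at h1
    have h2 := mul_le_mul_of_nonneg_right hγ6 (norm_nonneg (D (m + 1)))
    have h3 := mul_le_mul_of_nonneg_right hβ1 (norm_nonneg (U (m + 1)))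
    linarith
  have hB : ‖Complex.exp (-(Complex.I * phase γ t)) * Z (m + 1) - Z m‖
      ≤ 5 / 36 * t ^ 2 * ‖D (m + 1)‖ + t ^ 3 / 6 * ‖U (m + 1)‖ + ‖F m‖ := by
    have := norm_add_le (Complex.exp (-(Complex.I * phase γ t)) * Z (m + 1) - Z m - F m) (F m)
    rw [sub_add_cancel] at this
    linarith
  have hs := mul_le_mul_of_nonneg_right s1 (norm_nonneg (Z (m + 1)))
  have hload := load_eq m F
  set S := load m F
  set x := ‖U (m + 1)‖
  set d := ‖D (m + 1)‖
  have hS : 0 ≤ S := Finset.sum_nonneg fun _ _ ↦ norm_nonneg _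
  have hx : 0 ≤ x := norm_nonneg _
  have hd : 0 ≤ d := norm_nonneg _
  have k1 : 3 / 4 * t * x ≤ 19 / 72 * (t * d) + t ^ 3 / 6 * x + S := by
    have h1 := mul_le_mul_of_nonneg_left hU ht0.le
    have h2 : t ^ 2 * d ≤ t * d := mul_le_mul_of_nonneg_right (by nlinarith) hd
    linarith
  have ht3 : t ^ 3 * x ≤ t * x := mul_le_mul_of_nonneg_right (by
    have : t ^ 2 ≤ 1 := by nlinarith
    nlinarith) hx
  have htS : t * S ≤ S := mul_le_of_le_one_left hS ht1
  have k2 := mul_le_mul_of_nonneg_left hD ht0.le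
  have k3 : t * x ≤ 16 * S := by nlinarith
  refine ⟨k3, hD.trans ?_⟩
  have k4 : t ^ 2 * x ≤ t * x := mul_le_mul_of_nonneg_right (by nlinarith) hx
  linarith

theorem norm_boundary_sub_le :
    ‖Complex.exp (-(Complex.I * phase γ t)) *
        ((1 + t ^ 2 / 6 + γ * symbolRoot γ t : ℝ) * U (m + 1) + γ * D (m + 1))
      - ((1 + t ^ 2 / 6 + γ * symbolRoot γ t : ℝ) * U m + γ * D m) - F m‖
      ≤ 8 * t ^ 2 * load m F := by
  refine (h.norm_boundary_le hγ hγ6 ht0 ht1).trans ?_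
  obtain ⟨h1, h2⟩ := h.stability_last hγ hγ6 ht0 ht1
  have hS : 0 ≤ load m F := Finset.sum_nonneg fun _ _ ↦ norm_nonneg _
  have := mul_le_mul_of_nonneg_left h2 (sq_nonneg t)
  have := mul_le_mul_of_nonneg_left h1 (sq_nonneg t)
  nlinarith [mul_nonneg (sq_nonneg t) hS]

/-- `U` is recovered from `βU = Z - γD` and `D = w + σU`, where `β ≥ 1`, `|γ| ≤ 1/6` and `σ ≤ 1`
permit absorption of `U`. -/
theorem stability : ∀ j ≤ m + 1, t * ‖U j‖ ≤ 18 * load m F := by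
  obtain ⟨hσ, hβ1, -⟩ := symbolRoot_spec hγ hγ6 ht0 ht1
  obtain ⟨hσ0, hσ1⟩ := symbolRoot_bounds hγ hγ6 ht0 ht1
  obtain ⟨s1, -, -⟩ := sin_phase_bounds hγ hγ6 ht0 ht1
  have hc := cos_phase hγ hγ6 ht0 ht1
  have hb := h.norm_boundary_sub_le hγ hγ6 ht0 ht1
  obtain ⟨w1, w2⟩ := h.norm_high_le hγ hγ6 ht0 ht1
  obtain ⟨l1, l2⟩ := h.stability_last hγ hγ6 ht0 ht1
  set σ := symbolRoot γ t
  set β := 1 + t ^ 2 / 6 + γ * σ with hβ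
  set Z : ℕ → ℂ := fun j ↦ β * U j + γ * D j with hZ
  have hZ0 : Z 0 = 0 := by simp [hZ, h.zero, h.jump_zero]
  have hload := load_eq m F
  have hS : 0 ≤ load m F := Finset.sum_nonneg fun _ _ ↦ norm_nonneg _
  intro j hj
  obtain _ | j := j
  · rw [h.zero]; simpa using hS
  rcases (Nat.lt_or_ge j m) with hjm | hjm
  swap
  · obtain rfl : j = m := by omega
    linarith
  obtain ⟨-, r2⟩ := recursion_bounds hZ0 (fun j hj ↦ h.low_interior hβ hσ hc hj) rfl
    (le_trans (by positivity) s1) j (by omega)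
  have hB : ‖Complex.exp (-(Complex.I * phase γ t)) * Z (m + 1) - Z m‖
      ≤ 8 * t ^ 2 * load m F + ‖F m‖ := by
    have := norm_add_le (Complex.exp (-(Complex.I * phase γ t)) * Z (m + 1) - Z m - F m) (F m)
    rw [sub_add_cancel] at this
    linarith
  have hs := mul_le_mul_of_nonneg_right s1 (norm_nonneg (Z (j + 1)))
  have ht2 : t ^ 2 ≤ 1 := by nlinarith
  have ht2S := mul_le_mul_of_nonneg_right ht2 hS
  have kW : ‖D (j + 1) - σ * U (j + 1)‖ ≤ 11 * load m F := by
    have := w2 j hjm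
    have k4 : t ^ 2 * ‖U (m + 1)‖ ≤ t * ‖U (m + 1)‖ :=
      mul_le_mul_of_nonneg_right (by nlinarith) (norm_nonneg _)
    linarith
  have hD : ‖D (j + 1)‖ ≤ 11 * load m F + ‖U (j + 1)‖ := by
    have e : D (j + 1) = (D (j + 1) - σ * U (j + 1)) + σ * U (j + 1) := by ring
    have h1 := norm_add_le (D (j + 1) - σ * U (j + 1)) (σ * U (j + 1))
    rw [← e, norm_mul, Complex.norm_real, Real.norm_of_nonneg (le_trans (by positivity) hσ0)] at h1
    have := mul_le_mul_of_nonneg_right (hσ1.trans ht2) (norm_nonneg (U (j + 1)))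
    linarith
  have hU : ‖U (j + 1)‖ ≤ ‖Z (j + 1)‖ + ‖D (j + 1)‖ / 6 := by
    have e : (β : ℂ) * U (j + 1) = Z (j + 1) - γ * D (j + 1) := by simp [hZ]
    have h1 := norm_sub_le (Z (j + 1)) (γ * D (j + 1))
    rw [← e, norm_mul, norm_mul, Complex.norm_real, Complex.norm_real, Real.norm_eq_abs,
      Real.norm_eq_abs, abs_of_nonneg (by linarith : 0 ≤ β)] at h1
    have h2 := mul_le_mul_of_nonneg_right hγ6 (norm_nonneg (D (j + 1)))
    have h3 := mul_le_mul_of_nonneg_right hβ1 (norm_nonneg (U (j + 1)))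
    linarith
  have k1 : ‖U (j + 1)‖ ≤ 6 / 5 * ‖Z (j + 1)‖ + 11 / 5 * load m F := by linarith
  have k2 := mul_le_mul_of_nonneg_left k1 ht0.le
  have htS : t * load m F ≤ load m F := mul_le_of_le_one_left hS ht1
  linarith

theorem high_sq_sum_le : ∑ j ∈ Finset.range (m + 1), ‖D (j + 1) - symbolRoot γ t * U (j + 1)‖ ^ 2
    ≤ 18 * ∑ j ∈ Finset.range (m + 1), ‖F j‖ ^ 2 + 2100 * t ^ 2 * load m F ^ 2 := by
  obtain ⟨c, c0, c1, c2, c3, c4⟩ := h.high_dominance hγ hγ6 ht0 ht1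
  have h1 := dominance_sq_sum_bound (a := fun j ↦ ‖D j - symbolRoot γ t * U j‖)
    (fun _ ↦ norm_nonneg _) h.high_zero c3 c4
  refine h1.trans ?_
  obtain ⟨l1, -⟩ := h.stability_last hγ hγ6 ht0 ht1
  have hs : ∑ j ∈ Finset.range m, c j ^ 2 = ∑ j ∈ Finset.range m, ‖F j‖ ^ 2 :=
    Finset.sum_congr rfl fun j hj ↦ by rw [c1 j (Finset.mem_range.1 hj)]
  rw [Finset.sum_range_succ, Finset.sum_range_succ (fun j ↦ ‖F j‖ ^ 2), hs]
  have hs0 : 0 ≤ ∑ j ∈ Finset.range m, ‖F j‖ ^ 2 := Finset.sum_nonneg fun _ _ ↦ sq_nonneg _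
  -- `32/3 = 2/3 · 16`, from the trace term and `stability_last`.
  have hcm : c m ≤ ‖F m‖ + 32 / 3 * (t * load m F) := by
    have := mul_le_mul_of_nonneg_left l1 ht0.le
    linarith
  have := pow_le_pow_left₀ (c0 m) hcm 2
  nlinarith [sq_nonneg (‖F m‖ - 32 / 3 * (t * load m F)), sq_nonneg (t * load m F)]

end IsDiscreteSolution

/-! ### The uniform mesh. -/

section Mesh

variable {n : ℕ}

theorem step_pos (hn : 0 < n) : 0 < step n := by
  have : (0 : ℝ) < n := by exact_mod_cast hn
  unfold step; positivity

theorem node_zero (n : ℕ) : node n 0 = 0 := by simp [node]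

theorem node_self (hn : 0 < n) : node n n = 1 := by
  have : (n : ℝ) ≠ 0 := by exact_mod_cast hn.ne'
  simp [node, this]

theorem node_succ (n j : ℕ) : node n (j + 1) = node n j + step n := by
  simp [node, step]; ring

theorem node_lt_succ (hn : 0 < n) (j : ℕ) : node n j < node n (j + 1) := by
  rw [node_succ]; linarith [step_pos hn]

theorem node_mem (hn : 0 < n) {j : ℕ} (hj : j ≤ n) : node n j ∈ Icc (0 : ℝ) 1 := by
  have h1 : (0 : ℝ) < n := by exact_mod_cast hn
  have h2 : (j : ℝ) ≤ n := by exact_mod_cast hj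
  exact ⟨by unfold node; positivity, by unfold node; rw [div_le_one h1]; exact h2⟩

theorem cell_subset (hn : 0 < n) {j : ℕ} (hj : j < n) :
    Icc (node n j) (node n (j + 1)) ⊆ Icc 0 1 :=
  Icc_subset_Icc (node_mem hn hj.le).1 (node_mem hn hj).2

theorem open_cell_subset (hn : 0 < n) {j : ℕ} (hj : j < n) :
    Ioo (node n j) (node n (j + 1)) ⊆ Ioo 0 1 :=
  Ioo_subset_Ioo (node_mem hn hj.le).1 (node_mem hn hj).2

theorem exists_cell (hn : 0 < n) {x : ℝ} (hx : x ∈ Icc (0 : ℝ) 1) :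
    ∃ j < n, x ∈ Icc (node n j) (node n (j + 1)) := by
  have h1 : (0 : ℝ) < n := by exact_mod_cast hn
  -- At `x = 1` the floor would give the index `n`, one too large.
  rcases hx.2.eq_or_lt with rfl | hlt
  · refine ⟨n - 1, by omega, ?_⟩
    have e : n - 1 + 1 = n := by omega
    rw [e, node_self hn]
    exact ⟨(node_mem hn (by omega)).2, le_rfl⟩
  · have h0 : 0 ≤ n * x := mul_nonneg h1.le hx.1
    refine ⟨⌊n * x⌋₊, ?_, ?_, ?_⟩
    · rw [Nat.floor_lt h0]; nlinarith
    · unfold node; rw [div_le_iff₀ h1]; exact (Nat.floor_le h0).trans_eq (mul_comm _ _)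
    · unfold node; rw [le_div_iff₀ h1, mul_comm]; push_cast; exact (Nat.lt_floor_add_one _).le

theorem integral_eq_sum_cells {E : Type*} [NormedAddCommGroup E] [NormedSpace ℝ E] (hn : 0 < n)
    {g : ℝ → E} (hg : ∀ j < n, IntervalIntegrable g volume (node n j) (node n (j + 1))) :
    ∫ x in (0 : ℝ)..1, g x = ∑ j ∈ Finset.range n, ∫ x in (node n j)..(node n (j + 1)), g x := by
  rw [intervalIntegral.sum_integral_adjacent_intervals hg, node_zero, node_self hn]

end Mesh

/-! ### Finite element functions, element integrals and interpolation. -/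

section FiniteElements

variable {n : ℕ} {v w : ℝ → ℂ}

/-- The slope of the finite element function `v` on the element `(x_j, x_{j+1})`. -/
noncomputable def slopeOn (n : ℕ) (v : ℝ → ℂ) (j : ℕ) : ℂ :=
  (v (node n (j + 1)) - v (node n j)) / step n

theorem MemFESpace.eq_affine (hv : MemFESpace n v) (hn : 0 < n) {j : ℕ} (hj : j < n) {x : ℝ}
    (hx : x ∈ Icc (node n j) (node n (j + 1))) :
    v x = v (node n j) + slopeOn n v j * (x - node n j : ℝ) := by
  obtain ⟨hc, -, haff⟩ := hv
  obtain ⟨a, b, hab⟩ := haff j hj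
  have hlt := node_lt_succ hn j
  have heq : EqOn v (fun x ↦ a + b * x) (Icc (node n j) (node n (j + 1))) :=
    EqOn.of_subset_closure hab (hc.mono (cell_subset hn hj)) (by fun_prop) Ioo_subset_Icc_self
      (by rw [closure_Ioo hlt.ne])
  have hs : (step n : ℂ) ≠ 0 := by exact_mod_cast (step_pos hn).ne'
  unfold slopeOn
  rw [heq hx, heq (left_mem_Icc.2 hlt.le), heq (right_mem_Icc.2 hlt.le), node_succ]
  push_cast
  field_simp
  ring

theorem MemFESpace.hasDerivAt (hv : MemFESpace n v) (hn : 0 < n) {j : ℕ} (hj : j < n) {x : ℝ}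
    (hx : x ∈ Ioo (node n j) (node n (j + 1))) : HasDerivAt v (slopeOn n v j) x := by
  have h : HasDerivAt (fun x : ℝ ↦ v (node n j) + slopeOn n v j * ((x - node n j : ℝ) : ℂ))
      (slopeOn n v j * ((1 : ℝ) : ℂ)) x :=
    ((((hasDerivAt_id x).sub_const (node n j)).ofReal_comp).const_mul _).const_add _
  rw [Complex.ofReal_one, mul_one] at h
  refine h.congr_of_eventuallyEq ?_
  filter_upwards [Ioo_mem_nhds hx.1 hx.2] with y hy
  exact hv.eq_affine hn hj (Ioo_subset_Icc_self hy)

theorem leftLim_deriv {a b : ℝ} (hab : a < b) {g : ℝ → ℂ} {L : ℂ}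
    (hw : ∀ x ∈ Ioo a b, HasDerivAt w (g x) x) (hg : Tendsto g (𝓝[<] b) (𝓝 L)) :
    Function.leftLim (deriv w) b = L := by
  refine leftLim_eq_of_tendsto (hg.congr' ?_)
  filter_upwards [Ioo_mem_nhdsLT hab] with x hx
  exact (hw x hx).deriv.symm

theorem rightLim_deriv {a b : ℝ} (hab : a < b) {g : ℝ → ℂ} {L : ℂ}
    (hw : ∀ x ∈ Ioo a b, HasDerivAt w (g x) x) (hg : Tendsto g (𝓝[>] a) (𝓝 L)) :
    Function.rightLim (deriv w) a = L := by
  refine rightLim_eq_of_tendsto (hg.congr' ?_)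
  filter_upwards [Ioo_mem_nhdsGT hab] with x hx
  exact (hw x hx).deriv.symm

theorem MemFESpace.leftLim (hv : MemFESpace n v) (hn : 0 < n) {j : ℕ} (hj : j < n) :
    Function.leftLim (deriv v) (node n (j + 1)) = slopeOn n v j :=
  leftLim_deriv (node_lt_succ hn j) (g := fun _ ↦ slopeOn n v j)
    (fun _ hx ↦ hv.hasDerivAt hn hj hx) tendsto_const_nhds

theorem MemFESpace.rightLim (hv : MemFESpace n v) (hn : 0 < n) {j : ℕ} (hj : j < n) :
    Function.rightLim (deriv v) (node n j) = slopeOn n v j :=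
  rightLim_deriv (node_lt_succ hn j) (g := fun _ ↦ slopeOn n v j)
    (fun _ hx ↦ hv.hasDerivAt hn hj hx) tendsto_const_nhds

theorem MemFESpace.derivJump_eq (hv : MemFESpace n v) (hn : 0 < n) {j : ℕ} (hj : j + 1 < n) :
    derivJump n v (j + 1) = slopeOn n v j - slopeOn n v (j + 1) := by
  unfold derivJump
  rw [hv.leftLim hn (by omega), hv.rightLim hn hj]

theorem MemFESpace.l2inner_deriv (hv : MemFESpace n v) (hw : MemFESpace n w) (hn : 0 < n) :
    l2inner (deriv v) (deriv w)
      = ∑ j ∈ Finset.range n, step n * (slopeOn n v j * conj (slopeOn n w j)) := by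
  have hc : ∀ j < n, EqOn (fun _ ↦ slopeOn n v j * conj (slopeOn n w j))
      (fun x ↦ deriv v x * conj (deriv w x)) (uIoo (node n j) (node n (j + 1))) := by
    intro j hj x hx
    rw [uIoo_of_le (node_lt_succ hn j).le] at hx
    simp only [(hv.hasDerivAt hn hj hx).deriv, (hw.hasDerivAt hn hj hx).deriv]
  unfold l2inner
  rw [setIntegral_eq_intervalIntegral, integral_eq_sum_cells hn fun j hj ↦
    (intervalIntegrable_const).congr_uIoo (hc j hj)]
  refine Finset.sum_congr rfl fun j hj ↦ ?_
  rw [← intervalIntegral.integral_congr_uIoo (hc j (Finset.mem_range.1 hj)),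
    intervalIntegral.integral_const, node_succ, add_sub_cancel_left, Complex.real_smul]

theorem MemFESpace.continuousOn_cell (hv : MemFESpace n v) (hn : 0 < n) {j : ℕ} (hj : j < n) :
    ContinuousOn v (uIcc (node n j) (node n (j + 1))) := by
  rw [uIcc_of_le (node_lt_succ hn j).le]
  exact hv.1.mono (cell_subset hn hj)

theorem integral_affine_mul_affine (A B C E : ℂ) (a h : ℝ) :
    ∫ x in a..(a + h), (A + B * (x - a : ℝ)) * (C + E * (x - a : ℝ))
      = A * C * h + (A * E + B * C) * h ^ 2 / 2 + B * E * h ^ 3 / 3 := by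
  have hd : ∀ x : ℝ, HasDerivAt (fun x : ℝ ↦ A * C * ((x - a : ℝ) : ℂ)
      + (A * E + B * C) / 2 * ((x - a : ℝ) : ℂ) ^ 2 + B * E / 3 * ((x - a : ℝ) : ℂ) ^ 3)
      ((A + B * (x - a : ℝ)) * (C + E * (x - a : ℝ))) x := by
    intro x
    have h1 : HasDerivAt (fun x : ℝ ↦ ((x - a : ℝ) : ℂ)) ((1 : ℝ) : ℂ) x :=
      ((hasDerivAt_id x).sub_const a).ofReal_comp
    refine (((h1.const_mul (A * C)).add ((h1.pow 2).const_mul ((A * E + B * C) / 2))).add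
      ((h1.pow 3).const_mul (B * E / 3))).congr_deriv ?_
    push_cast; ring
  rw [intervalIntegral.integral_eq_sub_of_hasDerivAt (fun x _ ↦ hd x)
    ((by fun_prop : Continuous fun x : ℝ ↦
      (A + B * (x - a : ℝ)) * (C + E * (x - a : ℝ))).intervalIntegrable _ _)]
  push_cast; ring

theorem MemFESpace.l2inner_eq (hv : MemFESpace n v) (hw : MemFESpace n w) (hn : 0 < n) :
    l2inner v w = ∑ j ∈ Finset.range n, (step n : ℂ) / 6 *
      (2 * v (node n j) * conj (w (node n j)) + v (node n j) * conj (w (node n (j + 1)))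
        + v (node n (j + 1)) * conj (w (node n j))
        + 2 * v (node n (j + 1)) * conj (w (node n (j + 1)))) := by
  have hi : ∀ j < n, IntervalIntegrable (fun x ↦ v x * conj (w x)) volume
      (node n j) (node n (j + 1)) := fun j hj ↦
    ((hv.continuousOn_cell hn hj).mul (Complex.continuous_conj.comp_continuousOn
      (hw.continuousOn_cell hn hj))).intervalIntegrable
  unfold l2inner
  rw [setIntegral_eq_intervalIntegral, integral_eq_sum_cells hn hi]
  refine Finset.sum_congr rfl fun j hj ↦ ?_
  have hj' := Finset.mem_range.1 hj
  have hs : (step n : ℂ) ≠ 0 := by exact_mod_cast (step_pos hn).ne'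
  have e : ∫ x in (node n j)..(node n (j + 1)), v x * conj (w x)
      = ∫ x in (node n j)..(node n j + step n),
        (v (node n j) + slopeOn n v j * (x - node n j : ℝ))
          * (conj (w (node n j)) + conj (slopeOn n w j) * (x - node n j : ℝ)) := by
    rw [node_succ]
    refine intervalIntegral.integral_congr fun x hx ↦ ?_
    rw [← node_succ, uIcc_of_le (node_lt_succ hn j).le] at hx
    simp only [hv.eq_affine hn hj' hx, hw.eq_affine hn hj' hx, map_add, map_mul,
      Complex.conj_ofReal]
  rw [e, integral_affine_mul_affine]
  unfold slopeOn
  rw [map_div₀, map_sub, Complex.conj_ofReal]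
  field_simp
  ring

/-- `∫ (x_{j+1} - y) f(y) dy` over the element `(x_j, x_{j+1})`. -/
noncomputable def momentLeft (n : ℕ) (f : ℝ → ℂ) (j : ℕ) : ℂ :=
  ∫ y in (node n j)..(node n (j + 1)), ((node n (j + 1) - y : ℝ) : ℂ) * f y

/-- `∫ (y - x_j) f(y) dy` over the element `(x_j, x_{j+1})`. -/
noncomputable def momentRight (n : ℕ) (f : ℝ → ℂ) (j : ℕ) : ℂ :=
  ∫ y in (node n j)..(node n (j + 1)), ((y - node n j : ℝ) : ℂ) * f y

theorem MemFESpace.l2inner_load (hw : MemFESpace n w) {f : ℝ → ℂ}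
    (hf : IntervalIntegrable f volume 0 1) (hn : 0 < n) :
    step n * l2inner f w = ∑ j ∈ Finset.range n,
      (conj (w (node n j)) * momentLeft n f j
        + conj (w (node n (j + 1))) * momentRight n f j) := by
  have hfj : ∀ j < n, IntervalIntegrable f volume (node n j) (node n (j + 1)) := fun j hj ↦
    intervalIntegrable_mono_unit hf (node_mem hn hj.le) (node_mem hn hj)
  have hi : ∀ j < n, IntervalIntegrable (fun x ↦ f x * conj (w x)) volume
      (node n j) (node n (j + 1)) := fun j hj ↦
    (hfj j hj).mul_continuousOn
      (Complex.continuous_conj.comp_continuousOn (hw.continuousOn_cell hn hj))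
  unfold l2inner
  rw [setIntegral_eq_intervalIntegral, integral_eq_sum_cells hn hi, Finset.mul_sum]
  refine Finset.sum_congr rfl fun j hj ↦ ?_
  have hj' := Finset.mem_range.1 hj
  have hs : (step n : ℂ) ≠ 0 := by exact_mod_cast (step_pos hn).ne'
  unfold momentLeft momentRight
  rw [← intervalIntegral.integral_const_mul, ← intervalIntegral.integral_const_mul,
    ← intervalIntegral.integral_const_mul, ← intervalIntegral.integral_add
      (((hfj j hj').continuousOn_mul (by fun_prop)).const_mul _)
      (((hfj j hj').continuousOn_mul (by fun_prop)).const_mul _)]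
  refine intervalIntegral.integral_congr fun x hx ↦ ?_
  rw [uIcc_of_le (node_lt_succ hn j).le] at hx
  simp only [hw.eq_affine hn hj' hx, map_add, map_mul, Complex.conj_ofReal]
  unfold slopeOn
  rw [map_div₀, map_sub, Complex.conj_ofReal, node_succ]
  push_cast
  field_simp
  ring

/-- The continuous piecewise affine function with nodal values `V`. -/
noncomputable def nodalInterp (n : ℕ) (V : ℕ → ℂ) (x : ℝ) : ℂ :=
  ∑ j ∈ Finset.range (n + 1), V j * (max 0 (1 - |n * x - j|) : ℝ)

theorem nodalInterp_eq (hn : 0 < n) (V : ℕ → ℂ) {i : ℕ} (hi : i < n) {x : ℝ}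
    (hx : x ∈ Icc (node n i) (node n (i + 1))) :
    nodalInterp n V x = V i + (V (i + 1) - V i) * (n * x - i : ℝ) := by
  have h1 : (0 : ℝ) < n := by exact_mod_cast hn
  have hl : (i : ℝ) ≤ n * x := by
    have := hx.1; unfold node at this; rwa [div_le_iff₀ h1, mul_comm] at this
  have hr : n * x ≤ (i : ℝ) + 1 := by
    have := hx.2; unfold node at this; rw [le_div_iff₀ h1, mul_comm] at this
    exact_mod_cast this
  unfold nodalInterp
  rw [Finset.sum_eq_add i (i + 1) (by omega)]
  · have e1 : max 0 (1 - |n * x - (i : ℝ)|) = 1 - (n * x - i) := by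
      rw [abs_of_nonneg (by linarith), max_eq_right (by linarith)]
    have e2 : max 0 (1 - |n * x - ((i + 1 : ℕ) : ℝ)|) = n * x - i := by
      push_cast
      rw [abs_of_nonpos (by linarith), max_eq_right (by linarith)]; ring
    rw [e1, e2]; push_cast; ring
  · intro c _ hc
    have : max 0 (1 - |n * x - (c : ℝ)|) = 0 := by
      refine max_eq_left ?_
      rw [sub_nonpos]
      rcases lt_or_gt_of_ne hc.1 with h | h
      · have : (c : ℝ) + 1 ≤ i := by exact_mod_cast h
        exact le_trans (by linarith) (le_abs_self _)
      · have : (i : ℝ) + 2 ≤ c := by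
          have : i + 2 ≤ c := by omega
          exact_mod_cast this
        exact le_trans (by linarith) (neg_le_abs _)
    rw [this]; simp
  · intro h; simp at h; omega
  · intro h; simp at h; omega

theorem nodalInterp_node (hn : 0 < n) (V : ℕ → ℂ) {i : ℕ} (hi : i ≤ n) :
    nodalInterp n V (node n i) = V i := by
  have h1 : (n : ℝ) ≠ 0 := by exact_mod_cast hn.ne'
  have e : ∀ j : ℕ, (n : ℝ) * node n j = j := fun j ↦ by unfold node; field_simp
  rcases hi.eq_or_lt with rfl | h
  · obtain ⟨m, rfl⟩ : ∃ m, i = m + 1 := ⟨i - 1, by omega⟩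
    rw [nodalInterp_eq hn V (Nat.lt_succ_self m) (right_mem_Icc.2 (node_lt_succ hn m).le), e]
    push_cast; ring
  · rw [nodalInterp_eq hn V h (left_mem_Icc.2 (node_lt_succ hn i).le), e]
    push_cast; ring

theorem memFESpace_nodalInterp (hn : 0 < n) {V : ℕ → ℂ} (hV : V 0 = 0) :
    MemFESpace n (nodalInterp n V) := by
  refine ⟨?_, ?_, fun j hj ↦ ⟨V j - (V (j + 1) - V j) * j, (V (j + 1) - V j) * n, fun x hx ↦ ?_⟩⟩
  · unfold nodalInterp; fun_prop
  · have := nodalInterp_node hn V (Nat.zero_le n)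
    rwa [node_zero, hV] at this
  · rw [nodalInterp_eq hn V hj (Ioo_subset_Icc_self hx)]
    push_cast; ring

end FiniteElements

/-! ### Summation by parts. -/

section SummationByParts

theorem sum_stiffness (U V : ℕ → ℂ) (hV : V 0 = 0) (m : ℕ) :
    ∑ j ∈ Finset.range (m + 1), (U (j + 1) - U j) * (V (j + 1) - V j)
      = ∑ j ∈ Finset.range m, V (j + 1) * (2 * U (j + 1) - U j - U (j + 2))
        + V (m + 1) * (U (m + 1) - U m) := by
  induction m with
  | zero => simp [hV]; ring
  | succ m ih => rw [Finset.sum_range_succ, ih, Finset.sum_range_succ]; ring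

theorem sum_mass (U V : ℕ → ℂ) (hV : V 0 = 0) (m : ℕ) :
    ∑ j ∈ Finset.range (m + 1), (2 * U j * V j + U j * V (j + 1) + U (j + 1) * V j
        + 2 * U (j + 1) * V (j + 1))
      = ∑ j ∈ Finset.range m, V (j + 1) * (U j + 4 * U (j + 1) + U (j + 2))
        + V (m + 1) * (2 * U (m + 1) + U m) := by
  induction m with
  | zero => simp [hV]; ring
  | succ m ih => rw [Finset.sum_range_succ, ih, Finset.sum_range_succ]; ring

/-- The second difference moves from the test values to the jumps. The boundary term with `V m` is
cancelled by the penalty at `x = 1`, leaving the coefficient `(1 - it)D_{m+1} - D_m` of `V (m + 1)`.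
-/
theorem sum_penalty (D V : ℕ → ℂ) (hV : V 0 = 0) (hD : D 0 = 0) (m : ℕ) :
    ∑ j ∈ Finset.range m, D (j + 1) * (2 * V (j + 1) - V j - V (j + 2))
      = ∑ j ∈ Finset.range m, V (j + 1) * (2 * D (j + 1) - D j - D (j + 2))
        + V m * D (m + 1) - V (m + 1) * D m := by
  induction m with
  | zero => simp [hV, hD]
  | succ m ih => rw [Finset.sum_range_succ, ih, Finset.sum_range_succ]; ring

theorem sum_load (V A B : ℕ → ℂ) (hV : V 0 = 0) (m : ℕ) :
    ∑ j ∈ Finset.range (m + 1), (V j * A j + V (j + 1) * B j)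
      = ∑ j ∈ Finset.range m, V (j + 1) * (B j + A (j + 1)) + V (m + 1) * B m := by
  induction m with
  | zero => simp [hV]
  | succ m ih => rw [Finset.sum_range_succ, ih, Finset.sum_range_succ]; ring

end SummationByParts

/-! ### Equivalence of the variational problem with the nodal system. -/

/-- The scaled derivative jumps of the piecewise affine function with nodal values `U`. -/
noncomputable def jumpSeq (m : ℕ) (t : ℝ) (U : ℕ → ℂ) : ℕ → ℂ
  | 0 => 0
  | j + 1 => if j < m then 2 * U (j + 1) - U j - U (j + 2)
      else U (j + 1) - U j - Complex.I * t * U (j + 1)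

/-- The left-hand sides of the nodal equations. -/
noncomputable def nodalForm (m : ℕ) (t γ : ℝ) (U : ℕ → ℂ) (j : ℕ) : ℂ :=
  if j < m then
    jumpSeq m t U (j + 1) - (t : ℂ) ^ 2 / 6 * (U j + 4 * U (j + 1) + U (j + 2))
      + γ * (2 * jumpSeq m t U (j + 1) - jumpSeq m t U j - jumpSeq m t U (j + 2))
  else
    jumpSeq m t U (m + 1) - (t : ℂ) ^ 2 / 6 * (2 * U (m + 1) + U m)
      + γ * ((1 - Complex.I * t) * jumpSeq m t U (m + 1) - jumpSeq m t U m)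

/-- The load vector of `f`, scaled by the mesh size. -/
noncomputable def nodalLoad (m : ℕ) (f : ℝ → ℂ) (j : ℕ) : ℂ :=
  momentRight (m + 1) f j + if j < m then momentLeft (m + 1) f (j + 1) else 0

/-- The nodal values of `v`. -/
noncomputable def nodal (n : ℕ) (v : ℝ → ℂ) (j : ℕ) : ℂ := v (node n j)

theorem isDiscreteSolution_iff {m : ℕ} {t γ : ℝ} {U F : ℕ → ℂ} :
    IsDiscreteSolution m t γ U (jumpSeq m t U) F ↔
      U 0 = 0 ∧ ∀ j < m + 1, nodalForm m t γ U j = F j := by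
  constructor
  · intro h
    refine ⟨h.zero, fun j hj ↦ ?_⟩
    unfold nodalForm
    split_ifs with hjm
    · exact h.eq_interior j hjm
    · obtain rfl : j = m := by omega
      exact h.eq_last
  · rintro ⟨h0, h⟩
    refine ⟨h0, rfl, fun j hj ↦ by simp [jumpSeq, hj], by simp [jumpSeq], fun j hj ↦ ?_, ?_⟩
    · rw [← h j (by omega)]; simp [nodalForm, hj]
    · rw [← h m (by omega)]; simp [nodalForm]

variable {m : ℕ} {k γ : ℝ}

theorem MemFESpace.nodal_zero {n : ℕ} {v : ℝ → ℂ} (hv : MemFESpace n v) : nodal n v 0 = 0 := by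
  unfold nodal; rw [node_zero]; exact hv.2.1

theorem MemFESpace.step_mul_derivJump {v : ℝ → ℂ} (hv : MemFESpace (m + 1) v) (t : ℝ) {j : ℕ}
    (hj : j < m) :
    step (m + 1) * derivJump (m + 1) v (j + 1) = jumpSeq m t (nodal (m + 1) v) (j + 1) := by
  have hs : (step (m + 1) : ℂ) ≠ 0 := by exact_mod_cast (step_pos (Nat.succ_pos m)).ne'
  rw [hv.derivJump_eq (Nat.succ_pos m) (by omega)]
  simp only [jumpSeq, hj, if_true, slopeOn, nodal]
  field_simp
  ring

theorem MemFESpace.step_mul_derivAtOne {v : ℝ → ℂ} (hv : MemFESpace (m + 1) v) :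
    step (m + 1) * derivAtOne v = nodal (m + 1) v (m + 1) - nodal (m + 1) v m := by
  have hs : (step (m + 1) : ℂ) ≠ 0 := by exact_mod_cast (step_pos (Nat.succ_pos m)).ne'
  have := hv.leftLim (Nat.succ_pos m) (Nat.lt_succ_self m)
  unfold derivAtOne
  rw [← node_self (Nat.succ_pos m), this]
  unfold slopeOn nodal
  field_simp

theorem step_mul_cipForm {v w : ℝ → ℂ} (hv : MemFESpace (m + 1) v) (hw : MemFESpace (m + 1) w) :
    step (m + 1) * cipForm k γ (m + 1) v w = ∑ j ∈ Finset.range (m + 1),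
      conj (nodal (m + 1) w (j + 1)) * nodalForm m (k * step (m + 1)) γ (nodal (m + 1) v) j := by
  have hn : 0 < m + 1 := Nat.succ_pos m
  have hs : (step (m + 1) : ℂ) ≠ 0 := by exact_mod_cast (step_pos hn).ne'
  set t := k * step (m + 1) with ht
  have ht' : (t : ℂ) = k * step (m + 1) := by rw [ht]; push_cast; ring
  set U := nodal (m + 1) v with hU
  set V : ℕ → ℂ := fun j ↦ conj (nodal (m + 1) w j) with hV
  have hV0 : V 0 = 0 := by simp [hV, hw.nodal_zero]
  set D := jumpSeq m t U with hD
  have hD0 : D 0 = 0 := rfl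
  have e1 : step (m + 1) * l2inner (deriv v) (deriv w)
      = ∑ j ∈ Finset.range (m + 1), (U (j + 1) - U j) * (V (j + 1) - V j) := by
    rw [hv.l2inner_deriv hw hn, Finset.mul_sum]
    refine Finset.sum_congr rfl fun j _ ↦ ?_
    simp only [slopeOn, map_div₀, map_sub, Complex.conj_ofReal, hU, hV, nodal]
    field_simp
  have e2 : step (m + 1) * ((k : ℂ) ^ 2 * l2inner v w)
      = (t : ℂ) ^ 2 / 6 * ∑ j ∈ Finset.range (m + 1), (2 * U j * V j + U j * V (j + 1)
        + U (j + 1) * V j + 2 * U (j + 1) * V (j + 1)) := by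
    rw [hv.l2inner_eq hw hn, ← Finset.mul_sum, ht']
    simp only [hU, hV, nodal]
    ring
  have e3 : step (m + 1) * penalty k γ (m + 1) v w
      = γ * (∑ j ∈ Finset.range m, D (j + 1) * (2 * V (j + 1) - V j - V (j + 2))
        + D (m + 1) * (V (m + 1) - V m - Complex.I * t * V (m + 1))) := by
    unfold penalty
    rw [mul_add, mul_add, Finset.mul_sum, Finset.mul_sum, Finset.sum_Ico_eq_sum_range]
    congr 1
    · refine Finset.sum_congr (by simp) fun j hj ↦ ?_
      have hj' : j < m := by simpa using hj
      have h1 := hv.step_mul_derivJump t hj'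
      have h2 := congrArg conj (hw.step_mul_derivJump t hj')
      rw [map_mul, Complex.conj_ofReal] at h2
      have h3 : conj (jumpSeq m t (nodal (m + 1) w) (j + 1))
          = 2 * V (j + 1) - V j - V (j + 2) := by
        simp [jumpSeq, hj', hV, map_ofNat (starRingEnd ℂ) 2]
      rw [h3] at h2
      rw [add_comm 1 j, ← h2, hD, ← h1]
      ring
    · have h1 := hv.step_mul_derivAtOne
      have h2 := congrArg conj hw.step_mul_derivAtOne
      rw [map_mul, Complex.conj_ofReal, map_sub] at h2
      have hU1 : v 1 = U (m + 1) := by rw [hU]; unfold nodal; rw [node_self hn]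
      have hV1 : conj (w 1) = V (m + 1) := by simp only [hV, nodal]; rw [node_self hn]
      have hDm : D (m + 1) = U (m + 1) - U m - Complex.I * t * U (m + 1) := by
        simp [hD, jumpSeq]
      change step (m + 1) * conj (derivAtOne w) = V (m + 1) - V m at h2
      rw [hU1, hV1, hDm, ← h1, ← h2, ht']
      ring
  have e4 : nodal (m + 1) v (m + 1) = v 1 := by unfold nodal; rw [node_self hn]
  have hV1 : conj (w 1) = V (m + 1) := by simp only [hV, nodal]; rw [node_self hn]
  unfold cipForm
  rw [mul_add, mul_sub, mul_sub, e1, e2, e3, sum_stiffness U V hV0, sum_mass U V hV0,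
    sum_penalty D V hV0 hD0, ← e4, hV1, Finset.sum_range_succ]
  have hlast : nodalForm m t γ U m = D (m + 1) - (t : ℂ) ^ 2 / 6 * (2 * U (m + 1) + U m)
      + γ * ((1 - Complex.I * t) * D (m + 1) - D m) := by simp [nodalForm, hD]
  have hint : ∑ j ∈ Finset.range m, V (j + 1) * nodalForm m t γ U j
      = ∑ j ∈ Finset.range m, V (j + 1) * (2 * U (j + 1) - U j - U (j + 2))
        - (t : ℂ) ^ 2 / 6 * ∑ j ∈ Finset.range m, V (j + 1) * (U j + 4 * U (j + 1) + U (j + 2))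
        + γ * ∑ j ∈ Finset.range m, V (j + 1) * (2 * D (j + 1) - D j - D (j + 2)) := by
    rw [Finset.mul_sum, Finset.mul_sum, ← Finset.sum_sub_distrib, ← Finset.sum_add_distrib]
    refine Finset.sum_congr rfl fun j hj ↦ ?_
    have hj' := Finset.mem_range.1 hj
    have hDj : D (j + 1) = 2 * U (j + 1) - U j - U (j + 2) := by simp [hD, jumpSeq, hj']
    simp only [nodalForm, hj', if_true]
    rw [← hDj]; ring
  have hDm : D (m + 1) = U (m + 1) - U m - Complex.I * t * U (m + 1) := by
    simp [hD, jumpSeq]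
  change _ = ∑ j ∈ Finset.range m, V (j + 1) * nodalForm m t γ U j + V (m + 1) * nodalForm m t γ U m
  rw [hint, hlast]
  linear_combination (-V (m + 1)) * hDm + (Complex.I * U (m + 1) * V (m + 1)) * ht'

theorem step_mul_load {w : ℝ → ℂ} (hw : MemFESpace (m + 1) w) {f : ℝ → ℂ}
    (hf : IntervalIntegrable f volume 0 1) :
    step (m + 1) * l2inner f w = ∑ j ∈ Finset.range (m + 1),
      conj (nodal (m + 1) w (j + 1)) * nodalLoad m f j := by
  have h := sum_load (fun j ↦ conj (nodal (m + 1) w j)) (momentLeft (m + 1) f)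
    (momentRight (m + 1) f) (by simp [hw.nodal_zero]) m
  rw [hw.l2inner_load hf (Nat.succ_pos m)]
  refine h.trans ?_
  rw [Finset.sum_range_succ]
  congr 1
  · refine Finset.sum_congr rfl fun j hj ↦ ?_
    simp [nodalLoad, Finset.mem_range.1 hj]
  · simp [nodalLoad]

theorem isCIPSolution_iff {f uh : ℝ → ℂ} (hf : IntervalIntegrable f volume 0 1) :
    IsCIPSolution k γ (m + 1) f uh ↔ MemFESpace (m + 1) uh ∧
      IsDiscreteSolution m (k * step (m + 1)) γ (nodal (m + 1) uh)
        (jumpSeq m (k * step (m + 1)) (nodal (m + 1) uh)) (nodalLoad m f) := by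
  have hn : 0 < m + 1 := Nat.succ_pos m
  have hs : (step (m + 1) : ℂ) ≠ 0 := by exact_mod_cast (step_pos hn).ne'
  rw [isDiscreteSolution_iff]
  constructor
  · rintro ⟨hu, h⟩
    refine ⟨hu, hu.nodal_zero, fun j hj ↦ ?_⟩
    -- The hat function at node `j + 1` selects equation `j`; the node `0` carries no equation.
    have hV : MemFESpace (m + 1) (nodalInterp (m + 1) (Pi.single (j + 1) 1)) :=
      memFESpace_nodalInterp hn (by simp)
    have e := congrArg (fun z ↦ (step (m + 1) : ℂ) * z) (h _ hV)
    simp only [step_mul_cipForm hu hV, step_mul_load hV hf] at e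
    have hnod : ∀ i ∈ Finset.range (m + 1),
        conj (nodal (m + 1) (nodalInterp (m + 1) (Pi.single (j + 1) 1)) (i + 1))
          = if i = j then 1 else 0 := by
      intro i hi
      have hi' := Finset.mem_range.1 hi
      unfold nodal
      rw [nodalInterp_node hn _ (by omega)]
      by_cases hij : i = j
      · simp [hij]
      · rw [Pi.single_eq_of_ne (by omega)]; simp [hij]
    have hcollapse : ∀ G : ℕ → ℂ, ∑ i ∈ Finset.range (m + 1),
        conj (nodal (m + 1) (nodalInterp (m + 1) (Pi.single (j + 1) 1)) (i + 1)) * G i = G j := by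
      intro G
      rw [Finset.sum_congr rfl fun i hi ↦ by rw [hnod i hi]]
      simp only [ite_mul, one_mul, zero_mul, Finset.sum_ite_eq', Finset.mem_range, hj, if_true]
    rwa [hcollapse, hcollapse] at e
  · rintro ⟨hu, -, h⟩
    refine ⟨hu, fun vh hv ↦ mul_left_cancel₀ hs ?_⟩
    rw [step_mul_cipForm hu hv, step_mul_load hv hf]
    exact Finset.sum_congr rfl fun j hj ↦ by rw [h j (Finset.mem_range.1 hj)]

theorem jumpSeq_sub (m : ℕ) (t : ℝ) (U V : ℕ → ℂ) :
    jumpSeq m t (U - V) = jumpSeq m t U - jumpSeq m t V := by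
  funext j
  obtain _ | j := j
  · simp [jumpSeq]
  · simp only [jumpSeq, Pi.sub_apply]; split_ifs <;> ring

theorem nodalForm_sub (m : ℕ) (t γ : ℝ) (U V : ℕ → ℂ) (j : ℕ) :
    nodalForm m t γ (U - V) j = nodalForm m t γ U j - nodalForm m t γ V j := by
  simp only [nodalForm, jumpSeq_sub, Pi.sub_apply]; split_ifs <;> ring

theorem jumpSeq_smul (m : ℕ) (t : ℝ) (c : ℂ) (U : ℕ → ℂ) :
    jumpSeq m t (c • U) = c • jumpSeq m t U := by
  funext j
  obtain _ | j := j
  · simp [jumpSeq]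
  · simp only [jumpSeq, Pi.smul_apply, smul_eq_mul]; split_ifs <;> ring

theorem nodalForm_smul (m : ℕ) (t γ : ℝ) (c : ℂ) (U : ℕ → ℂ) (j : ℕ) :
    nodalForm m t γ (c • U) j = c * nodalForm m t γ U j := by
  simp only [nodalForm, jumpSeq_smul, Pi.smul_apply, smul_eq_mul]; split_ifs <;> ring

/-! ### Existence and uniqueness of the discrete solution. -/

theorem nodal_eq_zero {t : ℝ} {U : ℕ → ℂ} (hγ : 0 < |γ|) (hγ6 : |γ| ≤ 1 / 6)
    (ht0 : 0 < t) (ht1 : t ≤ 1) (hU : U 0 = 0) (h : ∀ j < m + 1, nodalForm m t γ U j = 0) :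
    ∀ j ≤ m + 1, U j = 0 := by
  intro j hj
  have hd : IsDiscreteSolution m t γ U (jumpSeq m t U) 0 := isDiscreteSolution_iff.2 ⟨hU, h⟩
  have := hd.stability hγ hγ6 ht0 ht1 j hj
  have e : IsDiscreteSolution.load m 0 = 0 := by simp [IsDiscreteSolution.load]
  rw [e, mul_zero] at this
  have h2 : ‖U j‖ ≤ 0 := by
    by_contra hc
    nlinarith [norm_nonneg (U j), mul_pos ht0 (not_le.1 hc)]
  exact norm_le_zero_iff.1 h2

/-- Extension of a vector of nodal values by zero at the left endpoint. -/
def extendNodal (m : ℕ) (x : Fin (m + 1) → ℂ) (j : ℕ) : ℂ :=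
  if h : 0 < j ∧ j ≤ m + 1 then x ⟨j - 1, by omega⟩ else 0

/-- The system is square, so injectivity, which is stability with zero load, gives surjectivity. -/
theorem exists_nodalForm_eq {t : ℝ} (hγ : 0 < |γ|) (hγ6 : |γ| ≤ 1 / 6) (ht0 : 0 < t) (ht1 : t ≤ 1)
    (F : ℕ → ℂ) : ∃ U : ℕ → ℂ, U 0 = 0 ∧ ∀ j < m + 1, nodalForm m t γ U j = F j := by
  have hsub : ∀ x y : Fin (m + 1) → ℂ,
      extendNodal m (x - y) = extendNodal m x - extendNodal m y := by
    intro x y; funext j; simp only [extendNodal, Pi.sub_apply]; split_ifs <;> simp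
  have hsmul : ∀ (c : ℂ) (x : Fin (m + 1) → ℂ),
      extendNodal m (c • x) = c • extendNodal m x := by
    intro c x; funext j; simp only [extendNodal, Pi.smul_apply]; split_ifs <;> simp
  let T : (Fin (m + 1) → ℂ) →ₗ[ℂ] (Fin (m + 1) → ℂ) :=
    { toFun := fun x i ↦ nodalForm m t γ (extendNodal m x) i
      map_add' := by
        intro x y
        have e : x + y = x - (-1 : ℂ) • y := by simp
        funext i
        rw [e, hsub, hsmul, nodalForm_sub, nodalForm_smul, Pi.add_apply]; ring
      map_smul' := by
        intro c x; funext i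
        rw [hsmul, nodalForm_smul]; rfl }
  have hinj : Function.Injective T := by
    rw [injective_iff_map_eq_zero]
    intro x hx
    have := nodal_eq_zero hγ hγ6 ht0 ht1 (U := extendNodal m x) (m := m) (by simp [extendNodal])
      (fun j hj ↦ congrFun hx ⟨j, hj⟩)
    funext i
    have h1 := this (i + 1) (by omega)
    have h2 : (i : ℕ) + 1 ≤ m + 1 := by omega
    simpa [extendNodal, h2] using h1
  obtain ⟨x, hx⟩ := (LinearMap.injective_iff_surjective.1 hinj) fun i ↦ F i
  exact ⟨extendNodal m x, by simp [extendNodal], fun j hj ↦ congrFun hx ⟨j, hj⟩⟩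

theorem exists_unique_cipSolution {n : ℕ} {f : ℝ → ℂ} (hA : Admissible k γ n) (hf : MemL2 f) :
    ∃ uh : ℝ → ℂ, IsCIPSolution k γ n f uh ∧
      ∀ wh : ℝ → ℂ, IsCIPSolution k γ n f wh → EqOn wh uh (Icc 0 1) := by
  obtain ⟨m, rfl⟩ : ∃ m, n = m + 1 := ⟨n - 1, by have := hA.1; omega⟩
  have hn : 0 < m + 1 := Nat.succ_pos m
  have hfi := intervalIntegrable_of_integrableOn hf.integrableOn
  have hγ := hA.2.2.2.1
  have hγ6 := hA.2.2.2.2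
  obtain ⟨U, hU0, hU⟩ := exists_nodalForm_eq (m := m) hγ hγ6 hA.pos hA.2.2.1 (nodalLoad m f)
  have hmem := memFESpace_nodalInterp hn hU0
  have hnod : ∀ j ≤ m + 1, nodal (m + 1) (nodalInterp (m + 1) U) j = U j := fun j hj ↦
    nodalInterp_node hn U hj
  have hjump : ∀ j ≤ m + 1, jumpSeq m (k * step (m + 1)) (nodal (m + 1) (nodalInterp (m + 1) U)) j
      = jumpSeq m (k * step (m + 1)) U j := by
    intro j hj
    obtain _ | j := j
    · rfl
    · simp only [jumpSeq]
      split_ifs with h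
      · rw [hnod j (by omega), hnod (j + 1) (by omega), hnod (j + 2) (by omega)]
      · rw [hnod j (by omega), hnod (j + 1) (by omega)]
  refine ⟨nodalInterp (m + 1) U, (isCIPSolution_iff hfi).2 ⟨hmem, isDiscreteSolution_iff.2
    ⟨hmem.nodal_zero, fun j hj ↦ ?_⟩⟩, fun wh hw ↦ ?_⟩
  · rw [← hU j hj]
    unfold nodalForm
    split_ifs with h
    · rw [hnod j (by omega), hnod (j + 1) (by omega), hnod (j + 2) (by omega),
        hjump j (by omega), hjump (j + 1) (by omega), hjump (j + 2) (by omega)]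
    · rw [hnod (m + 1) le_rfl, hnod m (by omega), hjump (m + 1) le_rfl, hjump m (by omega)]
  · obtain ⟨hwm, hwd⟩ := (isCIPSolution_iff hfi).1 hw
    obtain ⟨w0, w1⟩ := isDiscreteSolution_iff.1 hwd
    have hz := nodal_eq_zero (m := m) (U := nodal (m + 1) wh - U) hγ hγ6 hA.pos hA.2.2.1
      (by simp [w0, hU0]) (fun j hj ↦ by rw [nodalForm_sub, w1 j hj, hU j hj, sub_self])
    have hv : ∀ j ≤ m + 1, wh (node (m + 1) j) = nodalInterp (m + 1) U (node (m + 1) j) := by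
      intro j hj
      have := sub_eq_zero.1 (hz j hj)
      rw [nodalInterp_node hn U hj, ← this]; rfl
    intro x hx
    obtain ⟨j, hj, hxj⟩ := exists_cell hn hx
    rw [hwm.eq_affine hn hj hxj, hmem.eq_affine hn hj hxj]
    unfold slopeOn
    rw [hv j hj.le, hv (j + 1) hj]

/-! ### Cellwise `L¹` and `L²` bounds for the data. -/

section CauchySchwarz

variable {n : ℕ} {f : ℝ → ℂ}

/-- The `L¹` norm of `f` over the element `(x_j, x_{j+1})`. -/
noncomputable def cellL1 (n : ℕ) (f : ℝ → ℂ) (j : ℕ) : ℝ :=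
  ∫ y in (node n j)..(node n (j + 1)), ‖f y‖

theorem MemL2.intervalIntegrable_sq (hf : MemL2 f) :
    IntervalIntegrable (fun y ↦ ‖f y‖ ^ 2) volume 0 1 :=
  intervalIntegrable_of_integrableOn
    ((memLp_two_iff_integrable_sq_norm (MemLp.aestronglyMeasurable hf)).1 hf)

theorem MemL2.intervalIntegrable (hf : MemL2 f) : IntervalIntegrable f volume 0 1 :=
  intervalIntegrable_of_integrableOn hf.integrableOn

/-- The variance of `‖f‖` about its mean `c` is nonnegative. -/
theorem sq_integral_norm_le {a b : ℝ} (hab : a < b) (hf : IntervalIntegrable f volume a b)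
    (hf2 : IntervalIntegrable (fun y ↦ ‖f y‖ ^ 2) volume a b) :
    (∫ y in a..b, ‖f y‖) ^ 2 ≤ (b - a) * ∫ y in a..b, ‖f y‖ ^ 2 := by
  set A := ∫ y in a..b, ‖f y‖
  set c := A / (b - a) with hc
  have hba : 0 < b - a := sub_pos.2 hab
  have h0 : 0 ≤ ∫ y in a..b, (‖f y‖ ^ 2 - 2 * c * ‖f y‖ + c ^ 2) :=
    intervalIntegral.integral_nonneg hab.le fun y _ ↦ by nlinarith [sq_nonneg (‖f y‖ - c)]
  rw [intervalIntegral.integral_add (hf2.sub (hf.norm.const_mul _)) intervalIntegrable_const,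
    intervalIntegral.integral_sub hf2 (hf.norm.const_mul _),
    intervalIntegral.integral_const_mul, intervalIntegral.integral_const, smul_eq_mul] at h0
  have e : A = c * (b - a) := by rw [hc]; field_simp
  change 0 ≤ (∫ y in a..b, ‖f y‖ ^ 2) - 2 * c * A + (b - a) * c ^ 2 at h0
  rw [e] at h0 ⊢
  nlinarith [mul_nonneg hba.le h0]

theorem l2norm_sq (f : ℝ → ℂ) : l2norm f ^ 2 = ∫ y in (0 : ℝ)..1, ‖f y‖ ^ 2 := by
  unfold l2norm
  rw [Real.sq_sqrt (integral_nonneg fun _ ↦ sq_nonneg _),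
    intervalIntegral.integral_of_le zero_le_one, integral_Ioc_eq_integral_Ioo]

theorem l2norm_nonneg (f : ℝ → ℂ) : 0 ≤ l2norm f := Real.sqrt_nonneg _

theorem MemL2.l1_le_l2norm (hf : MemL2 f) : ∫ y in (0 : ℝ)..1, ‖f y‖ ≤ l2norm f := by
  have := sq_integral_norm_le one_pos hf.intervalIntegrable hf.intervalIntegrable_sq
  rw [sub_zero, one_mul, ← l2norm_sq] at this
  exact (abs_le_of_sq_le_sq' this (l2norm_nonneg f)).2

theorem cellL1_nonneg (hn : 0 < n) (f : ℝ → ℂ) (j : ℕ) : 0 ≤ cellL1 n f j :=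
  intervalIntegral.integral_nonneg (node_lt_succ hn j).le fun _ _ ↦ norm_nonneg _

theorem sum_cellL1 (hn : 0 < n) (hf : IntervalIntegrable f volume 0 1) :
    ∑ j ∈ Finset.range n, cellL1 n f j = ∫ y in (0 : ℝ)..1, ‖f y‖ :=
  (integral_eq_sum_cells hn fun _ hj ↦
    (intervalIntegrable_mono_unit hf (node_mem hn hj.le) (node_mem hn hj)).norm).symm

theorem cellL1_le (hn : 0 < n) (hf : IntervalIntegrable f volume 0 1) {j : ℕ} (hj : j < n) :
    cellL1 n f j ≤ ∫ y in (0 : ℝ)..1, ‖f y‖ := by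
  rw [← sum_cellL1 hn hf]
  exact Finset.single_le_sum (fun i _ ↦ cellL1_nonneg hn f i) (Finset.mem_range.2 hj)

theorem sum_cellL1_sq_le (hn : 0 < n) (hf : MemL2 f) :
    ∑ j ∈ Finset.range n, cellL1 n f j ^ 2 ≤ step n * l2norm f ^ 2 := by
  have hsq : ∀ j < n, IntervalIntegrable (fun y ↦ ‖f y‖ ^ 2) volume (node n j) (node n (j + 1)) :=
    fun j hj ↦ intervalIntegrable_mono_unit hf.intervalIntegrable_sq (node_mem hn hj.le)
      (node_mem hn hj)
  rw [l2norm_sq, integral_eq_sum_cells hn hsq, Finset.mul_sum]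
  refine Finset.sum_le_sum fun j hj ↦ ?_
  have hj' := Finset.mem_range.1 hj
  have := sq_integral_norm_le (node_lt_succ hn j)
    (intervalIntegrable_mono_unit hf.intervalIntegrable (node_mem hn hj'.le) (node_mem hn hj'))
    (hsq j hj')
  rwa [node_succ, add_sub_cancel_left, ← node_succ] at this

theorem sum_add_shift_le {m : ℕ} {r : ℕ → ℝ} (hr : ∀ j, 0 ≤ r j) :
    ∑ j ∈ Finset.range (m + 1), (r j + if j < m then r (j + 1) else 0)
      ≤ 2 * ∑ j ∈ Finset.range (m + 1), r j := by
  rw [Finset.sum_add_distrib]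
  have h1 : ∑ j ∈ Finset.range (m + 1), (if j < m then r (j + 1) else 0)
      = ∑ j ∈ Finset.range m, r (j + 1) := by
    rw [Finset.sum_range_succ, if_neg (lt_irrefl m), add_zero]
    exact Finset.sum_congr rfl fun j hj ↦ if_pos (Finset.mem_range.1 hj)
  have h2 := Finset.sum_range_succ' r m
  linarith [hr 0]

end CauchySchwarz

/-! ### Load moments and the exact nodal recursion. -/

section Moments

variable {n m : ℕ} {f : ℝ → ℂ} {κ : ℝ}

/-- `∫ sin(κ(x_{j+1} - y))/κ f(y) dy` over the element `(x_j, x_{j+1})`. -/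
noncomputable def sineLeft (n : ℕ) (κ : ℝ) (f : ℝ → ℂ) (j : ℕ) : ℂ :=
  ∫ y in (node n j)..(node n (j + 1)), ((Real.sin (κ * (node n (j + 1) - y)) / κ : ℝ) : ℂ) * f y

/-- `∫ sin(κ(y - x_j))/κ f(y) dy` over the element `(x_j, x_{j+1})`. -/
noncomputable def sineRight (n : ℕ) (κ : ℝ) (f : ℝ → ℂ) (j : ℕ) : ℂ :=
  ∫ y in (node n j)..(node n (j + 1)), ((Real.sin (κ * (y - node n j)) / κ : ℝ) : ℂ) * f y

theorem abs_sin_sub_le {z : ℝ} (hz : 0 ≤ z) : |Real.sin z - z| ≤ z ^ 3 := by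
  rcases hz.eq_or_lt with rfl | hpos
  · simp
  have h1 := Real.sin_le hz
  rw [abs_of_nonpos (by linarith)]
  linarith [Real.sin_gt_sub_cube hpos, pow_pos hpos 3]

theorem abs_sin_div_sub_le (hκ : 0 < κ) {s h : ℝ} (hs : 0 ≤ s) (hsh : s ≤ h) :
    |Real.sin (κ * s) / κ - s| ≤ (κ * h) ^ 2 * h := by
  have h1 := abs_sin_sub_le (mul_nonneg hκ.le hs)
  have e : Real.sin (κ * s) / κ - s = (Real.sin (κ * s) - κ * s) / κ := by field_simp
  rw [e, abs_div, abs_of_pos hκ, div_le_iff₀ hκ]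
  refine h1.trans ?_
  have : (κ * s) ^ 3 ≤ (κ * h) ^ 3 :=
    pow_le_pow_left₀ (mul_nonneg hκ.le hs) (mul_le_mul_of_nonneg_left hsh hκ.le) 3
  refine this.trans (le_of_eq ?_); ring

theorem norm_moment_le (hn : 0 < n) (hf : IntervalIntegrable f volume 0 1) {j : ℕ} (hj : j < n) :
    ‖momentLeft n f j‖ ≤ step n * cellL1 n f j ∧ ‖momentRight n f j‖ ≤ step n * cellL1 n f j := by
  have hfj := intervalIntegrable_mono_unit hf (node_mem hn hj.le) (node_mem hn hj)
  have hs := node_succ n j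
  constructor
  · refine norm_integral_mul_le (node_lt_succ hn j).le hfj fun y hy ↦ ?_
    rw [Complex.norm_real, Real.norm_eq_abs, abs_le]
    constructor <;> linarith [hy.1, hy.2, step_pos hn]
  · refine norm_integral_mul_le (node_lt_succ hn j).le hfj fun y hy ↦ ?_
    rw [Complex.norm_real, Real.norm_eq_abs, abs_le]
    constructor <;> linarith [hy.1, hy.2, step_pos hn]

/-- This is the consistency error: hat-function weights replace the weights `sin(κ·)/κ` of the exact
recursion, at a relative cost `(κh)²`. -/
theorem norm_moment_sub_sine_le (hn : 0 < n) (hκ : 0 < κ) (hf : IntervalIntegrable f volume 0 1)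
    {j : ℕ} (hj : j < n) :
    ‖momentLeft n f j - sineLeft n κ f j‖ ≤ (κ * step n) ^ 2 * step n * cellL1 n f j ∧
      ‖momentRight n f j - sineRight n κ f j‖ ≤ (κ * step n) ^ 2 * step n * cellL1 n f j := by
  have hfj := intervalIntegrable_mono_unit hf (node_mem hn hj.le) (node_mem hn hj)
  have hs := node_succ n j
  unfold momentLeft momentRight sineLeft sineRight
  constructor
  · rw [← intervalIntegral.integral_sub (hfj.continuousOn_mul (by fun_prop))
      (hfj.continuousOn_mul (by fun_prop))]
    simp only [← sub_mul]
    refine norm_integral_mul_le (node_lt_succ hn j).le hfj fun y hy ↦ ?_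
    rw [← Complex.ofReal_sub, Complex.norm_real, Real.norm_eq_abs, abs_sub_comm]
    exact abs_sin_div_sub_le hκ (by linarith [hy.2]) (by linarith [hy.1])
  · rw [← intervalIntegral.integral_sub (hfj.continuousOn_mul (by fun_prop))
      (hfj.continuousOn_mul (by fun_prop))]
    simp only [← sub_mul]
    refine norm_integral_mul_le (node_lt_succ hn j).le hfj fun y hy ↦ ?_
    rw [← Complex.ofReal_sub, Complex.norm_real, Real.norm_eq_abs, abs_sub_comm]
    exact abs_sin_div_sub_le hκ (by linarith [hy.1]) (by linarith [hy.2])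

theorem waveSol_backward (hn : 0 < n) (hκ : κ ≠ 0) (hf : IntervalIntegrable f volume 0 1) {j : ℕ}
    (hj : j < n) : waveSol κ f (node n j) = Real.cos (κ * step n) * waveSol κ f (node n (j + 1))
      - (Real.sin (κ * step n) / κ : ℝ) * waveDeriv κ f (node n (j + 1)) - sineRight n κ f j := by
  rw [waveSol_transfer hκ hf (node_mem hn hj) (node_mem hn hj.le)]
  have e1 : κ * (node n j - node n (j + 1)) = -(κ * step n) := by rw [node_succ]; ring
  rw [e1, Real.cos_neg, Real.sin_neg, intervalIntegral.integral_symm]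
  have e2 : ∫ y in (node n j)..(node n (j + 1)),
      ((Real.sin (κ * (node n j - y)) / κ : ℝ) : ℂ) * f y = -sineRight n κ f j := by
    unfold sineRight
    rw [← intervalIntegral.integral_neg]
    congr 1; ext y
    have : κ * (node n j - y) = -(κ * (y - node n j)) := by ring
    rw [this, Real.sin_neg]; push_cast; ring
  rw [e2]; push_cast; ring

theorem waveSol_forward (hn : 0 < n) (hκ : κ ≠ 0) (hf : IntervalIntegrable f volume 0 1) {j : ℕ}
    (hj : j < n) : waveSol κ f (node n (j + 1)) = Real.cos (κ * step n) * waveSol κ f (node n j)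
      + (Real.sin (κ * step n) / κ : ℝ) * waveDeriv κ f (node n j) - sineLeft n κ f j := by
  rw [waveSol_transfer hκ hf (node_mem hn hj.le) (node_mem hn hj)]
  have e1 : κ * (node n (j + 1) - node n j) = κ * step n := by rw [node_succ]; ring
  rw [e1]; rfl

/-- The derivative at the middle node cancels between the forward and the backward transfer. No
discretisation error arises, so for `κ = k_h⁻` the operator is exactly that of `low_interior`. -/
theorem waveSol_recursion (hn : 0 < n) (hκ : κ ≠ 0) (hf : IntervalIntegrable f volume 0 1) {j : ℕ}
    (hj : j + 1 < n) : 2 * (Real.cos (κ * step n) : ℂ) * waveSol κ f (node n (j + 1))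
      - waveSol κ f (node n j) - waveSol κ f (node n (j + 2))
      = sineRight n κ f j + sineLeft n κ f (j + 1) := by
  rw [waveSol_backward hn hκ hf (by omega : j < n), waveSol_forward hn hκ hf hj]
  ring

theorem waveSol_boundary (hκ : κ ≠ 0) (hf : IntervalIntegrable f volume 0 1) :
    Complex.exp (-(Complex.I * (κ * step (m + 1) : ℝ))) * waveSol κ f (node (m + 1) (m + 1))
      - waveSol κ f (node (m + 1) m) = sineRight (m + 1) κ f m := by
  have hn : 0 < m + 1 := Nat.succ_pos m
  have hκ' : (κ : ℂ) ≠ 0 := by exact_mod_cast hκ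
  rw [waveSol_backward hn hκ hf (Nat.lt_succ_self m), node_self hn, waveDeriv_one hκ,
    exp_neg_I_mul_real]
  push_cast
  field_simp
  ring

theorem norm_sine_le (hn : 0 < n) (hκ : 0 < κ) (hf : IntervalIntegrable f volume 0 1) {j : ℕ}
    (hj : j < n) : ‖sineLeft n κ f j‖ ≤ step n * cellL1 n f j := by
  have hfj := intervalIntegrable_mono_unit hf (node_mem hn hj.le) (node_mem hn hj)
  have hs := node_succ n j
  refine norm_integral_mul_le (node_lt_succ hn j).le hfj fun y hy ↦ ?_
  rw [Complex.norm_real, Real.norm_eq_abs, abs_div, abs_of_pos hκ, div_le_iff₀ hκ]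
  refine (Real.abs_sin_le_abs).trans ?_
  rw [abs_of_nonneg (mul_nonneg hκ.le (by linarith [hy.2])), mul_comm]
  exact mul_le_mul_of_nonneg_right (by linarith [hy.1]) hκ.le

theorem norm_nodalLoad_le (hf : IntervalIntegrable f volume 0 1) {j : ℕ} (hj : j < m + 1) :
    ‖nodalLoad m f j‖ ≤ step (m + 1) *
      (cellL1 (m + 1) f j + if j < m then cellL1 (m + 1) f (j + 1) else 0) := by
  have hn : 0 < m + 1 := Nat.succ_pos m
  unfold nodalLoad
  refine (norm_add_le _ _).trans ?_
  rw [mul_add]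
  refine add_le_add (norm_moment_le hn hf hj).2 ?_
  split_ifs with h
  · exact (norm_moment_le hn hf (by omega)).1
  · simp

theorem load_nodalLoad_le (hf : IntervalIntegrable f volume 0 1) :
    IsDiscreteSolution.load m (nodalLoad m f)
      ≤ 2 * step (m + 1) * ∫ y in (0 : ℝ)..1, ‖f y‖ := by
  have hn : 0 < m + 1 := Nat.succ_pos m
  unfold IsDiscreteSolution.load
  refine (Finset.sum_le_sum fun j hj ↦ norm_nodalLoad_le hf (Finset.mem_range.1 hj)).trans ?_
  rw [← Finset.mul_sum, ← sum_cellL1 hn hf]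
  have := mul_le_mul_of_nonneg_left
    (sum_add_shift_le (m := m) fun j ↦ cellL1_nonneg hn f j) (step_pos hn).le
  linarith

theorem sum_sq_nodalLoad_le (hf : MemL2 f) :
    ∑ j ∈ Finset.range (m + 1), ‖nodalLoad m f j‖ ^ 2
      ≤ 4 * step (m + 1) ^ 3 * l2norm f ^ 2 := by
  have hn : 0 < m + 1 := Nat.succ_pos m
  have h1 : ∀ j ∈ Finset.range (m + 1), ‖nodalLoad m f j‖ ^ 2 ≤ 2 * step (m + 1) ^ 2 *
      (cellL1 (m + 1) f j ^ 2 + if j < m then cellL1 (m + 1) f (j + 1) ^ 2 else 0) := by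
    intro j hj
    have := pow_le_pow_left₀ (norm_nonneg _)
      (norm_nodalLoad_le hf.intervalIntegrable (Finset.mem_range.1 hj)) 2
    refine this.trans ?_
    rw [mul_pow, mul_comm 2, mul_assoc]
    refine mul_le_mul_of_nonneg_left ?_ (sq_nonneg _)
    split_ifs
    · nlinarith [sq_nonneg (cellL1 (m + 1) f j - cellL1 (m + 1) f (j + 1))]
    · nlinarith [sq_nonneg (cellL1 (m + 1) f j)]
  refine (Finset.sum_le_sum h1).trans ?_
  rw [← Finset.mul_sum]
  have h2 := sum_add_shift_le (m := m) (r := fun j ↦ cellL1 (m + 1) f j ^ 2)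
    fun j ↦ sq_nonneg _
  have h3 := h2.trans (mul_le_mul_of_nonneg_left (sum_cellL1_sq_le hn hf) two_pos.le)
  have := mul_le_mul_of_nonneg_left h3 (by positivity : 0 ≤ 2 * step (m + 1) ^ 2)
  linarith

end Moments

/-! ### Oscillation of the continuous solution on one element. -/

section Exact

variable {n : ℕ} {f : ℝ → ℂ} {κ : ℝ}

theorem norm_waveSol_sub_le (hn : 0 < n) (hκ : 0 < κ) (hθ : κ * step n ≤ 2)
    (hf : IntervalIntegrable f volume 0 1) {j : ℕ} (hj : j < n) :
    ‖waveSol κ f (node n (j + 1)) - waveSol κ f (node n j)‖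
      ≤ 7 * step n * ∫ y in (0 : ℝ)..1, ‖f y‖ := by
  have hs := step_pos hn
  set N := ∫ y in (0 : ℝ)..1, ‖f y‖
  have hN : 0 ≤ N := intervalIntegral.integral_nonneg zero_le_one fun _ _ ↦ norm_nonneg _
  have b1 := norm_waveSol_le hκ hf (node_mem hn hj.le)
  have b2 := norm_waveDeriv_le (κ := κ) hf (node_mem hn hj.le)
  have b3 := norm_sine_le hn hκ hf hj
  have b4 := mul_le_mul_of_nonneg_left (cellL1_le hn hf hj) hs.le
  rw [waveSol_forward hn hκ.ne' hf hj]
  have e : (Real.cos (κ * step n) : ℂ) * waveSol κ f (node n j)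
      + (Real.sin (κ * step n) / κ : ℝ) * waveDeriv κ f (node n j) - sineLeft n κ f j
      - waveSol κ f (node n j) = ((Real.cos (κ * step n) - 1 : ℝ) : ℂ) * waveSol κ f (node n j)
      + (Real.sin (κ * step n) / κ : ℝ) * waveDeriv κ f (node n j) - sineLeft n κ f j := by
    push_cast; ring
  rw [e]
  have hθ0 : 0 ≤ κ * step n := by positivity
  have c1 : |Real.cos (κ * step n) - 1| ≤ κ * step n := by
    rw [abs_of_nonpos (by linarith [Real.cos_le_one (κ * step n)])]
    nlinarith [Real.one_sub_sq_div_two_le_cos (x := κ * step n)]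
  have c2 : |Real.sin (κ * step n) / κ| ≤ step n := by
    rw [abs_div, abs_of_pos hκ, div_le_iff₀ hκ]
    refine (Real.abs_sin_le_abs).trans ?_
    rw [abs_of_nonneg hθ0, mul_comm]
  have d1 := mul_le_mul c1 b1 (norm_nonneg _) hθ0
  have d2 := mul_le_mul c2 b2 (norm_nonneg _) hs.le
  have d3 : κ * step n * (2 * N / κ) = 2 * (step n * N) := by field_simp
  refine (norm_sub_le _ _).trans ?_
  refine (add_le_add_left (norm_add_le _ _) _).trans ?_
  rw [norm_mul, norm_mul, Complex.norm_real, Complex.norm_real, Real.norm_eq_abs,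
    Real.norm_eq_abs]
  have : 0 ≤ step n * N := by positivity
  change step n * cellL1 n f j ≤ step n * N at b4
  linarith

/-- Both the derivative and the difference quotient are expanded from the left node. The local `L¹`
norm is kept apart because it gains a factor `h` only after squaring and summing over the elements.
-/
theorem norm_waveDeriv_sub_slope_le (hn : 0 < n) (hκ : 0 < κ) (hθ : κ * step n ≤ 2)
    (hf : IntervalIntegrable f volume 0 1) {j : ℕ} (hj : j < n) {x : ℝ}
    (hx : x ∈ Icc (node n j) (node n (j + 1))) :
    ‖waveDeriv κ f x - (waveSol κ f (node n (j + 1)) - waveSol κ f (node n j)) / step n‖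
      ≤ 12 * (κ * step n) * (∫ y in (0 : ℝ)..1, ‖f y‖) + 2 * cellL1 n f j := by
  have hs := step_pos hn
  have hs' : (step n : ℂ) ≠ 0 := by exact_mod_cast hs.ne'
  have hjI := node_mem hn hj.le
  have hxI := cell_subset hn hj hx
  set N := ∫ y in (0 : ℝ)..1, ‖f y‖
  have hN : 0 ≤ N := intervalIntegral.integral_nonneg zero_le_one fun _ _ ↦ norm_nonneg _
  set θ := κ * step n with hθdef
  have hθ0 : 0 < θ := by positivity
  have b1 : ‖waveSol κ f (node n j)‖ ≤ 2 * N / κ := norm_waveSol_le hκ hf hjI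
  have b2 : ‖waveDeriv κ f (node n j)‖ ≤ 2 * N := norm_waveDeriv_le hf hjI
  have b3 := norm_sine_le hn hκ hf hj
  set u₀ := waveSol κ f (node n j)
  set g₀ := waveDeriv κ f (node n j)
  set z := κ * (x - node n j) with hz
  have hz0 : 0 ≤ z := mul_nonneg hκ.le (by linarith [hx.1])
  have hzθ : z ≤ θ := mul_le_mul_of_nonneg_left (by linarith [hx.2, node_succ n j]) hκ.le
  have b4 : ‖∫ y in (node n j)..x, ((Real.cos (κ * (x - y)) : ℝ) : ℂ) * f y‖ ≤ cellL1 n f j := by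
    have hfx := intervalIntegrable_mono_unit hf hjI hxI
    have h1 := norm_integral_mul_le (c := 1) hx.1 hfx
      (g := fun y ↦ ((Real.cos (κ * (x - y)) : ℝ) : ℂ)) fun y _ ↦ by
        rw [Complex.norm_real, Real.norm_eq_abs]; exact Real.abs_cos_le_one _
    rw [one_mul] at h1
    exact h1.trans (intervalIntegral.integral_mono_interval le_rfl hx.1 hx.2
      (Filter.Eventually.of_forall fun _ ↦ norm_nonneg _)
      (intervalIntegrable_mono_unit hf hjI (node_mem hn hj)).norm)
  have e : waveDeriv κ f x - (waveSol κ f (node n (j + 1)) - u₀) / step n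
      = ((Real.cos z - 1 : ℝ) : ℂ) * g₀ - (κ * Real.sin z : ℝ) * u₀
        - (∫ y in (node n j)..x, ((Real.cos (κ * (x - y)) : ℝ) : ℂ) * f y)
        - (((Real.cos θ - 1) / step n : ℝ) * u₀ + ((Real.sin θ - θ) / θ : ℝ) * g₀
          - sineLeft n κ f j / step n) := by
    have t1 : waveDeriv κ f x = Real.cos z * g₀ - (κ * Real.sin z : ℝ) * u₀
        - ∫ y in (node n j)..x, ((Real.cos (κ * (x - y)) : ℝ) : ℂ) * f y :=
      waveDeriv_transfer hκ.ne' hf hjI hxI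
    have t2 : waveSol κ f (node n (j + 1)) = Real.cos θ * u₀ + (Real.sin θ / κ : ℝ) * g₀
        - sineLeft n κ f j := waveSol_forward hn hκ.ne' hf hj
    rw [t1, t2]
    have hκ' : (κ : ℂ) ≠ 0 := by exact_mod_cast hκ.ne'
    have e5 : (θ : ℂ) = κ * step n := by rw [hθdef]; push_cast; ring
    have e6 : (((Real.sin θ - θ) / θ : ℝ) : ℂ) = (Real.sin θ / κ : ℝ) / step n - 1 := by
      push_cast; rw [e5]; field_simp
    rw [e6]
    push_cast
    field_simp
    ring
  have a1 : ‖((Real.cos z - 1 : ℝ) : ℂ) * g₀‖ ≤ θ * (2 * N) := by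
    rw [norm_mul, Complex.norm_real, Real.norm_eq_abs]
    refine mul_le_mul ?_ b2 (norm_nonneg _) hθ0.le
    rw [abs_of_nonpos (by linarith [Real.cos_le_one z])]
    nlinarith [Real.one_sub_sq_div_two_le_cos (x := z)]
  have a2 : ‖((κ * Real.sin z : ℝ) : ℂ) * u₀‖ ≤ θ * (2 * N) := by
    rw [norm_mul, Complex.norm_real, Real.norm_eq_abs, abs_mul, abs_of_pos hκ]
    have h1 : |Real.sin z| ≤ θ := by
      refine (Real.abs_sin_le_abs).trans ?_
      rwa [abs_of_nonneg hz0]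
    have h2 := mul_le_mul (mul_le_mul_of_nonneg_left h1 hκ.le) b1 (norm_nonneg _) (by positivity)
    refine h2.trans (le_of_eq ?_); field_simp
  have a3 : ‖(((Real.cos θ - 1) / step n : ℝ) : ℂ) * u₀‖ ≤ θ * N := by
    rw [norm_mul, Complex.norm_real, Real.norm_eq_abs]
    have h1 : |(Real.cos θ - 1) / step n| ≤ θ ^ 2 / 2 / step n := by
      rw [abs_div, abs_of_pos hs]
      refine div_le_div_of_nonneg_right ?_ hs.le
      rw [abs_of_nonpos (by linarith [Real.cos_le_one θ])]
      linarith [Real.one_sub_sq_div_two_le_cos (x := θ)]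
    refine (mul_le_mul h1 b1 (norm_nonneg _) (by positivity)).trans (le_of_eq ?_)
    rw [hθdef]; field_simp
  have a4 : ‖(((Real.sin θ - θ) / θ : ℝ) : ℂ) * g₀‖ ≤ 2 * θ * (2 * N) := by
    rw [norm_mul, Complex.norm_real, Real.norm_eq_abs]
    refine mul_le_mul ?_ b2 (norm_nonneg _) (by positivity)
    rw [abs_div, abs_of_pos hθ0, div_le_iff₀ hθ0]
    refine (abs_sin_sub_le hθ0.le).trans ?_
    nlinarith [mul_pos hθ0 hθ0]
  have a5 : ‖sineLeft n κ f j / step n‖ ≤ cellL1 n f j := by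
    rw [norm_div, Complex.norm_real, Real.norm_of_nonneg hs.le, div_le_iff₀ hs]
    linarith
  rw [e]
  refine (norm_sub_le _ _).trans ?_
  have n1 := norm_sub_le (((Real.cos z - 1 : ℝ) : ℂ) * g₀ - (κ * Real.sin z : ℝ) * u₀)
    (∫ y in (node n j)..x, ((Real.cos (κ * (x - y)) : ℝ) : ℂ) * f y)
  have n2 := norm_sub_le (((Real.cos z - 1 : ℝ) : ℂ) * g₀) ((κ * Real.sin z : ℝ) * u₀)
  have n3 := norm_sub_le ((((Real.cos θ - 1) / step n : ℝ) : ℂ) * u₀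
    + ((Real.sin θ - θ) / θ : ℝ) * g₀) (sineLeft n κ f j / step n)
  have n4 := norm_add_le ((((Real.cos θ - 1) / step n : ℝ) : ℂ) * u₀)
    (((Real.sin θ - θ) / θ : ℝ) * g₀)
  have : 0 ≤ θ * N := by positivity
  linarith

end Exact

/-! ### Discrete error estimates. -/

section DiscreteError

variable {m : ℕ} {k γ : ℝ} {f : ℝ → ℂ} {U D : ℕ → ℂ}

theorem discreteWavenumber_mul_step (hA : Admissible k γ (m + 1)) :
    discreteWavenumber k γ (m + 1) * step (m + 1) = phase γ (k * step (m + 1)) := by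
  unfold discreteWavenumber phase
  exact div_mul_cancel₀ _ hA.step_pos.ne'

theorem discreteWavenumber_pos (hA : Admissible k γ (m + 1)) :
    0 < discreteWavenumber k γ (m + 1) := by
  have h1 := (phase_bounds hA.2.2.2.1 hA.2.2.2.2 hA.pos hA.2.2.1).1
  have h2 := hA.pos
  rw [← discreteWavenumber_mul_step hA] at h1
  exact (mul_pos_iff_of_pos_right hA.step_pos).1 (by linarith)

theorem step_le_one (m : ℕ) : step (m + 1) ≤ 1 := by
  unfold step
  rw [div_le_one (by positivity)]
  push_cast
  linarith [(Nat.cast_nonneg m : (0 : ℝ) ≤ m)]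

theorem card_mul_step (m : ℕ) : ((m + 1 : ℕ) : ℝ) * step (m + 1) = 1 := by
  unfold step
  have : ((m + 1 : ℕ) : ℝ) ≠ 0 := by positivity
  field_simp

/-- Split `D = w + σU`. The part `σU` is pointwise of size `t·h‖f‖` by stability; for `w` the `ℓ²`
bound is needed, since the squared loads sum to `O(h³)‖f‖²` and `h ≤ t` because `k ≥ 1`. -/
theorem sum_sq_jump_le (hA : Admissible k γ (m + 1)) (hf : MemL2 f)
    (h : IsDiscreteSolution m (k * step (m + 1)) γ U D (nodalLoad m f)) :
    ∑ j ∈ Finset.range (m + 1), ‖D (j + 1)‖ ^ 2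
      ≤ 20000 * ((k * step (m + 1)) ^ 2 * step (m + 1) * l2norm f ^ 2) := by
  have hs := hA.step_pos
  have hs1 := step_le_one m
  have ht0 := hA.pos
  have ht1 := hA.2.2.1
  have hst : step (m + 1) ≤ k * step (m + 1) := le_mul_of_one_le_left hs.le hA.2.1
  have w := h.high_sq_sum_le hA.2.2.2.1 hA.2.2.2.2 ht0 ht1
  have st := h.stability hA.2.2.2.1 hA.2.2.2.2 ht0 ht1
  obtain ⟨σ0, σ1⟩ := symbolRoot_bounds hA.2.2.2.1 hA.2.2.2.2 ht0 ht1
  have hQ := sum_sq_nodalLoad_le (m := m) hf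
  have hL0 : 0 ≤ IsDiscreteSolution.load m (nodalLoad m f) :=
    Finset.sum_nonneg fun _ _ ↦ norm_nonneg _
  have hN := l2norm_nonneg f
  have hL : IsDiscreteSolution.load m (nodalLoad m f) ≤ 2 * step (m + 1) * l2norm f :=
    (load_nodalLoad_le hf.intervalIntegrable).trans
      (mul_le_mul_of_nonneg_left hf.l1_le_l2norm (by positivity))
  have hcard := card_mul_step m
  set s := step (m + 1)
  set t := k * s
  set σ := symbolRoot γ t
  set N := l2norm f
  set S := IsDiscreteSolution.load m (nodalLoad m f)
  have hS2 : S ^ 2 ≤ 4 * s ^ 2 * N ^ 2 := by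
    refine (pow_le_pow_left₀ hL0 hL 2).trans (le_of_eq ?_); ring
  have hσ0 : 0 ≤ σ := le_trans (by positivity) σ0
  have hpt : ∀ j ∈ Finset.range (m + 1), ‖D (j + 1)‖ ^ 2
      ≤ 2 * ‖D (j + 1) - σ * U (j + 1)‖ ^ 2 + 2592 * t ^ 2 * s ^ 2 * N ^ 2 := by
    intro j hj
    have hj' := Finset.mem_range.1 hj
    have e : D (j + 1) = (D (j + 1) - σ * U (j + 1)) + σ * U (j + 1) := by ring
    have h1 := norm_add_le (D (j + 1) - σ * U (j + 1)) (σ * U (j + 1))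
    rw [← e, norm_mul, Complex.norm_real, Real.norm_of_nonneg hσ0] at h1
    have h2 : σ * ‖U (j + 1)‖ ≤ 36 * t * s * N := by
      have h3 := mul_le_mul_of_nonneg_right σ1 (norm_nonneg (U (j + 1)))
      have h4 := mul_le_mul_of_nonneg_left (st (j + 1) (by omega)) ht0.le
      have h5 := mul_le_mul_of_nonneg_left hL ht0.le
      linarith
    have h3 := pow_le_pow_left₀ (mul_nonneg hσ0 (norm_nonneg _)) h2 2
    have h4 := pow_le_pow_left₀ (norm_nonneg _) h1 2
    nlinarith [sq_nonneg (‖D (j + 1) - σ * U (j + 1)‖ - σ * ‖U (j + 1)‖)]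
  refine (Finset.sum_le_sum hpt).trans ?_
  rw [Finset.sum_add_distrib, ← Finset.mul_sum, Finset.sum_const, Finset.card_range, nsmul_eq_mul]
  have e1 : ((m + 1 : ℕ) : ℝ) * (2592 * t ^ 2 * s ^ 2 * N ^ 2) = 2592 * (t ^ 2 * s * N ^ 2) := by
    calc _ = (((m + 1 : ℕ) : ℝ) * s) * (2592 * t ^ 2 * s * N ^ 2) := by ring
      _ = _ := by rw [hcard]; ring
  have h3 : s ^ 3 * N ^ 2 ≤ t ^ 2 * s * N ^ 2 := by
    refine mul_le_mul_of_nonneg_right ?_ (sq_nonneg _)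
    have : s ^ 2 ≤ t ^ 2 := pow_le_pow_left₀ hs.le hst 2
    calc s ^ 3 = s ^ 2 * s := by ring
      _ ≤ _ := mul_le_mul_of_nonneg_right this hs.le
  have h4 : t ^ 2 * S ^ 2 ≤ 4 * (t ^ 2 * s * N ^ 2) := by
    have h5 := mul_le_mul_of_nonneg_left hS2 (sq_nonneg t)
    have h6 : t ^ 2 * s ^ 2 * N ^ 2 ≤ t ^ 2 * s * N ^ 2 := by
      refine mul_le_mul_of_nonneg_right ?_ (sq_nonneg _)
      exact mul_le_mul_of_nonneg_left (by nlinarith) (sq_nonneg t)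
    linarith
  rw [e1]
  have : 0 ≤ t ^ 2 * s * N ^ 2 := by positivity
  linarith

/-- `Z - ũ` solves the three-term recursion with the moment differences as load and the boundary
defect at the end. These contribute `8` and `16` times `t²h‖f‖`, and `recursion_difference_bound`
multiplies their sum by four. -/
theorem norm_low_sub_wave_le (hA : Admissible k γ (m + 1)) (hf : MemL2 f)
    (h : IsDiscreteSolution m (k * step (m + 1)) γ U D (nodalLoad m f)) {β : ℝ}
    (hβ : β = 1 + (k * step (m + 1)) ^ 2 / 6 + γ * symbolRoot γ (k * step (m + 1))) :
    ∀ j ≤ m, ‖(β * U (j + 1) + γ * D (j + 1)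
        - waveSol (discreteWavenumber k γ (m + 1)) f (node (m + 1) (j + 1)))
      - (β * U j + γ * D j - waveSol (discreteWavenumber k γ (m + 1)) f (node (m + 1) j))‖
      ≤ 96 * ((k * step (m + 1)) ^ 2 * step (m + 1) * l2norm f) := by
  have hn : 0 < m + 1 := Nat.succ_pos m
  have hs := hA.step_pos
  have ht0 := hA.pos
  have ht1 := hA.2.2.1
  have hfi := hf.intervalIntegrable
  have hκ := discreteWavenumber_pos hA
  have hκθ := discreteWavenumber_mul_step hA
  obtain ⟨hσ, -, -⟩ := symbolRoot_spec hA.2.2.2.1 hA.2.2.2.2 ht0 ht1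
  have hc := cos_phase hA.2.2.2.1 hA.2.2.2.2 ht0 ht1
  obtain ⟨s1, -, -⟩ := sin_phase_bounds hA.2.2.2.1 hA.2.2.2.2 ht0 ht1
  obtain ⟨p1, p2, -⟩ := phase_bounds hA.2.2.2.1 hA.2.2.2.2 ht0 ht1
  have hB := h.norm_boundary_sub_le hA.2.2.2.1 hA.2.2.2.2 ht0 ht1
  have hL : IsDiscreteSolution.load m (nodalLoad m f) ≤ 2 * step (m + 1) * l2norm f :=
    (load_nodalLoad_le hf.intervalIntegrable).trans
      (mul_le_mul_of_nonneg_left hf.l1_le_l2norm (by positivity))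
  rw [← hβ] at hσ hB
  set κ := discreteWavenumber k γ (m + 1)
  set s := step (m + 1) with hsdef
  set t := k * s
  set N := l2norm f
  set ũ : ℕ → ℂ := fun j ↦ waveSol κ f (node (m + 1) j) with hũ
  set Z : ℕ → ℂ := fun j ↦ β * U j + γ * D j with hZ
  set Φ : ℕ → ℂ := fun j ↦ sineRight (m + 1) κ f j
    + if j < m then sineLeft (m + 1) κ f (j + 1) else 0 with hΦ
  have hdiff : ∀ j < m + 1, ‖nodalLoad m f j - Φ j‖ ≤ (κ * s) ^ 2 * s *
      (cellL1 (m + 1) f j + if j < m then cellL1 (m + 1) f (j + 1) else 0) := by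
    intro j hj
    have h1 := (norm_moment_sub_sine_le hn hκ hfi hj).2
    simp only [nodalLoad, hΦ]
    rw [mul_add]
    split_ifs with hjm
    · have h2 := (norm_moment_sub_sine_le hn hκ hfi (by omega : j + 1 < m + 1)).1
      rw [add_sub_add_comm]
      exact (norm_add_le _ _).trans (add_le_add h1 h2)
    · simpa using h1
  have hsum : ∑ j ∈ Finset.range (m + 1), ‖nodalLoad m f j - Φ j‖ ≤ 8 * (t ^ 2 * s * N) := by
    refine (Finset.sum_le_sum fun j hj ↦ hdiff j (Finset.mem_range.1 hj)).trans ?_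
    rw [← Finset.mul_sum]
    have h1 := sum_add_shift_le (m := m) fun j ↦ cellL1_nonneg hn f j
    rw [sum_cellL1 hn hfi] at h1
    have h2 : (κ * s) ^ 2 * s ≤ 4 * t ^ 2 * s := by
      refine mul_le_mul_of_nonneg_right ?_ hs.le
      rw [hκθ]
      refine (pow_le_pow_left₀ (by linarith) p2 2).trans (le_of_eq ?_); ring
    have h3 := h1.trans (mul_le_mul_of_nonneg_left hf.l1_le_l2norm two_pos.le)
    have h4 : 0 ≤ 2 * N := by have := l2norm_nonneg f; positivity
    calc _ ≤ (κ * s) ^ 2 * s * (2 * N) := mul_le_mul_of_nonneg_left h3 (by positivity)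
      _ ≤ 4 * t ^ 2 * s * (2 * N) := mul_le_mul_of_nonneg_right h2 h4
      _ = _ := by ring
  have hY0 : (fun j ↦ Z j - ũ j) 0 = 0 := by
    simp only [hZ, hũ, h.zero, h.jump_zero, node_zero, waveSol_zero]; simp
  have hrec : ∀ j < m, 2 * (Real.cos (phase γ t) : ℂ) * (fun j ↦ Z j - ũ j) (j + 1)
      - (fun j ↦ Z j - ũ j) j - (fun j ↦ Z j - ũ j) (j + 2) = nodalLoad m f j - Φ j := by
    intro j hj
    have h1 := h.low_interior hβ hσ hc hj
    have h2 := waveSol_recursion hn hκ.ne' hfi (by omega : j + 1 < m + 1)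
    rw [← hsdef, hκθ] at h2
    simp only [hZ, hũ, hΦ, if_pos hj]
    rw [← h1, ← h2]; ring
  have hbd : ‖Complex.exp (-(Complex.I * phase γ t)) * (fun j ↦ Z j - ũ j) (m + 1)
      - (fun j ↦ Z j - ũ j) m‖ ≤ 16 * (t ^ 2 * s * N) + ‖nodalLoad m f m - Φ m‖ := by
    have h2 := waveSol_boundary (m := m) hκ.ne' hfi
    rw [← hsdef, hκθ] at h2
    have hΦm : Φ m = sineRight (m + 1) κ f m := by simp [hΦ]
    have e : Complex.exp (-(Complex.I * phase γ t)) * (Z (m + 1) - ũ (m + 1)) - (Z m - ũ m)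
        = (Complex.exp (-(Complex.I * phase γ t)) * Z (m + 1) - Z m - nodalLoad m f m)
          + (nodalLoad m f m - Φ m) := by
      rw [hΦm, ← h2]; ring
    simp only [e]
    refine (norm_add_le _ _).trans ?_
    refine add_le_add_left (hB.trans ?_) _
    have := mul_le_mul_of_nonneg_left hL (by positivity : 0 ≤ 8 * t ^ 2)
    linarith
  intro j hj
  have hθ3 : phase γ t ≤ 3 * Real.sin (phase γ t) := by linarith
  have := recursion_difference_bound (Y := fun j ↦ Z j - ũ j)
    (g := fun j ↦ nodalLoad m f j - Φ j) hY0 hrec rfl (le_trans (by positivity) s1) (by linarith)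
    hθ3 j hj
  refine this.trans ?_
  rw [Finset.sum_range_succ] at hsum
  linarith

/-- With `Δ` the forward difference, `β(Δũ - ΔU) = (β - 1)Δũ - Δ(Z - ũ) + γΔD`. The first two terms
are small pointwise, as `β - 1 ≤ t²/3`; the last is small only in `ℓ²`. -/
theorem sum_sq_error_le (hA : Admissible k γ (m + 1)) (hf : MemL2 f)
    (h : IsDiscreteSolution m (k * step (m + 1)) γ U D (nodalLoad m f)) :
    ∑ j ∈ Finset.range (m + 1),
      ‖(waveSol (discreteWavenumber k γ (m + 1)) f (node (m + 1) (j + 1))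
          - waveSol (discreteWavenumber k γ (m + 1)) f (node (m + 1) j)) - (U (j + 1) - U j)‖ ^ 2
      ≤ 26000 * ((k * step (m + 1)) ^ 2 * step (m + 1) * l2norm f ^ 2) := by
  have hn : 0 < m + 1 := Nat.succ_pos m
  have hs := hA.step_pos
  have ht0 := hA.pos
  have ht1 := hA.2.2.1
  have hγ6 := hA.2.2.2.2
  have hfi := hf.intervalIntegrable
  have hκ := discreteWavenumber_pos hA
  have hκθ := discreteWavenumber_mul_step hA
  obtain ⟨-, β1, β2⟩ := symbolRoot_spec hA.2.2.2.1 hA.2.2.2.2 ht0 ht1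
  obtain ⟨p1, p2, -⟩ := phase_bounds hA.2.2.2.1 hA.2.2.2.2 ht0 ht1
  have hY := norm_low_sub_wave_le hA hf h rfl
  have hDsum := sum_sq_jump_le hA hf h
  have hcard := card_mul_step m
  have hN := l2norm_nonneg f
  have hl1 := hf.l1_le_l2norm
  set κ := discreteWavenumber k γ (m + 1)
  have hθ2 : κ * step (m + 1) ≤ 2 := by rw [hκθ]; linarith
  have hΔ := fun j (hj : j < m + 1) ↦ norm_waveSol_sub_le hn hκ hθ2 hfi hj
  set s := step (m + 1)
  set t := k * s
  set β := 1 + t ^ 2 / 6 + γ * symbolRoot γ t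
  set N := l2norm f
  set ũ : ℕ → ℂ := fun j ↦ waveSol κ f (node (m + 1) j) with hũ
  have hpt : ∀ j ∈ Finset.range (m + 1), ‖(ũ (j + 1) - ũ j) - (U (j + 1) - U j)‖ ^ 2
      ≤ 19602 * (t ^ 2 * s ^ 2 * N ^ 2) + (‖D (j + 1)‖ ^ 2 + ‖D j‖ ^ 2) / 9 := by
    intro j hj
    have hj' := Finset.mem_range.1 hj
    have h1 := hY j (by omega)
    have h2 := (hΔ j hj').trans (mul_le_mul_of_nonneg_left hl1 (by positivity))
    change ‖ũ (j + 1) - ũ j‖ ≤ 7 * s * N at h2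
    set y := (β * U (j + 1) + γ * D (j + 1) - ũ (j + 1)) - (β * U j + γ * D j - ũ j) with hy
    change ‖y‖ ≤ _ at h1
    have e : (β : ℂ) * ((ũ (j + 1) - ũ j) - (U (j + 1) - U j))
        = ((β - 1 : ℝ) : ℂ) * (ũ (j + 1) - ũ j) - y + γ * (D (j + 1) - D j) := by
      rw [hy]; push_cast; ring
    have e2 := congrArg norm e
    rw [norm_mul, Complex.norm_real, Real.norm_of_nonneg (by linarith)] at e2
    have n1 := norm_add_le (((β - 1 : ℝ) : ℂ) * (ũ (j + 1) - ũ j) - y) (γ * (D (j + 1) - D j))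
    have n2 := norm_sub_le (((β - 1 : ℝ) : ℂ) * (ũ (j + 1) - ũ j)) y
    have n3 := norm_sub_le (D (j + 1)) (D j)
    rw [norm_mul, Complex.norm_real, Real.norm_eq_abs] at n1
    rw [norm_mul, Complex.norm_real, Real.norm_of_nonneg (by linarith)] at n2
    have a1 := mul_le_mul hγ6 n3 (norm_nonneg _) (by norm_num)
    have a2 := mul_le_mul (by linarith : β - 1 ≤ t ^ 2 / 3) h2 (norm_nonneg _) (by positivity)
    have a3 := mul_le_mul_of_nonneg_right β1
      (norm_nonneg ((ũ (j + 1) - ũ j) - (U (j + 1) - U j)))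
    have hpos : 0 ≤ t ^ 2 * s * N := by positivity
    have h6 : t ^ 2 * s * N ≤ t * s * N := by
      refine mul_le_mul_of_nonneg_right (mul_le_mul_of_nonneg_right ?_ hs.le) hN
      nlinarith
    have a4 : ‖(ũ (j + 1) - ũ j) - (U (j + 1) - U j)‖
        ≤ 99 * (t * s * N) + (‖D (j + 1)‖ + ‖D j‖) / 6 := by linarith
    have a5 := pow_le_pow_left₀ (norm_nonneg _) a4 2
    nlinarith [sq_nonneg (99 * (t * s * N) - (‖D (j + 1)‖ + ‖D j‖) / 6),
      sq_nonneg (‖D (j + 1)‖ - ‖D j‖)]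
  refine (Finset.sum_le_sum hpt).trans ?_
  have hD2 : ∑ j ∈ Finset.range (m + 1), ‖D j‖ ^ 2
      ≤ ∑ j ∈ Finset.range (m + 1), ‖D (j + 1)‖ ^ 2 := by
    rw [Finset.sum_range_succ', h.jump_zero, norm_zero, zero_pow two_ne_zero, add_zero,
      Finset.sum_range_succ (fun j ↦ ‖D (j + 1)‖ ^ 2)]
    linarith [sq_nonneg ‖D (m + 1)‖]
  rw [Finset.sum_add_distrib, ← Finset.sum_div, Finset.sum_add_distrib, Finset.sum_const,
    Finset.card_range, nsmul_eq_mul]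
  have e1 : ((m + 1 : ℕ) : ℝ) * (19602 * (t ^ 2 * s ^ 2 * N ^ 2))
      = 19602 * (t ^ 2 * s * N ^ 2) := by
    calc _ = (((m + 1 : ℕ) : ℝ) * s) * (19602 * (t ^ 2 * s * N ^ 2)) := by ring
      _ = _ := by rw [hcard]; ring
  rw [e1]
  have : 0 ≤ t ^ 2 * s * N ^ 2 := by positivity
  linarith

end DiscreteError

/-! ### The energy error and the final estimate. -/

section EnergyError

variable {m : ℕ} {k γ : ℝ} {f u uh : ℝ → ℂ}

theorem hasDerivAt_error (hf : MemL2 f) (hu : IsHelmholtzSolution k f u)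
    (hm : MemFESpace (m + 1) uh) {j : ℕ} (hj : j < m + 1) :
    ∀ x ∈ Ioo (node (m + 1) j) (node (m + 1) (j + 1)),
      HasDerivAt (u - uh) (waveDeriv k f x - slopeOn (m + 1) uh j) x := fun x hx ↦
  (hu.hasDerivAt hf x (open_cell_subset (Nat.succ_pos m) hj hx)).sub
    (hm.hasDerivAt (Nat.succ_pos m) hj hx)

theorem derivJump_error (hf : MemL2 f) (hu : IsHelmholtzSolution k f u)
    (hm : MemFESpace (m + 1) uh) {j : ℕ} (hj : j + 1 < m + 1) :
    derivJump (m + 1) (u - uh) (j + 1) = -derivJump (m + 1) uh (j + 1) := by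
  have hn : 0 < m + 1 := Nat.succ_pos m
  have hnode : node (m + 1) (j + 1) ∈ Ioo (0 : ℝ) 1 := by
    refine ⟨(node_mem hn (by omega)).1.trans_lt (node_lt_succ hn j), ?_⟩
    exact (node_lt_succ hn (j + 1)).trans_le (node_mem hn (by omega)).2
  have hc : ContinuousAt (waveDeriv k f) (node (m + 1) (j + 1)) :=
    (continuousOn_waveDeriv hf.intervalIntegrable).continuousAt (Icc_mem_nhds hnode.1 hnode.2)
  unfold derivJump
  rw [hm.leftLim hn (by omega), hm.rightLim hn hj,
    leftLim_deriv (node_lt_succ hn j) (hasDerivAt_error hf hu hm (by omega))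
      ((hc.tendsto.mono_left nhdsWithin_le_nhds).sub_const _),
    rightLim_deriv (node_lt_succ hn (j + 1)) (hasDerivAt_error hf hu hm hj)
      ((hc.tendsto.mono_left nhdsWithin_le_nhds).sub_const _)]
  ring

/-- The error passes from `u'` to `ũ'` (change of wave number), then to the slope of the interpolant
of `ũ`, then to the slope of `u_h`. -/
theorem norm_deriv_error_le (hA : Admissible k γ (m + 1)) (hf : MemL2 f)
    (uh : ℝ → ℂ) {j : ℕ} (hj : j < m + 1) {x : ℝ}
    (hx : x ∈ Icc (node (m + 1) j) (node (m + 1) (j + 1))) :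
    ‖waveDeriv k f x - slopeOn (m + 1) uh j‖ ≤
      4 * |discreteWavenumber k γ (m + 1) - k| * l2norm f + 24 * (k * step (m + 1)) * l2norm f
      + 2 * cellL1 (m + 1) f j
      + ‖(waveSol (discreteWavenumber k γ (m + 1)) f (node (m + 1) (j + 1))
          - waveSol (discreteWavenumber k γ (m + 1)) f (node (m + 1) j))
        - (nodal (m + 1) uh (j + 1) - nodal (m + 1) uh j)‖ / step (m + 1) := by
  have hn : 0 < m + 1 := Nat.succ_pos m
  have hs := hA.step_pos
  have ht0 := hA.pos
  have ht1 := hA.2.2.1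
  have hfi := hf.intervalIntegrable
  have hκ := discreteWavenumber_pos hA
  have hκθ := discreteWavenumber_mul_step hA
  obtain ⟨p1, p2, -⟩ := phase_bounds hA.2.2.2.1 hA.2.2.2.2 ht0 ht1
  have hl1 := hf.l1_le_l2norm
  have hN1 : 0 ≤ ∫ y in (0 : ℝ)..1, ‖f y‖ :=
    intervalIntegral.integral_nonneg zero_le_one fun _ _ ↦ norm_nonneg _
  set κ := discreteWavenumber k γ (m + 1)
  have hθ2 : κ * step (m + 1) ≤ 2 := by rw [hκθ]; linarith
  have b1 := norm_waveDeriv_sub_le (k := k) (κ := κ) hfi (cell_subset hn hj hx)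
  have b2 := norm_waveDeriv_sub_slope_le hn hκ hθ2 hfi hj hx
  rw [hκθ] at b2
  set ũ := waveSol κ f
  have e : waveDeriv k f x - slopeOn (m + 1) uh j = (waveDeriv k f x - waveDeriv κ f x)
      + (waveDeriv κ f x - (ũ (node (m + 1) (j + 1)) - ũ (node (m + 1) j)) / step (m + 1))
      + ((ũ (node (m + 1) (j + 1)) - ũ (node (m + 1) j))
        - (nodal (m + 1) uh (j + 1) - nodal (m + 1) uh j)) / step (m + 1) := by
    unfold slopeOn nodal; ring
  have n1 := norm_add_le ((waveDeriv k f x - waveDeriv κ f x)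
      + (waveDeriv κ f x - (ũ (node (m + 1) (j + 1)) - ũ (node (m + 1) j)) / step (m + 1)))
      (((ũ (node (m + 1) (j + 1)) - ũ (node (m + 1) j))
        - (nodal (m + 1) uh (j + 1) - nodal (m + 1) uh j)) / step (m + 1))
  have n2 := norm_add_le (waveDeriv k f x - waveDeriv κ f x)
      (waveDeriv κ f x - (ũ (node (m + 1) (j + 1)) - ũ (node (m + 1) j)) / step (m + 1))
  rw [← e, norm_div, Complex.norm_real, Real.norm_of_nonneg hs.le] at n1
  have c1 : 4 * |k - κ| * (∫ y in (0 : ℝ)..1, ‖f y‖) ≤ 4 * |κ - k| * l2norm f := by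
    rw [abs_sub_comm]; exact mul_le_mul_of_nonneg_left hl1 (by positivity)
  have c2 : 12 * phase γ (k * step (m + 1)) * (∫ y in (0 : ℝ)..1, ‖f y‖)
      ≤ 24 * (k * step (m + 1)) * l2norm f := by
    refine mul_le_mul (by linarith) hl1 hN1 (by positivity)
  linarith

theorem l2norm_deriv_error_sq_le (hA : Admissible k γ (m + 1)) (hf : MemL2 f)
    (hu : IsHelmholtzSolution k f u) (hm : MemFESpace (m + 1) uh) {D : ℕ → ℂ}
    (h : IsDiscreteSolution m (k * step (m + 1)) γ (nodal (m + 1) uh) D (nodalLoad m f)) :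
    l2norm (deriv (u - uh)) ^ 2 ≤ 110000 *
      ((k * step (m + 1) + |discreteWavenumber k γ (m + 1) - k|) * l2norm f) ^ 2 := by
  have hn : 0 < m + 1 := Nat.succ_pos m
  have hs := hA.step_pos
  have ht0 := hA.pos
  have hN := l2norm_nonneg f
  have hst : step (m + 1) ≤ k * step (m + 1) := le_mul_of_one_le_left hs.le hA.2.1
  have hcard := card_mul_step m
  have hE := sum_sq_error_le hA hf h
  have hq := sum_cellL1_sq_le hn hf
  have hpt := fun j (hj : j < m + 1) x hx ↦ norm_deriv_error_le (x := x) hA hf uh hj hx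
  set κ := discreteWavenumber k γ (m + 1)
  set E : ℕ → ℝ := fun j ↦ ‖(waveSol κ f (node (m + 1) (j + 1)) - waveSol κ f (node (m + 1) j))
        - (nodal (m + 1) uh (j + 1) - nodal (m + 1) uh j)‖
  set s := step (m + 1) with hsdef
  set t := k * s
  set N := l2norm f
  set δ := |κ - k|
  have hδ : 0 ≤ δ := abs_nonneg _
  have hcong : ∀ j < m + 1, EqOn (fun x ↦ ‖waveDeriv k f x - slopeOn (m + 1) uh j‖ ^ 2)
      (fun x ↦ ‖deriv (u - uh) x‖ ^ 2) (uIoo (node (m + 1) j) (node (m + 1) (j + 1))) := by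
    intro j hj x hx
    rw [uIoo_of_le (node_lt_succ hn j).le] at hx
    simp only [(hasDerivAt_error hf hu hm hj x hx).deriv]
  have hint : ∀ j < m + 1, IntervalIntegrable
      (fun x ↦ ‖waveDeriv k f x - slopeOn (m + 1) uh j‖ ^ 2) volume
      (node (m + 1) j) (node (m + 1) (j + 1)) := by
    intro j hj
    refine ContinuousOn.intervalIntegrable ?_
    rw [uIcc_of_le (node_lt_succ hn j).le]
    exact ((((continuousOn_waveDeriv hf.intervalIntegrable).mono (cell_subset hn hj)).sub
      continuousOn_const).norm).pow 2
  have hcell : ∀ j ∈ Finset.range (m + 1),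
      ∫ x in (node (m + 1) j)..(node (m + 1) (j + 1)), ‖deriv (u - uh) x‖ ^ 2
      ≤ s * (4 * (16 * δ ^ 2 * N ^ 2 + 576 * t ^ 2 * N ^ 2)) + 16 * s * cellL1 (m + 1) f j ^ 2
        + 4 / s * E j ^ 2 := by
    intro j hj
    have hj' := Finset.mem_range.1 hj
    have hE0 : 0 ≤ E j := norm_nonneg _
    have hq0 := cellL1_nonneg hn f j
    rw [← intervalIntegral.integral_congr_uIoo (hcong j hj')]
    have hb : ∀ x ∈ Icc (node (m + 1) j) (node (m + 1) (j + 1)),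
        ‖waveDeriv k f x - slopeOn (m + 1) uh j‖ ^ 2
          ≤ 4 * (16 * δ ^ 2 * N ^ 2 + 576 * t ^ 2 * N ^ 2 + 4 * cellL1 (m + 1) f j ^ 2
            + E j ^ 2 / s ^ 2) := by
      intro x hx
      have h1 : ‖waveDeriv k f x - slopeOn (m + 1) uh j‖
        ≤ 4 * δ * N + 24 * t * N + 2 * cellL1 (m + 1) f j + E j / s := hpt j hj' x hx
      refine (pow_le_pow_left₀ (norm_nonneg _) h1 2).trans ?_
      have four : ∀ a b c d : ℝ, (a + b + c + d) ^ 2 ≤ 4 * (a ^ 2 + b ^ 2 + c ^ 2 + d ^ 2) := by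
        intro a b c d
        nlinarith [sq_nonneg (a - b), sq_nonneg (a - c), sq_nonneg (a - d), sq_nonneg (b - c),
          sq_nonneg (b - d), sq_nonneg (c - d)]
      refine (four _ _ _ _).trans (le_of_eq ?_)
      rw [div_pow]; ring
    have h2 := intervalIntegral.integral_mono_on (node_lt_succ hn j).le (hint j hj')
      intervalIntegrable_const hb
    rw [intervalIntegral.integral_const, node_succ, add_sub_cancel_left, smul_eq_mul,
      ← node_succ] at h2
    refine h2.trans (le_of_eq ?_)
    rw [← hsdef]
    field_simp
    ring
  rw [l2norm_sq, integral_eq_sum_cells hn fun j hj ↦ (hint j hj).congr_uIoo (hcong j hj)]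
  refine (Finset.sum_le_sum hcell).trans ?_
  have hconst : ∑ _j ∈ Finset.range (m + 1), s * (4 * (16 * δ ^ 2 * N ^ 2 + 576 * t ^ 2 * N ^ 2))
      = 4 * (16 * δ ^ 2 * N ^ 2 + 576 * t ^ 2 * N ^ 2) := by
    rw [Finset.sum_const, Finset.card_range, nsmul_eq_mul, ← mul_assoc, hcard, one_mul]
  rw [Finset.sum_add_distrib, Finset.sum_add_distrib, hconst, ← Finset.mul_sum, ← Finset.mul_sum]
  have a1 := mul_le_mul_of_nonneg_left hq (by positivity : 0 ≤ 16 * s)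
  have a2 := mul_le_mul_of_nonneg_left hE (by positivity : 0 ≤ 4 / s)
  have a3 : 4 / s * (26000 * (t ^ 2 * s * N ^ 2)) = 104000 * (t ^ 2 * N ^ 2) := by
    field_simp; ring
  have a4 : s ^ 2 * N ^ 2 ≤ t ^ 2 * N ^ 2 :=
    mul_le_mul_of_nonneg_right (pow_le_pow_left₀ hs.le hst 2) (sq_nonneg _)
  have a5 : 0 ≤ t * δ * N ^ 2 := by positivity
  have a6 : 0 ≤ t ^ 2 * N ^ 2 := by positivity
  have a7 : 0 ≤ δ ^ 2 * N ^ 2 := by positivity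
  rw [a3] at a2
  nlinarith

theorem sum_jump_error_le (hA : Admissible k γ (m + 1)) (hf : MemL2 f)
    (hu : IsHelmholtzSolution k f u) (hm : MemFESpace (m + 1) uh)
    (h : IsDiscreteSolution m (k * step (m + 1)) γ (nodal (m + 1) uh)
      (jumpSeq m (k * step (m + 1)) (nodal (m + 1) uh)) (nodalLoad m f)) :
    ∑ j ∈ Finset.Ico 1 (m + 1), |γ| * step (m + 1) * ‖derivJump (m + 1) (u - uh) j‖ ^ 2
      ≤ 20000 * ((k * step (m + 1)) * l2norm f) ^ 2 := by
  have hs := hA.step_pos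
  have hγ6 := hA.2.2.2.2
  have hD := sum_sq_jump_le hA hf h
  set t := k * step (m + 1)
  set D := jumpSeq m t (nodal (m + 1) uh)
  have hpt : ∀ j ∈ Finset.range m,
      |γ| * step (m + 1) * ‖derivJump (m + 1) (u - uh) (1 + j)‖ ^ 2
        ≤ ‖D (j + 1)‖ ^ 2 / step (m + 1) := by
    intro j hj
    have hj' := Finset.mem_range.1 hj
    have e := congrArg norm (hm.step_mul_derivJump t hj')
    rw [norm_mul, Complex.norm_real, Real.norm_of_nonneg hs.le] at e
    change _ = ‖D (j + 1)‖ at e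
    rw [add_comm 1 j, derivJump_error hf hu hm (by omega), norm_neg, ← e, le_div_iff₀ hs]
    have h0 := sq_nonneg (step (m + 1) * ‖derivJump (m + 1) uh (j + 1)‖)
    nlinarith
  rw [Finset.sum_Ico_eq_sum_range, Nat.add_sub_cancel]
  refine (Finset.sum_le_sum hpt).trans ?_
  rw [← Finset.sum_div, div_le_iff₀ hs]
  rw [Finset.sum_range_succ] at hD
  refine le_trans ?_ (hD.trans (le_of_eq ?_))
  · linarith [sq_nonneg ‖D (m + 1)‖]
  · ring

theorem seminorm1h_error_le {n : ℕ} (hA : Admissible k γ n) (hf : MemL2 f)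
    (hu : IsHelmholtzSolution k f u) (hh : IsCIPSolution k γ n f uh) :
    seminorm1h γ n (u - uh)
      ≤ 400 * ((k * step n + |discreteWavenumber k γ n - k|) * l2norm f) := by
  obtain ⟨m, rfl⟩ : ∃ m, n = m + 1 := ⟨n - 1, by have := hA.1; omega⟩
  obtain ⟨hm, hd⟩ := (isCIPSolution_iff hf.intervalIntegrable).1 hh
  have h1 := l2norm_deriv_error_sq_le hA hf hu hm hd
  have h2 := sum_jump_error_le hA hf hu hm hd
  have ht0 := hA.pos
  have hN := l2norm_nonneg f
  have hδ := abs_nonneg (discreteWavenumber k γ (m + 1) - k)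
  have h3 : ((k * step (m + 1)) * l2norm f) ^ 2
      ≤ ((k * step (m + 1) + |discreteWavenumber k γ (m + 1) - k|) * l2norm f) ^ 2 :=
    pow_le_pow_left₀ (by positivity) (mul_le_mul_of_nonneg_right (by linarith) hN) 2
  unfold seminorm1h
  refine Real.sqrt_le_iff.2 ⟨by positivity, ?_⟩
  -- `110000 + 20000 ≤ 400²`.
  nlinarith [sq_nonneg ((k * step (m + 1) + |discreteWavenumber k γ (m + 1) - k|) * l2norm f)]

end EnergyError

end CIPFEM

theorem mainTheorem1 :
    (∀ (k γ : ℝ) (n : ℕ) (f : ℝ → ℂ), CIPFEM.Admissible k γ n → CIPFEM.MemL2 f →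
      ∃ uh : ℝ → ℂ, CIPFEM.IsCIPSolution k γ n f uh ∧
        ∀ wh : ℝ → ℂ, CIPFEM.IsCIPSolution k γ n f wh → Set.EqOn wh uh (Set.Icc 0 1)) ∧
    (∃ C : ℝ, 0 < C ∧ ∀ (k γ : ℝ) (n : ℕ) (f u uh : ℝ → ℂ),
      CIPFEM.Admissible k γ n → CIPFEM.MemL2 f →
      CIPFEM.IsHelmholtzSolution k f u → CIPFEM.IsCIPSolution k γ n f uh →
        CIPFEM.seminorm1h γ n (u - uh)
            ≤ C * ((k * CIPFEM.step n + |CIPFEM.discreteWavenumber k γ n - k|)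
                * CIPFEM.l2norm f) ∧
        (k * CIPFEM.step n + |CIPFEM.discreteWavenumber k γ n - k|) * CIPFEM.l2norm f
            ≤ C * ((k * CIPFEM.step n + k ^ 3 * CIPFEM.step n ^ 2) * CIPFEM.l2norm f)) ∧
    (∃ C : ℝ, 0 < C ∧ ∀ (k γ : ℝ) (n : ℕ) (f u uh : ℝ → ℂ),
      CIPFEM.Admissible k γ n → CIPFEM.MemL2 f →
      CIPFEM.IsHelmholtzSolution k f u → CIPFEM.IsCIPSolution k γ n f uh →
      γ = -1 / 12 →
        CIPFEM.seminorm1h γ n (u - uh)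
          ≤ C * ((k * CIPFEM.step n + k ^ 5 * CIPFEM.step n ^ 4) * CIPFEM.l2norm f)) ∧
    (∀ C₀ : ℝ, 0 < C₀ → ∃ C : ℝ, 0 < C ∧ ∀ (k γ : ℝ) (n : ℕ) (f u uh : ℝ → ℂ),
      CIPFEM.Admissible k γ n → CIPFEM.MemL2 f →
      CIPFEM.IsHelmholtzSolution k f u → CIPFEM.IsCIPSolution k γ n f uh →
      |γ - CIPFEM.gammaOpt (k * CIPFEM.step n)| ≤ C₀ * (1 / (k ^ 2 * CIPFEM.step n)) →
        CIPFEM.seminorm1h γ n (u - uh) ≤ C * (k * CIPFEM.step n * CIPFEM.l2norm f)) := by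
  refine ⟨fun k γ n f hA hf ↦ CIPFEM.exists_unique_cipSolution hA hf,
    ⟨400, by norm_num, fun k γ n f u uh hA hf hu hh ↦
      ⟨CIPFEM.seminorm1h_error_le hA hf hu hh, ?_⟩⟩,
    -- `7200 = 400 · 18`, the energy constant times the phase-error constant for `γ = -1/12`.
    ⟨7200, by norm_num, fun k γ n f u uh hA hf hu hh hγ ↦ ?_⟩,
    fun C₀ hC₀ ↦ ⟨400 * (1 + 6 * C₀), by positivity, fun k γ n f u uh hA hf hu hh hγ ↦ ?_⟩⟩
  · rw [← mul_assoc]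
    refine mul_le_mul_of_nonneg_right ?_ (CIPFEM.l2norm_nonneg f)
    have h1 := hA.wavenumber_le
    have h2 := hA.pos
    have h3 : 0 ≤ k ^ 3 * CIPFEM.step n ^ 2 :=
      mul_nonneg (pow_nonneg (zero_le_one.trans hA.2.1) 3) (sq_nonneg _)
    linarith
  · subst hγ
    refine (CIPFEM.seminorm1h_error_le hA hf hu hh).trans ?_
    have h1 := hA.wavenumber_le_of_neg_one_twelfth
    have h2 := hA.pos
    rw [← mul_assoc, ← mul_assoc]
    refine mul_le_mul_of_nonneg_right ?_ (CIPFEM.l2norm_nonneg f)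
    linarith
  · refine (CIPFEM.seminorm1h_error_le hA hf hu hh).trans ?_
    have h1 := hA.wavenumber_le_of_gammaOpt hC₀ hγ
    rw [← mul_assoc, ← mul_assoc]
    refine mul_le_mul_of_nonneg_right ?_ (CIPFEM.l2norm_nonneg f)
    linarith
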